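/- Let $(M,J)$ be a compact complex manifold (without boundary) and let $g$ be a smooth Hermitian metric on it, with Kähler form $\omega(X,Y)=g(JX,Y)$. Assume that $g$ is pluriclosed, $dd^c\omega=0$ with $d^c=\sqrt{-1}(\bar\partial-\partial)$, and put $H=-d^c\omega$. Let $f\in C^\infty(M)$ and assume that $(M,g,H,J,f)$ is a steady soliton, i.e. $$\mathrm{Rc}-\tfrac14H^2+\nabla^2f=0,\qquad d^*H+i_{\nabla f}H=0,$$ where $\nabla$ is the Levi-Civita connection and $H^2(X,Y)=\langle i_XH,i_YH\rangle$, i.e. $H^2_{ij}=H_{ikl}H_{jkl}$ in an orthonormal frame. Notation. $\nabla^\pm$ are the Bismut connections, $\langle\nabla^\pm_XY,Z\rangle=\langle\nabla_XY,Z\rangle\pm\tfrac12H(X,Y,Z)$; $\nabla^B=\nabla^+$. The curvature of $\nabla^+$ is $R^+(X,Y,Z,W)=\langle\nabla^+_X\nabla^+_YZ-\nabla^+_Y\nabla^+_XZ-\nabla^+_{[X,Y]}Z,W\rangle$, and $\mathring R^+(\gamma)_{ij}=R^+_{iklj}\gamma_{kl}$ for a $2$-tensor $\gamma$. The mixed connection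 on $2$-tensors is $(\overline\nabla_X\gamma)(Y,Z)=X(\gamma(Y,Z))-\gamma(\nabla^-_XY,Z)-\gamma(Y,\nabla^+_XZ)$. Formal adjoints are taken with respect to the $L^2$ product weighted by $e^{-f}dV_g$; explicitly, for an orthonormal frame $(e_a)$, $\overline\Delta_f=-\overline\nabla^{*_f}\overline\nabla$ with $\overline\nabla^{*_f}T=-\sum_a(\overline\nabla_{e_a}T)(e_a,\cdot,\cdot)+T(\nabla f,\cdot,\cdot)$ (with $\nabla$ acting on the first argument of $T$), and on forms $$d_f^*\alpha=-\sum_a(\nabla_{e_a}\alpha)(e_a,\dots)+i_{\nabla f}\alpha,\qquad (d_f^B)^*\alpha=-\sum_a(\nabla^B_{e_a}\alpha)(e_a,\dots)+i_{\nabla f}\alpha .$$ Set $$\overline L_f(\gamma)=\tfrac12\overline\Delta_f\gamma+\mathring R^+(\gamma),\qquad \Delta_{d,f}=-(d\,d_f^*+d_f^*\,d),$$ $\overline{\mathrm{div}}_f\gamma=(u,v)$ with $u_l=(\nabla^+)^m\gamma_{ml}-\nabla_mf\,\gamma_{ml}$ and $v_l=(\nabla^-)^m\gamma_{lm}-\nabla_mf\,\gamma_{lm}$,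 and let $IGSD$ be the set of smooth $2$-tensors $\gamma$ with $\overline L_f(\gamma)=0$ and $\overline{\mathrm{div}}_f\gamma=0$. Finally $(\gamma\circ J)(X,Y)=\gamma(X,JY)$. Then for every smooth $2$-form $\xi$ on $M$: 1. $\overline L_f(\xi)=0$ if and only if $d\xi=0$, $d_f^*\xi=0$ and $(d_f^B)^*\xi=0$. 2. If $\gamma=\xi\circ J\in IGSD$, then $\gamma\circ J$ is $f$-twisted harmonic, i.e. $\Delta_{d,f}(\gamma\circ J)=0$. -/

import Mathlib

open scoped Manifold ContDiff

noncomputable section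

namespace PluriclosedSoliton

section

variable (E : Type*) [NormedAddCommGroup E] [NormedSpace ℝ E]
  (M : Type*) [TopologicalSpace M] [ChartedSpace E M]

/-- Vector fields on `M` (no regularity is built in). -/
abbrev VField := (x : M) → TangentSpace 𝓘(ℝ, E) x

/-- Covariant `k`-tensor fields on `M`, as functions of a point and of `k` tangent vectors at it.
Multilinearity and smoothness are the predicates `IsTensorField`, `IsDiffForm` below. -/
abbrev TField (k : ℕ) := (x : M) → (Fin k → TangentSpace 𝓘(ℝ, E) x) → ℝ

/-- Operators `(Y, x, v) ↦ (∇_v Y)(x)`, the type of the connections on `TM` below. -/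
abbrev Conn := VField E M → (x : M) → TangentSpace 𝓘(ℝ, E) x → TangentSpace 𝓘(ℝ, E) x

/-- Fields of endomorphisms of `TM`. -/
abbrev EndField := (x : M) → TangentSpace 𝓘(ℝ, E) x →L[ℝ] TangentSpace 𝓘(ℝ, E) x

/-- Smooth Riemannian metrics on `M`. -/
abbrev RMetric [IsManifold 𝓘(ℝ, E) ∞ M] :=
  Bundle.ContMDiffRiemannianMetric 𝓘(ℝ, E) ∞ E (fun x : M => TangentSpace 𝓘(ℝ, E) x)

end

variable {E : Type*} [NormedAddCommGroup E] [NormedSpace ℝ E]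
  {M : Type*} [TopologicalSpace M] [ChartedSpace E M] [IsManifold 𝓘(ℝ, E) ∞ M]

/-! ### Smooth tensor fields and differential forms -/

/-- The vector field is smooth at `x`. -/
def SmoothVFieldAt (X : VField E M) (x : M) : Prop :=
  ContMDiffAt 𝓘(ℝ, E) 𝓘(ℝ, E).tangent ∞ (fun y => (⟨y, X y⟩ : TangentBundle 𝓘(ℝ, E) M)) x

/-- The tensor field takes smooth vector fields to smooth functions. -/
def IsSmooth {k : ℕ} (T : TField E M k) : Prop :=
  ∀ (x : M) (X : Fin k → VField E M), (∀ i, SmoothVFieldAt (X i) x) →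
    ContMDiffAt 𝓘(ℝ, E) 𝓘(ℝ, ℝ) ∞ (fun y => T y (fun i => X i y)) x

/-- Smooth covariant `k`-tensor fields, i.e. smooth sections of `⊗ᵏ T*M`. -/
structure IsTensorField {k : ℕ} (T : TField E M k) : Prop where
  multilinear : ∀ x, ∃ A : MultilinearMap ℝ (fun _ : Fin k => TangentSpace 𝓘(ℝ, E) x) ℝ,
    T x = fun w => A w
  smooth : IsSmooth T

/-- Smooth differential `k`-forms. -/
structure IsDiffForm {k : ℕ} (T : TField E M k) : Prop where
  alternating : ∀ x, ∃ A : (TangentSpace 𝓘(ℝ, E) x) [⋀^Fin k]→ₗ[ℝ] ℝ, T x = fun w => A w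
  smooth : IsSmooth T

/-! ### Derivatives in coordinates -/

/-- The extension of a tangent vector at `x` to a vector field that has constant coefficients in
the preferred chart at `x`. Any two such fields commute near `x`. -/
def constExt {x : M} (v : TangentSpace 𝓘(ℝ, E) x) : VField E M :=
  FiberBundle.extend E (E := fun y : M => TangentSpace 𝓘(ℝ, E) y) v

/-- The derivative of the function `φ` in the direction of the tangent vector `v`. -/
def dirDeriv (φ : M → ℝ) {x : M} (v : TangentSpace 𝓘(ℝ, E) x) : ℝ :=
  mvfderiv 𝓘(ℝ, E) φ x v

/-- The exterior derivative. In the preferred chart at `x` this is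
`(dT)(w₀, …, w_k) = ∑ᵢ (-1)ⁱ ∂_{wᵢ} (T(w₀, …, ŵᵢ, …, w_k))`. -/
def extD {k : ℕ} (T : TField E M k) : TField E M (k + 1) := fun x w =>
  ∑ i : Fin (k + 1), (-1 : ℝ) ^ (i : ℕ) *
    dirDeriv (fun y => T y (fun j => constExt (w (i.succAbove j)) y)) (w i)

/-- The differential of a function, as a `1`-tensor. -/
def dFun (f : M → ℝ) : TField E M 1 := fun _ w => dirDeriv f (w 0)

/-- The covariant derivative of a covariant tensor field, where the connection `D i` acts on the
`i`-th argument; the direction of differentiation is the first argument of the result: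
`(∇T)(v, w₁, …, w_k) = v(T(w₁, …, w_k)) - ∑ᵢ T(w₁, …, Dᵢ_v wᵢ, …, w_k)`. -/
def covD {k : ℕ} (D : Fin k → Conn E M) (T : TField E M k) : TField E M (k + 1) := fun x w =>
  dirDeriv (fun y => T y (fun i => constExt (w i.succ) y)) (w 0)
    - ∑ i : Fin k, T x (Function.update (fun j => w j.succ) i (D i (constExt (w i.succ)) x (w 0)))

/-! ### Riemannian geometry -/

theorem exists_orthonormal_basis [FiniteDimensional ℝ E] (g : RMetric E M) (x : M) :
    ∃ b : Module.Basis (Fin (Module.finrank ℝ E)) ℝ (TangentSpace 𝓘(ℝ, E) x),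
      ∀ i j, g.inner x (b i) (b j) = if i = j then 1 else 0 := by
  let V := TangentSpace 𝓘(ℝ, E) x
  have : FiniteDimensional ℝ V := inferInstanceAs (FiniteDimensional ℝ E)
  let core : InnerProductSpace.Core ℝ V :=
    { inner := fun v w => g.inner x v w
      conj_inner_symm := fun v w => by simpa using g.symm x w v
      re_inner_nonneg := fun v => by
        by_cases hv : v = 0
        · simp [hv]
        · simpa using (g.pos x v hv).le
      add_left := fun u v w => by simp
      smul_left := fun v w r => by simp
      definite := fun v hv => by
        by_contra h
        exact (g.pos x v h).ne' hv }
  letI : NormedAddCommGroup V := core.toNormedAddCommGroup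
  letI : InnerProductSpace ℝ V := InnerProductSpace.ofCore core.toCore
  let b := stdOrthonormalBasis ℝ V
  refine ⟨b.toBasis, fun i j => ?_⟩
  have h := orthonormal_iff_ite.mp b.orthonormal i j
  rw [← b.coe_toBasis] at h
  exact h

variable [FiniteDimensional ℝ E]

/-- An orthonormal basis `(e_a)` of `T_x M`. All expressions in which it is used below are traces,
and so do not depend on the choice. -/
def onb (g : RMetric E M) (x : M) :
    Module.Basis (Fin (Module.finrank ℝ E)) ℝ (TangentSpace 𝓘(ℝ, E) x) :=
  (exists_orthonormal_basis g x).choose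

/-- The gradient of a function. -/
def grad (g : RMetric E M) (f : M → ℝ) : VField E M := fun x =>
  ∑ a, dirDeriv f (onb g x a) • onb g x a

/-- The right-hand side of the Koszul formula, `2 g(∇_X Y, Z)`. -/
def koszul (g : RMetric E M) (X Y Z : VField E M) (x : M) : ℝ :=
  dirDeriv (fun y => g.inner y (Y y) (Z y)) (X x)
    + dirDeriv (fun y => g.inner y (Z y) (X y)) (Y x)
    - dirDeriv (fun y => g.inner y (X y) (Y y)) (Z x)
    + g.inner x (VectorField.mlieBracket 𝓘(ℝ, E) X Y x) (Z x)
    - g.inner x (VectorField.mlieBracket 𝓘(ℝ, E) Y Z x) (X x)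
    + g.inner x (VectorField.mlieBracket 𝓘(ℝ, E) Z X x) (Y x)

/-- The Levi-Civita connection `∇`. -/
def leviCivita (g : RMetric E M) : Conn E M := fun Y x v =>
  ∑ a, ((1 / 2 : ℝ) * koszul g (constExt v) Y (constExt (onb g x a)) x) • onb g x a

/-- The connection with `⟨∇ˢ_X Y, Z⟩ = ⟨∇_X Y, Z⟩ + (s/2) H(X, Y, Z)`. -/
def bismut (g : RMetric E M) (H : TField E M 3) (s : ℝ) : Conn E M := fun Y x v =>
  leviCivita g Y x v + ∑ a, (s / 2 * H x ![v, Y x, onb g x a]) • onb g x a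

/-- The Bismut connection `∇⁺`. For `H = -dᶜω` it is the Bismut connection `∇ᴮ` of a Hermitian
manifold. -/
def bismutPlus (g : RMetric E M) (H : TField E M 3) : Conn E M := bismut g H 1

/-- The Bismut connection `∇⁻`. -/
def bismutMinus (g : RMetric E M) (H : TField E M 3) : Conn E M := bismut g H (-1)

/-- The curvature `R(X, Y, Z, W) = ⟨∇_X ∇_Y Z - ∇_Y ∇_X Z - ∇_{[X,Y]} Z, W⟩` of a connection. -/
def curv (g : RMetric E M) (D : Conn E M) : TField E M 4 := fun x w =>
  g.inner x
    (D (fun y => D (constExt (w 2)) y (constExt (w 1) y)) x (w 0)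
      - D (fun y => D (constExt (w 2)) y (constExt (w 0) y)) x (w 1)
      - D (constExt (w 2)) x (VectorField.mlieBracket 𝓘(ℝ, E) (constExt (w 0)) (constExt (w 1)) x))
    (w 3)

/-- The Ricci curvature of `g`. -/
def ricci (g : RMetric E M) : TField E M 2 := fun x w =>
  ∑ a, curv g (leviCivita g) x ![onb g x a, w 0, w 1, onb g x a]

/-- The Hessian `∇²f`. -/
def hessian (g : RMetric E M) (f : M → ℝ) : TField E M 2 :=
  covD (fun _ => leviCivita g) (dFun f)

/-- `H²(X, Y) = ⟨i_X H, i_Y H⟩`, i.e. `H²_{ij} = H_{ikl} H_{jkl}`. -/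
def Hsq (g : RMetric E M) (H : TField E M 3) : TField E M 2 := fun x w =>
  ∑ a, ∑ b, H x ![w 0, onb g x a, onb g x b] * H x ![w 1, onb g x a, onb g x b]

/-- The formal adjoint of a covariant derivative for the `L²` product weighted by `e^{-f} dV_g`:
`T ↦ -∑_a (∇_{e_a} T)(e_a, …) + T(∇f, …)`, where the connection `D i` acts on the `i`-th argument
of `T`. -/
def adjD {k : ℕ} (g : RMetric E M) (D : Fin (k + 1) → Conn E M) (f : M → ℝ)
    (T : TField E M (k + 1)) : TField E M k := fun x w =>
  - ∑ a, covD D T x (Matrix.vecCons (onb g x a) (Matrix.vecCons (onb g x a) w))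
    + T x (Matrix.vecCons (grad g f x) w)

/-- The `f`-twisted codifferential `d_f^* = d^* + i_{∇f}`, the formal adjoint of `d` on forms for
the weight `e^{-f} dV_g`. -/
def dStar {k : ℕ} (g : RMetric E M) (f : M → ℝ) (T : TField E M (k + 1)) : TField E M k :=
  adjD g (fun _ => leviCivita g) f T

/-- The `f`-twisted Bismut codifferential `(d_f^B)^*`, the formal adjoint, for the weight
`e^{-f} dV_g`, of the skew-symmetrized covariant derivative `d^B` of the connection `∇⁺ = ∇ᴮ`. -/
def dStarB {k : ℕ} (g : RMetric E M) (H : TField E M 3) (f : M → ℝ) (T : TField E M (k + 1)) :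
    TField E M k :=
  adjD g (fun _ => bismutPlus g H) f T

/-- The `f`-twisted Hodge Laplacian `Δ_{d,f} = -(d d_f^* + d_f^* d)`. -/
def hodgeLap {k : ℕ} (g : RMetric E M) (f : M → ℝ) (T : TField E M (k + 1)) :
    TField E M (k + 1) :=
  -(extD (dStar g f T) + dStar g f (extD T))

/-! ### The operator `L̄_f` and infinitesimal deformations -/

/-- The mixed Bismut connection on `2`-tensors:
`(∇̄_X γ)(Y, Z) = X(γ(Y, Z)) - γ(∇⁻_X Y, Z) - γ(Y, ∇⁺_X Z)`. -/
def mixedD (g : RMetric E M) (H : TField E M 3) (γ : TField E M 2) : TField E M 3 :=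
  covD ![bismutMinus g H, bismutPlus g H] γ

/-- `Δ̄_f = -∇̄^{*_f} ∇̄`, i.e. `∑_a ∇̄²_{e_a, e_a} γ - ∇̄_{∇f} γ`. -/
def mixedLap (g : RMetric E M) (H : TField E M 3) (f : M → ℝ) (γ : TField E M 2) :
    TField E M 2 :=
  -adjD g ![leviCivita g, bismutMinus g H, bismutPlus g H] f (mixedD g H γ)

/-- `R̊⁺(γ)_{ij} = R⁺_{iklj} γ_{kl}`. -/
def ringR (g : RMetric E M) (H : TField E M 3) (γ : TField E M 2) : TField E M 2 := fun x w =>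
  ∑ a, ∑ b, curv g (bismutPlus g H) x ![w 0, onb g x a, onb g x b, w 1]
    * γ x ![onb g x a, onb g x b]

/-- `L̄_f = ½ Δ̄_f + R̊⁺`. -/
def Lbar (g : RMetric E M) (H : TField E M 3) (f : M → ℝ) (γ : TField E M 2) : TField E M 2 :=
  (1 / 2 : ℝ) • mixedLap g H f γ + ringR g H γ

/-- The `f`-twisted divergence `(u, v)` of a `2`-tensor with respect to the mixed connection:
`u_l = (∇⁺)^m γ_{ml} - ∇_m f γ_{ml}` and `v_l = (∇⁻)^m γ_{lm} - ∇_m f γ_{lm}`. -/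
def divBar (g : RMetric E M) (H : TField E M 3) (f : M → ℝ) (γ : TField E M 2) :
    TField E M 1 × TField E M 1 :=
  (fun x w => ∑ a, covD (fun _ => bismutPlus g H) γ x ![onb g x a, onb g x a, w 0]
      - γ x ![grad g f x, w 0],
   fun x w => ∑ a, covD (fun _ => bismutMinus g H) γ x ![onb g x a, w 0, onb g x a]
      - γ x ![w 0, grad g f x])

/-- The essential infinitesimal generalized solitonic deformations. -/
def IGSD (g : RMetric E M) (H : TField E M 3) (f : M → ℝ) : Set (TField E M 2) :=
  {γ | IsTensorField γ ∧ Lbar g H f γ = 0 ∧ divBar g H f γ = 0}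

/-! ### Complex geometry -/

/-- `J` is an integrable almost complex structure: smooth, `J² = -1`, with vanishing Nijenhuis
tensor. -/
structure IsComplexStructure (J : EndField E M) : Prop where
  sq : ∀ x v, J x (J x v) = -v
  smooth : ∀ x (X : VField E M), SmoothVFieldAt X x → SmoothVFieldAt (fun y => J y (X y)) x
  integrable : ∀ x (X Y : VField E M), SmoothVFieldAt X x → SmoothVFieldAt Y x →
    VectorField.mlieBracket 𝓘(ℝ, E) (fun y => J y (X y)) (fun y => J y (Y y)) x
      - J x (VectorField.mlieBracket 𝓘(ℝ, E) (fun y => J y (X y)) Y x)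
      - J x (VectorField.mlieBracket 𝓘(ℝ, E) X (fun y => J y (Y y)) x)
      - VectorField.mlieBracket 𝓘(ℝ, E) X Y x = 0

/-- The Kähler form `ω(X, Y) = g(JX, Y)`. -/
def kahlerForm (g : RMetric E M) (J : EndField E M) : TField E M 2 := fun x w =>
  g.inner x (J x (w 0)) (w 1)

/-- The action `α ↦ α(A·, …, A·)` of an endomorphism field on covariant tensors. -/
def pullEnd {k : ℕ} (A : EndField E M) (T : TField E M k) : TField E M k := fun x w =>
  T x (fun i => A x (w i))

/-- `dᶜ = J⁻¹ d J`, where `J` acts on forms by `α ↦ α(J·, …, J·)` and `J⁻¹ = -J` on `TM`. Since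
`α(J·, …, J·) = i^{p-q} α` for `α` of type `(p, q)`, this is `dᶜ = √-1 (∂̄ - ∂)`. -/
def dc {k : ℕ} (J : EndField E M) (T : TField E M k) : TField E M (k + 1) :=
  pullEnd (fun x => -J x) (extD (pullEnd J T))

/-- `γ ∘ J = γ(·, J·)`. -/
def compJ (J : EndField E M) (γ : TField E M 2) : TField E M 2 := fun x w =>
  γ x ![w 0, J x (w 1)]

/-- `(M, g, H, J, f)` is a pluriclosed steady soliton: `(M, g, J)` is Hermitian, `dd^cω = 0`,
`H = -dᶜω`, and `Rc - ¼ H² + ∇²f = 0`, `d^*H + i_{∇f} H = 0`. -/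
structure IsPluriclosedSteadySoliton (g : RMetric E M) (H : TField E M 3) (J : EndField E M)
    (f : M → ℝ) : Prop where
  complexStructure : IsComplexStructure J
  hermitian : ∀ x v w, g.inner x (J x v) (J x w) = g.inner x v w
  pluriclosed : extD (dc J (kahlerForm g J)) = 0
  torsion : H = -dc J (kahlerForm g J)
  smooth : ContMDiff 𝓘(ℝ, E) 𝓘(ℝ, ℝ) ∞ f
  ricci_eq : ricci g - (1 / 4 : ℝ) • Hsq g H + hessian g f = 0
  dStar_eq : dStar g f H = 0

end PluriclosedSoliton

end

open scoped Manifold ContDiff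
open PluriclosedSoliton

/-!
The proof is a Bochner argument. Write `ξ` for the `2`-form, `δ = d_f^* ξ`, `σ = dξ`, and let
`η(X) = ⟨i_X H, ξ⟩` (`contr₂ g H ξ`), so that `(d_f^B)^* ξ = d_f^* ξ - η / 2` (`dStarB_frame`).

*Pointwise identities.* In an orthonormal frame `L̄_f ξ` is a polynomial in the components of `ξ`,
`H`, the curvature and their covariant derivatives (`Lbar_frame`). The Ricci identity, the Bianchi
identities, `dH = 0` and the two soliton equations turn its skew part into
`2 (L̄_{bc} - L̄_{cb}) = 2 (Δ_{d,f} ξ)_{bc} - ∑ H_{bcm} η_m` (`Lbar_sub_frame`); when `dξ = 0`, its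
symmetric part is `2 (L̄_{bc} + L̄_{cb}) = ∇_b η_c + ∇_c η_b` (`Lbar_add_frame`). Hence
`δ = σ = η = 0` implies `L̄_f ξ = 0` (`Lbar_eq_zero`). Conversely, pairing the skew part with `ξ`
shows that `L̄_f ξ = 0` makes `|η|² + 4 |δ|² + ⅔ |σ|²` a twisted divergence (`energy_identity`), and
on a compact manifold the weighted divergence theorem forces it to vanish
(`eq_zero_of_Lbar_eq_zero`).

*The divergence theorem.* Only the following consequence of it is needed: a divergence that is
nowhere negative vanishes (`divg_eq_zero_of_nonneg`). It is proved with the Riemannian density in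
charts and a finite partition of unity, so no measure on `M` is constructed and `M` need not be
oriented.

*The complex structure.* Integrability of `J` and `H = -dᶜω` give `∇⁺ J = 0` (`bismutPlus_J`). The
mixed connection acts by `∇⁺` on the second argument of a `2`-tensor, so `L̄_f` commutes with
`γ ↦ γ ∘ J` (`Lbar_compJ`). Thus `L̄_f (ξ ∘ J) = 0` implies `L̄_f ξ = 0`, so that `ξ`, and with it
`ξ ∘ J ∘ J = -ξ`, is closed and `d_f^*`-closed.

*Tensor calculus.* The operators are defined through extensions of tangent vectors that are constant
in a chart. Every local field agrees near a point with a globally smooth one, and expressions that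
are `C^∞`-linear in a field depend on its value only (`eq_of_tensorial`); so all of them can be
computed with arbitrary global smooth fields, in particular with fields that are parallel at the
given point (`exists_parallelFrame`).
-/

open scoped Manifold ContDiff Topology
open VectorField Filter

noncomputable section

namespace PluriclosedSoliton

/-! ### Derivatives of functions and smooth vector fields -/

section Calculus

variable {E : Type*} [NormedAddCommGroup E] [NormedSpace ℝ E]
  {M : Type*} [TopologicalSpace M] [ChartedSpace E M]

variable (E) in
/-- Smooth real functions on `M`. -/
abbrev SmoothFn (φ : M → ℝ) : Prop := ContMDiff 𝓘(ℝ, E) 𝓘(ℝ, ℝ) ∞ φ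

variable (E) in
/-- Differentiability of a real function on `M` at a point. -/
abbrev DiffFnAt (φ : M → ℝ) (x : M) : Prop := MDifferentiableAt 𝓘(ℝ, E) 𝓘(ℝ, ℝ) φ x

lemma SmoothFn.diff {φ : M → ℝ} (h : SmoothFn E φ) (x : M) : DiffFnAt E φ x :=
  h.mdifferentiableAt (by simp)

lemma dirDeriv_congr {φ ψ : M → ℝ} {x : M} (h : φ =ᶠ[𝓝 x] ψ) (v : TangentSpace 𝓘(ℝ, E) x) :
    dirDeriv φ v = dirDeriv ψ v := by
  have h0 := h.eq_of_nhds
  have h1 : (mfderiv 𝓘(ℝ, E) 𝓘(ℝ, ℝ) φ x : E → ℝ) = mfderiv 𝓘(ℝ, E) 𝓘(ℝ, ℝ) ψ x := by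
    ext v
    exact congrArg (fun L : E →L[ℝ] ℝ => L v) (h.mfderiv_eq (I := 𝓘(ℝ, E)) (I' := 𝓘(ℝ, ℝ)))
  exact congrFun h1 v

lemma dirDeriv_add {φ ψ : M → ℝ} {x : M} (hφ : DiffFnAt E φ x) (hψ : DiffFnAt E ψ x)
    (v : TangentSpace 𝓘(ℝ, E) x) :
    dirDeriv (fun y => φ y + ψ y) v = dirDeriv φ v + dirDeriv ψ v := by
  exact congrArg (fun L : TangentSpace 𝓘(ℝ, E) x →L[ℝ] ℝ => L v) (mvfderiv_add hφ hψ)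

lemma dirDeriv_sub {φ ψ : M → ℝ} {x : M} (hφ : DiffFnAt E φ x) (hψ : DiffFnAt E ψ x)
    (v : TangentSpace 𝓘(ℝ, E) x) :
    dirDeriv (fun y => φ y - ψ y) v = dirDeriv φ v - dirDeriv ψ v := by
  exact congrArg (fun L : TangentSpace 𝓘(ℝ, E) x →L[ℝ] ℝ => L v) (mvfderiv_sub hφ hψ)

lemma dirDeriv_neg (φ : M → ℝ) {x : M} (v : TangentSpace 𝓘(ℝ, E) x) :
    dirDeriv (fun y => - φ y) v = - dirDeriv φ v := by
  exact congrArg (fun L : TangentSpace 𝓘(ℝ, E) x →L[ℝ] ℝ => L v) (mvfderiv_neg (g := φ))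

lemma dirDeriv_mul {φ ψ : M → ℝ} {x : M} (hφ : DiffFnAt E φ x) (hψ : DiffFnAt E ψ x)
    (v : TangentSpace 𝓘(ℝ, E) x) :
    dirDeriv (fun y => φ y * ψ y) v = φ x * dirDeriv ψ v + ψ x * dirDeriv φ v := by
  have := congrArg (fun L : TangentSpace 𝓘(ℝ, E) x →L[ℝ] ℝ => L v) (mvfderiv_mul hφ hψ)
  simpa using! this

lemma dirDeriv_const (c : ℝ) {x : M} (v : TangentSpace 𝓘(ℝ, E) x) :
    dirDeriv (fun _ : M => c) v = 0 := by
  exact congrArg (fun L : TangentSpace 𝓘(ℝ, E) x →L[ℝ] ℝ => L v) (mvfderiv_const (c := c))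

lemma dirDeriv_const_mul (c : ℝ) {φ : M → ℝ} {x : M} (hφ : DiffFnAt E φ x)
    (v : TangentSpace 𝓘(ℝ, E) x) :
    dirDeriv (fun y => c * φ y) v = c * dirDeriv φ v := by
  rw [dirDeriv_mul mdifferentiableAt_const hφ, dirDeriv_const]; simp

lemma DiffFnAt.sum {ι : Type*} {s : Finset ι} {φ : ι → M → ℝ} {x : M}
    (hφ : ∀ i ∈ s, DiffFnAt E (φ i) x) : DiffFnAt E (fun y => ∑ i ∈ s, φ i y) x := by
  classical
  induction s using Finset.induction_on with
  | empty => simpa using mdifferentiableAt_const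
  | insert a s ha ih =>
    simp only [Finset.sum_insert ha]
    exact (hφ a (by simp)).add (ih fun i hi => hφ i (by simp [hi]))

lemma dirDeriv_sum {ι : Type*} {s : Finset ι} {φ : ι → M → ℝ} {x : M}
    (hφ : ∀ i ∈ s, DiffFnAt E (φ i) x) (v : TangentSpace 𝓘(ℝ, E) x) :
    dirDeriv (fun y => ∑ i ∈ s, φ i y) v = ∑ i ∈ s, dirDeriv (φ i) v := by
  classical
  induction s using Finset.induction_on with
  | empty => simpa using dirDeriv_const (0 : ℝ) v
  | insert a s ha ih =>
    simp only [Finset.sum_insert ha]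
    rw [dirDeriv_add (hφ a (by simp)) (DiffFnAt.sum fun i hi => hφ i (by simp [hi])),
      ih fun i hi => hφ i (by simp [hi])]

lemma dirDeriv_vadd (φ : M → ℝ) {x : M} (v w : TangentSpace 𝓘(ℝ, E) x) :
    dirDeriv φ (v + w) = dirDeriv φ v + dirDeriv φ w := map_add _ _ _

lemma dirDeriv_vsmul (φ : M → ℝ) {x : M} (c : ℝ) (v : TangentSpace 𝓘(ℝ, E) x) :
    dirDeriv φ (c • v) = c * dirDeriv φ v := map_smul _ _ _

lemma dirDeriv_vsum {ι : Type*} {s : Finset ι} (φ : M → ℝ) {x : M}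
    (v : ι → TangentSpace 𝓘(ℝ, E) x) :
    dirDeriv φ (∑ i ∈ s, v i) = ∑ i ∈ s, dirDeriv φ (v i) := map_sum _ _ _

variable [IsManifold 𝓘(ℝ, E) ∞ M]

instance isManifold_minSmoothness_two : IsManifold 𝓘(ℝ, E) (minSmoothness ℝ 2) M := by
  rw [minSmoothness_of_isRCLikeNormedField]
  infer_instance

instance isManifold_minSmoothness_three : IsManifold 𝓘(ℝ, E) (minSmoothness ℝ 3) M := by
  rw [minSmoothness_of_isRCLikeNormedField]
  infer_instance

/-- Smooth vector fields on `M`. -/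
def SmoothVF (X : VField E M) : Prop := ∀ x, SmoothVFieldAt X x

lemma SmoothVFieldAt.mdiff {X : VField E M} {x : M} (h : SmoothVFieldAt X x) :
    MDifferentiableAt 𝓘(ℝ, E) 𝓘(ℝ, E).tangent (fun y => (⟨y, X y⟩ : TangentBundle 𝓘(ℝ, E) M)) x :=
  ContMDiffAt.mdifferentiableAt h (by simp)

lemma SmoothVFieldAt.add {X Y : VField E M} {x : M} (hX : SmoothVFieldAt X x)
    (hY : SmoothVFieldAt Y x) : SmoothVFieldAt (fun y => X y + Y y) x :=
  ContMDiffAt.add_section hX hY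

lemma SmoothVFieldAt.smul {φ : M → ℝ} {X : VField E M} {x : M}
    (hφ : ContMDiffAt 𝓘(ℝ, E) 𝓘(ℝ, ℝ) ∞ φ x) (hX : SmoothVFieldAt X x) :
    SmoothVFieldAt (fun y => φ y • X y) x :=
  ContMDiffAt.smul_section hφ hX

lemma SmoothVFieldAt.sum {ι : Type*} {s : Finset ι} {X : ι → VField E M} {x : M}
    (h : ∀ i ∈ s, SmoothVFieldAt (X i) x) : SmoothVFieldAt (fun y => ∑ i ∈ s, X i y) x :=
  ContMDiffAt.sum_section h

lemma SmoothVFieldAt.congr {X Y : VField E M} {x : M} (hX : SmoothVFieldAt X x)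
    (h : Y =ᶠ[𝓝 x] X) : SmoothVFieldAt Y x :=
  ContMDiffAt.congr_of_eventuallyEq hX (h.mono fun y hy => by simp [hy])

namespace SmoothVF

lemma zero : SmoothVF (fun _ => 0 : VField E M) := fun x =>
  Bundle.contMDiff_zeroSection ℝ (TangentSpace 𝓘(ℝ, E) (M := M)) x

lemma add {X Y : VField E M} (hX : SmoothVF X) (hY : SmoothVF Y) :
    SmoothVF (fun y => X y + Y y) := fun x => (hX x).add (hY x)

lemma sub {X Y : VField E M} (hX : SmoothVF X) (hY : SmoothVF Y) :
    SmoothVF (fun y => X y - Y y) := fun x => ContMDiffAt.sub_section (hX x) (hY x)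

lemma smul {φ : M → ℝ} {X : VField E M} (hφ : SmoothFn E φ) (hX : SmoothVF X) :
    SmoothVF (fun y => φ y • X y) := fun x => (hX x).smul (hφ x)

lemma const_smul (c : ℝ) {X : VField E M} (hX : SmoothVF X) :
    SmoothVF (fun y => c • X y) := smul contMDiff_const hX

lemma sum {ι : Type*} {s : Finset ι} {X : ι → VField E M}
    (h : ∀ i ∈ s, SmoothVF (X i)) : SmoothVF (fun y => ∑ i ∈ s, X i y) :=
  fun x => SmoothVFieldAt.sum fun i hi => h i hi x

lemma mlieBracket [CompleteSpace E] {X Y : VField E M} (hX : SmoothVF X) (hY : SmoothVF Y) :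
    SmoothVF (mlieBracket 𝓘(ℝ, E) X Y) := fun x =>
  have : IsManifold 𝓘(ℝ, E) (((⊤ : ℕ∞) : WithTop ℕ∞) + 1) M := by
    rwa [show (((⊤ : ℕ∞) : WithTop ℕ∞) + 1) = ∞ from rfl]
  ContMDiffAt.mlieBracket_vectorField (n := ⊤) (m := ⊤) (hX x) (hY x)
    (by rw [minSmoothness_of_isRCLikeNormedField]; rfl)

lemma dirDeriv {φ : M → ℝ} {X : VField E M} (hφ : SmoothFn E φ) (hX : SmoothVF X) :
    SmoothFn E (fun y => dirDeriv φ (X y)) := by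
  have h1 : ContMDiff 𝓘(ℝ, E) 𝓘(ℝ, ℝ).tangent ∞
      (fun y => tangentMap 𝓘(ℝ, E) 𝓘(ℝ, ℝ) φ ⟨y, X y⟩) :=
    (hφ.contMDiff_tangentMap (m := ∞) (by simp)).comp (fun x => hX x)
  have h2 := contMDiff_snd_tangentBundle_modelSpace ℝ 𝓘(ℝ, ℝ) (n := ∞)
  exact h2.comp h1

end SmoothVF

/-- The derivative of a function read in a chart. -/
lemma fderiv_comp_extChartAt_symm {c : M} {u : E} (hu : u ∈ (extChartAt 𝓘(ℝ, E) c).target)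
    {φ : M → ℝ} (hφ : DiffFnAt E φ ((extChartAt 𝓘(ℝ, E) c).symm u)) (e : E) :
    fderiv ℝ (fun z => φ ((extChartAt 𝓘(ℝ, E) c).symm z)) u e =
      dirDeriv φ (mfderiv 𝓘(ℝ, E) 𝓘(ℝ, E) (extChartAt 𝓘(ℝ, E) c).symm u e) := by
  have h1 : MDifferentiableAt 𝓘(ℝ, E) 𝓘(ℝ, E) (extChartAt 𝓘(ℝ, E) c).symm u :=
    (mdifferentiableOn_extChartAt_symm u hu).mdifferentiableAt
      ((isOpen_extChartAt_target c).mem_nhds hu)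
  have h2 := mvfderiv_comp_apply u hφ h1 e
  rw [dirDeriv, ← h2]
  simp only [mvfderiv, mfderiv_eq_fderiv]
  rfl

/-- `[X, Y] φ = X (Y φ) - Y (X φ)`, by symmetry of second derivatives in a chart. -/
lemma mlieBracket_dirDeriv [CompleteSpace E] {X Y : VField E M} {φ : M → ℝ} (hX : SmoothVF X)
    (hY : SmoothVF Y) (hφ : SmoothFn E φ) (x : M) :
    dirDeriv φ (mlieBracket 𝓘(ℝ, E) X Y x) =
      dirDeriv (fun y => dirDeriv φ (Y y)) (X x) - dirDeriv (fun y => dirDeriv φ (X y)) (Y x) := by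
  set s := extChartAt 𝓘(ℝ, E) x with hs
  have hso : IsOpen s.target := isOpen_extChartAt_target x
  have hx : s x ∈ s.target := mem_extChartAt_target x
  have hsx : s.symm (s x) = x := extChartAt_to_inv x
  have hinv : ∀ u ∈ s.target, (mfderiv 𝓘(ℝ, E) 𝓘(ℝ, E) s.symm u).IsInvertible := fun u hu => by
    have := isInvertible_mfderivWithin_extChartAt_symm (I := 𝓘(ℝ, E)) (x := x) hu
    simpa only [modelWithCornersSelf_coe, Set.range_id, mfderivWithin_univ] using this
  let R : VField E M → E → E := fun Z u => (mfderiv 𝓘(ℝ, E) 𝓘(ℝ, E) s.symm u).inverse (Z (s.symm u))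
  have hR : ∀ Z : VField E M, ∀ u ∈ s.target,
      mfderiv 𝓘(ℝ, E) 𝓘(ℝ, E) s.symm u (R Z u) = Z (s.symm u) := fun Z u hu =>
    (((hinv u hu).inverse_apply_eq).1 rfl).symm
  have hRd : ∀ Z : VField E M, SmoothVF Z → DifferentiableAt ℝ (R Z) (s x) := fun Z hZ => by
    have h := ((hZ x).mdiff.mdifferentiableWithinAt
      (s := Set.univ)).differentiableWithinAt_mpullbackWithin_vectorField
    simp only [modelWithCornersSelf_coe, Set.range_id, Set.preimage_univ, Set.univ_inter,
      mpullbackWithin_univ] at h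
    exact h.differentiableAt univ_mem
  have hφs : ContDiffOn ℝ ∞ (fun z => φ (s.symm z)) s.target := by
    rw [← contMDiffOn_iff_contDiffOn]
    exact hφ.comp_contMDiffOn (contMDiffOn_extChartAt_symm x)
  have hφs' : ContDiffAt ℝ ∞ (fun z => φ (s.symm z)) (s x) := hφs.contDiffAt (hso.mem_nhds hx)
  have hbase : ∀ (η : M → ℝ) (e : E),
      dirDeriv (x := s.symm (s x)) η e = dirDeriv (x := x) η e := fun η e => by rw [hsx]
  have hder : ∀ Z : VField E M, SmoothVF Z → ∀ e : E,
      dirDeriv (x := x) (fun y => dirDeriv φ (Z y)) (mfderiv 𝓘(ℝ, E) 𝓘(ℝ, E) s.symm (s x) e) =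
        fderiv ℝ (fderiv ℝ (fun z => φ (s.symm z))) (s x) e (R Z (s x)) +
          fderiv ℝ (fun z => φ (s.symm z)) (s x) (fderiv ℝ (R Z) (s x) e) := fun Z hZ e => by
    have h1 := fderiv_comp_extChartAt_symm hx (φ := fun y => dirDeriv φ (Z y))
      ((SmoothVF.dirDeriv hφ hZ).diff _) e
    have h2 : (fun z => dirDeriv φ (Z (s.symm z))) =ᶠ[𝓝 (s x)]
        fun z => fderiv ℝ (fun z => φ (s.symm z)) z (R Z z) := by
      filter_upwards [hso.mem_nhds hx] with z hz
      rw [fderiv_comp_extChartAt_symm hz (hφ.diff _), hR Z z hz]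
    have h3 : DifferentiableAt ℝ (fderiv ℝ (fun z => φ (s.symm z))) (s x) :=
      (hφs'.fderiv_right (m := 1) (by rw [one_add_one_eq_two]; exact ENat.LEInfty.out)).differentiableAt (by simp)
    rw [h2.fderiv_eq, fderiv_clm_apply h3 (hRd Z hZ)] at h1
    simp only [_root_.add_apply, ContinuousLinearMap.comp_apply,
      ContinuousLinearMap.flip_apply] at h1
    rw [add_comm] at h1
    exact (hbase _ _).symm.trans h1.symm
  have hval : ∀ V : E, dirDeriv (x := x) φ (mfderiv 𝓘(ℝ, E) 𝓘(ℝ, E) s.symm (s x) V) =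
      fderiv ℝ (fun z => φ (s.symm z)) (s x) V := fun V => by
    rw [fderiv_comp_extChartAt_symm hx (hφ.diff _)]
    exact (hbase _ _).symm
  have hRx : ∀ Z : VField E M, (mfderiv 𝓘(ℝ, E) 𝓘(ℝ, E) s.symm (s x) (R Z (s x)) : E) = Z x :=
    fun Z => by
    rw [hR Z _ hx]
    exact congrArg (fun y => (Z y : E)) hsx
  have hb : (mlieBracket 𝓘(ℝ, E) X Y x : E) = mfderiv 𝓘(ℝ, E) 𝓘(ℝ, E) s.symm (s x)
      (fderiv ℝ (R Y) (s x) (R X (s x)) - fderiv ℝ (R X) (s x) (R Y (s x))) := by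
    rw [mlieBracket, mlieBracketWithin_apply]
    have h0 := mfderiv_extChartAt_comp_mfderivWithin_extChartAt_symm (I := 𝓘(ℝ, E)) hx
    have h1 : ∀ e : E, (mfderiv 𝓘(ℝ, E) 𝓘(ℝ, E) (extChartAt 𝓘(ℝ, E) x) x
        (mfderiv 𝓘(ℝ, E) 𝓘(ℝ, E) s.symm (s x) e) : E) = e := fun e => by
      simp only [modelWithCornersSelf_coe, Set.range_id, mfderivWithin_univ] at h0
      have := congrArg (fun L : E →L[ℝ] E => L e) h0
      rw [← hs, hsx] at this
      exact this
    have h2 := isInvertible_mfderiv_extChartAt (I := 𝓘(ℝ, E)) (mem_extChartAt_source (I := 𝓘(ℝ, E)) x)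
    refine (ContinuousLinearMap.IsInvertible.inverse_apply_eq h2).2 ?_
    refine Eq.trans ?_ (h1 _).symm
    simp only [modelWithCornersSelf_coe, Set.range_id, Set.preimage_univ, Set.univ_inter,
      mpullbackWithin_univ]
    exact congrFun (lieBracketWithin_univ (𝕜 := ℝ) (E := E) (V := R X) (W := R Y)) _
  have hsymm : IsSymmSndFDerivAt ℝ (fun z => φ (s.symm z)) (s x) :=
    hφs'.isSymmSndFDerivAt (by rw [minSmoothness_of_isRCLikeNormedField]; exact ENat.LEInfty.out)
  have e1 := hder Y hY (R X (s x))
  have e2 := hder X hX (R Y (s x))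
  have e3 := hval (fderiv ℝ (R Y) (s x) (R X (s x)) - fderiv ℝ (R X) (s x) (R Y (s x)))
  rw [hRx] at e1 e2
  rw [← hb, map_sub] at e3
  have e4 := hsymm (R X (s x)) (R Y (s x))
  linarith

end Calculus

/-! ### Coordinate vector fields and extension of germs -/

section Frames

variable {E : Type*} [NormedAddCommGroup E] [NormedSpace ℝ E]
  {M : Type*} [TopologicalSpace M] [ChartedSpace E M] [IsManifold 𝓘(ℝ, E) ∞ M]

/-- The vector field on the domain of the chart at `c` with constant coefficients `e`. -/
def coordVF (c : M) (e : E) : VField E M :=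
  fun y => (trivializationAt E (TangentSpace 𝓘(ℝ, E)) c).symmL ℝ y e

/-- The coefficients of a tangent vector in the chart at `c`. -/
def coordL (c y : M) : TangentSpace 𝓘(ℝ, E) y →L[ℝ] E :=
  (trivializationAt E (TangentSpace 𝓘(ℝ, E)) c).continuousLinearMapAt ℝ y

lemma constExt_apply {x y : M} (hy : y ∈ (chartAt E x).source) (v : TangentSpace 𝓘(ℝ, E) x) :
    constExt v y = coordVF x (coordL x x v) y := by
  have hx : x ∈ (trivializationAt E (TangentSpace 𝓘(ℝ, E)) x).baseSet :=
    FiberBundle.mem_baseSet_trivializationAt' x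
  have hy' : y ∈ (trivializationAt E (TangentSpace 𝓘(ℝ, E)) x).baseSet := by simpa using hy
  simp only [constExt, FiberBundle.extend, coordVF, coordL,
    Bundle.Trivialization.continuousLinearMapAt_apply]
  rw [Bundle.Trivialization.linearMapAt_apply, if_pos hx]
  exact (Bundle.Trivialization.symmL_apply _ hy' _).symm

lemma constExt_eventuallyEq {x y : M} (hy : y ∈ (chartAt E x).source)
    (v : TangentSpace 𝓘(ℝ, E) x) : constExt v =ᶠ[𝓝 y] coordVF x (coordL x x v) := by
  filter_upwards [(chartAt E x).open_source.mem_nhds hy] with z hz using constExt_apply hz v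

lemma coordL_coordVF {c y : M} (hy : y ∈ (chartAt E c).source) (e : E) :
    coordL c y (coordVF c e y) = e :=
  Bundle.Trivialization.continuousLinearMapAt_symmL _ (by simpa using hy) e

lemma coordVF_coordL {c y : M} (hy : y ∈ (chartAt E c).source) (v : TangentSpace 𝓘(ℝ, E) y) :
    coordVF c (coordL c y v) y = v :=
  Bundle.Trivialization.symmL_continuousLinearMapAt _ (by simpa using hy) v

lemma smooth_coordVF {c y : M} (hy : y ∈ (chartAt E c).source) (e : E) :
    SmoothVFieldAt (coordVF c e) y := by
  have hy' : y ∈ (trivializationAt E (TangentSpace 𝓘(ℝ, E)) c).baseSet := by simpa using hy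
  rw [SmoothVFieldAt, Bundle.Trivialization.contMDiffAt_section_iff _ hy']
  refine (contMDiffAt_const (c := e)).congr_of_eventuallyEq ?_
  filter_upwards [(trivializationAt E (TangentSpace 𝓘(ℝ, E)) c).open_baseSet.mem_nhds hy'] with z hz
  have := coordL_coordVF (c := c) (y := z) (by simpa using hz) e
  rw [coordL, Bundle.Trivialization.continuousLinearMapAt_apply,
    Bundle.Trivialization.linearMapAt_apply, if_pos hz] at this
  exact this

lemma smooth_coordL {c y : M} (hy : y ∈ (chartAt E c).source) {X : VField E M}
    (hX : SmoothVFieldAt X y) : ContMDiffAt 𝓘(ℝ, E) 𝓘(ℝ, E) ∞ (fun z => coordL c z (X z)) y := by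
  have hy' : y ∈ (trivializationAt E (TangentSpace 𝓘(ℝ, E)) c).baseSet := by simpa using hy
  rw [SmoothVFieldAt, Bundle.Trivialization.contMDiffAt_section_iff _ hy'] at hX
  refine hX.congr_of_eventuallyEq ?_
  filter_upwards [(trivializationAt E (TangentSpace 𝓘(ℝ, E)) c).open_baseSet.mem_nhds hy'] with z hz
  rw [coordL, Bundle.Trivialization.continuousLinearMapAt_apply,
    Bundle.Trivialization.linearMapAt_apply, if_pos hz]

lemma coordVF_eq_mfderiv {c y : M} (hy : y ∈ (chartAt E c).source) (e : E) :
    coordVF c e y = mfderiv 𝓘(ℝ, E) 𝓘(ℝ, E) (extChartAt 𝓘(ℝ, E) c).symm (extChartAt 𝓘(ℝ, E) c y) e := by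
  rw [coordVF, TangentBundle.symmL_trivializationAt hy]
  simp only [modelWithCornersSelf_coe, Set.range_id, mfderivWithin_univ]
  rfl

lemma coordL_eq_mfderiv {c y : M} (hy : y ∈ (chartAt E c).source) :
    coordL c y = mfderiv 𝓘(ℝ, E) 𝓘(ℝ, E) (extChartAt 𝓘(ℝ, E) c) y := by
  rw [coordL, TangentBundle.continuousLinearMapAt_trivializationAt hy]

/-- Coordinate vector fields commute. -/
lemma mlieBracket_coordVF [CompleteSpace E] {c y : M} (hy : y ∈ (chartAt E c).source) (e e' : E) :
    mlieBracket 𝓘(ℝ, E) (coordVF c e) (coordVF c e') y = 0 := by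
  have hy' : y ∈ (extChartAt 𝓘(ℝ, E) c).source := by simpa using hy
  let K : E → (z : E) → TangentSpace 𝓘(ℝ, E) z := fun e _ => e
  have hpull : ∀ e : E, coordVF c e =ᶠ[𝓝 y]
      mpullback 𝓘(ℝ, E) 𝓘(ℝ, E) (extChartAt 𝓘(ℝ, E) c) (K e) := fun e => by
    filter_upwards [(chartAt E c).open_source.mem_nhds hy] with z hz
    symm
    refine (ContinuousLinearMap.IsInvertible.inverse_apply_eq
      (isInvertible_mfderiv_extChartAt (by simpa using hz))).2 ?_
    rw [← coordL_eq_mfderiv hz]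
    exact (coordL_coordVF hz e).symm
  rw [(hpull e).mlieBracket_vectorField_eq (hpull e')]
  have hmd : ∀ e : E, MDifferentiableAt 𝓘(ℝ, E) 𝓘(ℝ, E).tangent
      (fun z : E => (⟨z, K e z⟩ : TangentBundle 𝓘(ℝ, E) E)) (extChartAt 𝓘(ℝ, E) c y) := fun e => by
    have h : ContMDiff 𝓘(ℝ, E) 𝓘(ℝ, E).tangent 1
        (fun z : E => (⟨z, K e z⟩ : TangentBundle 𝓘(ℝ, E) E)) :=
      contMDiff_vectorSpace_iff_contDiff.2 contDiff_const
    exact (h _).mdifferentiableAt (by simp)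
  rw [← mpullback_mlieBracket (n := ∞) (hmd e) (hmd e') (contMDiffAt_extChartAt' hy)
    (by rw [minSmoothness_of_isRCLikeNormedField]; exact ENat.LEInfty.out)]
  have h0 : mlieBracket 𝓘(ℝ, E) (K e) (K e') = fun _ => 0 := by
    rw [← mlieBracketWithin_univ, mlieBracketWithin_eq_lieBracketWithin]
    funext z
    exact (congrFun (lieBracketWithin_univ (𝕜 := ℝ) (E := E) (V := fun _ => e)
      (W := fun _ => e')) z).trans (by simp [lieBracket]; rfl)
  rw [mpullback_apply, h0]
  exact map_zero _

lemma smooth_constExt {x y : M} (hy : y ∈ (chartAt E x).source) (v : TangentSpace 𝓘(ℝ, E) x) :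
    SmoothVFieldAt (constExt v) y :=
  (smooth_coordVF hy _).congr (constExt_eventuallyEq hy v)

lemma constExt_self {x : M} (v : TangentSpace 𝓘(ℝ, E) x) : constExt v x = v :=
  FiberBundle.extend_apply_self E v

lemma mlieBracket_constExt [CompleteSpace E] {x : M} (v w : TangentSpace 𝓘(ℝ, E) x) :
    mlieBracket 𝓘(ℝ, E) (constExt v) (constExt w) x = 0 := by
  have hx := mem_chart_source E x
  rw [(constExt_eventuallyEq hx v).mlieBracket_vectorField_eq (constExt_eventuallyEq hx w)]
  exact mlieBracket_coordVF hx _ _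

section Bump

variable [FiniteDimensional ℝ E] [T2Space M]

lemma exists_bump {x : M} {U : Set M} (hU : U ∈ 𝓝 x) :
    ∃ χ : M → ℝ, SmoothFn E χ ∧ χ =ᶠ[𝓝 x] 1 ∧ tsupport χ ⊆ U := by
  obtain ⟨f, -, hf⟩ := (SmoothBumpFunction.nhds_basis_tsupport (I := 𝓘(ℝ, E)) x).mem_iff.1 hU
  exact ⟨f, f.contMDiff, f.eventuallyEq_one, hf⟩

/-- The germ at `x` of a local smooth vector field extends to a global one, by a bump function. -/
lemma exists_smoothVF_eventuallyEq {x : M} {U : Set M} (hU : IsOpen U) (hx : x ∈ U) {X : VField E M}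
    (hX : ∀ y ∈ U, SmoothVFieldAt X y) : ∃ Y : VField E M, SmoothVF Y ∧ Y =ᶠ[𝓝 x] X := by
  obtain ⟨χ, hχ, h1, hs⟩ := exists_bump (E := E) (hU.mem_nhds hx)
  refine ⟨χ • X, fun y => ?_, ?_⟩
  · exact ContMDiffOn.smul_section_of_tsupport hχ.contMDiffOn hU hs
      (fun z hz => (hX z hz).contMDiffWithinAt) y
  · filter_upwards [h1] with y hy
    exact (congrArg (· • X y) hy).trans (one_smul ℝ (X y))

lemma exists_smoothVF_constExt {x : M} (v : TangentSpace 𝓘(ℝ, E) x) :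
    ∃ Y : VField E M, SmoothVF Y ∧ Y =ᶠ[𝓝 x] constExt v :=
  exists_smoothVF_eventuallyEq (chartAt E x).open_source (mem_chart_source E x)
    fun _ hy => smooth_constExt hy v

lemma exists_smoothVF {x : M} (v : TangentSpace 𝓘(ℝ, E) x) :
    ∃ Y : VField E M, SmoothVF Y ∧ Y x = v := by
  obtain ⟨Y, h1, h2⟩ := exists_smoothVF_constExt v
  exact ⟨Y, h1, by rw [h2.eq_of_nhds, constExt_self]⟩

/-- The germ at `x` of a local smooth function extends to a global one, by a bump function. -/
lemma exists_smoothFn_eventuallyEq {x : M} {U : Set M} (hU : IsOpen U) (hx : x ∈ U) {φ : M → ℝ}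
    (hφ : ContMDiffOn 𝓘(ℝ, E) 𝓘(ℝ, ℝ) ∞ φ U) : ∃ ψ : M → ℝ, SmoothFn E ψ ∧ ψ =ᶠ[𝓝 x] φ := by
  obtain ⟨χ, hχ, h1, hs⟩ := exists_bump (E := E) (hU.mem_nhds hx)
  refine ⟨fun y => χ y * φ y, ?_, ?_⟩
  · refine contMDiff_of_tsupport fun y hy => ?_
    have hy' : y ∈ U := hs (closure_mono (Function.support_mul_subset_left χ φ) hy)
    exact (hχ y).mul (hφ.contMDiffAt (hU.mem_nhds hy'))
  · filter_upwards [h1] with y hy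
    simp [hy]

/-- Every linear form at a point is the differential of a smooth function vanishing there. -/
lemma exists_smoothFn_dirDeriv {x : M} (l : TangentSpace 𝓘(ℝ, E) x →L[ℝ] ℝ) :
    ∃ ψ : M → ℝ, SmoothFn E ψ ∧ ψ x = 0 ∧ ∀ v : TangentSpace 𝓘(ℝ, E) x, dirDeriv ψ v = l v := by
  let l' : E →L[ℝ] ℝ := l
  have hs : ContMDiffOn 𝓘(ℝ, E) 𝓘(ℝ, ℝ) ∞
      (fun y => l' (extChartAt 𝓘(ℝ, E) x y - extChartAt 𝓘(ℝ, E) x x)) (chartAt E x).source := by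
    have h1 : ContMDiff 𝓘(ℝ, E) 𝓘(ℝ, ℝ) ∞ (fun z : E => l' (z - extChartAt 𝓘(ℝ, E) x x)) := by
      rw [contMDiff_iff_contDiff]; fun_prop
    exact h1.comp_contMDiffOn contMDiffOn_extChartAt
  obtain ⟨ψ, h1, h2⟩ := exists_smoothFn_eventuallyEq (chartAt E x).open_source
    (mem_chart_source E x) hs
  refine ⟨ψ, h1, by rw [h2.eq_of_nhds]; simp, fun v => ?_⟩
  rw [dirDeriv_congr h2]
  have h3 : MDifferentiableAt 𝓘(ℝ, E) 𝓘(ℝ, ℝ)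
      (fun z : E => l' (z - extChartAt 𝓘(ℝ, E) x x)) (extChartAt 𝓘(ℝ, E) x x) := by
    rw [mdifferentiableAt_iff_differentiableAt]; fun_prop
  have h4 := mvfderiv_comp_apply x h3
    (mdifferentiableAt_extChartAt (I := 𝓘(ℝ, E)) (mem_chart_source E x)) v
  refine h4.trans ?_
  rw [mfderiv_extChartAt_self]
  have h5 : fderiv ℝ (fun z : E => l' (z - extChartAt 𝓘(ℝ, E) x x)) (extChartAt 𝓘(ℝ, E) x x) = l' := by
    rw [fderiv_comp_sub (f := fun z => l' z)]
    exact l'.fderiv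
  simp only [mvfderiv, mfderiv_eq_fderiv]
  exact congrArg (fun L : E →L[ℝ] ℝ => L v) h5

/-- Hadamard's lemma for vector fields. -/
lemma exists_smoothVF_sum {x : M} {Z : VField E M} (hZ : SmoothVF Z) (h0 : Z x = 0) :
    ∃ (ι : Type) (_ : Fintype ι) (φ : ι → M → ℝ) (F : ι → VField E M),
      (∀ i, SmoothFn E (φ i)) ∧ (∀ i, SmoothVF (F i)) ∧ (∀ i, φ i x = 0) ∧
      Z = fun y => ∑ i, φ i y • F i y := by
  -- `Z = ∑ᵢ (χ Zⁱ) (χ ∂ᵢ) + (1 - χ²) Z` with a bump function `χ`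
  obtain ⟨χ, hχ, h1, hs⟩ := exists_bump (E := E)
    ((chartAt E x).open_source.mem_nhds (mem_chart_source E x))
  let b := Module.finBasis ℝ E
  let φ : Fin (Module.finrank ℝ E) → M → ℝ := fun i y => χ y * b.coord i (coordL x y (Z y))
  let F : Fin (Module.finrank ℝ E) → VField E M := fun i => χ • coordVF x (b i)
  refine ⟨Option (Fin (Module.finrank ℝ E)), inferInstance,
    fun i => i.elim (fun y => 1 - χ y * χ y) φ, fun i => i.elim Z F, ?_, ?_, ?_, ?_⟩
  · rintro (_ | i)
    · exact contMDiff_const.sub (hχ.mul hχ)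
    · refine contMDiff_of_tsupport fun y hy => ?_
      have hy' : y ∈ (chartAt E x).source :=
        hs (closure_mono (Function.support_mul_subset_left χ _) hy)
      have hb : ContMDiff 𝓘(ℝ, E) 𝓘(ℝ, ℝ) ∞ (LinearMap.toContinuousLinearMap (b.coord i)) :=
        ContinuousLinearMap.contMDiff _
      exact (hχ y).mul (hb.contMDiffAt.comp y (smooth_coordL hy' (hZ y)))
  · rintro (_ | i)
    · exact hZ
    · exact fun y => ContMDiffOn.smul_section_of_tsupport hχ.contMDiffOn
        (chartAt E x).open_source hs (fun z hz => (smooth_coordVF hz (b i)).contMDiffWithinAt) y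
  · rintro (_ | i)
    · simp [h1.eq_of_nhds]
    · simp [φ, h0]
  · funext y
    rw [Fintype.sum_option]
    by_cases hy : y ∈ (chartAt E x).source
    · have h2 : ∑ i, b.coord i (coordL x y (Z y)) • coordVF x (b i) y = Z y := by
        conv_rhs => rw [← coordVF_coordL hy (Z y), ← b.sum_repr (coordL x y (Z y))]
        simp only [coordVF, map_sum, map_smul]
        rfl
      have h3 : ∑ i, φ i y • F i y = (χ y * χ y) • Z y := by
        rw [← h2, Finset.smul_sum]
        refine Finset.sum_congr rfl fun i _ => ?_
        simp only [φ, F, Pi.smul_apply', smul_smul]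
        congr 1; ring
      simp only [Option.elim]
      rw [h3, ← add_smul]; simp
    · have : χ y = 0 := image_eq_zero_of_notMem_tsupport fun h => hy (hs h)
      simp [φ, F, this]

/-- An operator on smooth vector fields that is additive and linear over smooth functions at `x`
depends only on the value of the vector field at `x`. -/
lemma eq_of_tensorial {A : Type*} [AddCommGroup A] [Module ℝ A] {x : M} {Φ : VField E M → A}
    (hadd : ∀ X Y, SmoothVF X → SmoothVF Y → Φ (fun y => X y + Y y) = Φ X + Φ Y)
    (hsmul : ∀ φ X, SmoothFn E φ → SmoothVF X → Φ (fun y => φ y • X y) = φ x • Φ X)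
    {X Y : VField E M} (hX : SmoothVF X) (hY : SmoothVF Y) (h : X x = Y x) : Φ X = Φ Y := by
  have hzero : Φ (fun _ => 0) = 0 := by
    have := hsmul (fun _ => 0) X contMDiff_const hX
    simpa using this
  have hsum : ∀ (ι : Type) (s : Finset ι) (F : ι → VField E M), (∀ i, SmoothVF (F i)) →
      Φ (fun y => ∑ i ∈ s, F i y) = ∑ i ∈ s, Φ (F i) := by
    classical
    intro ι s F hF
    induction s using Finset.induction_on with
    | empty => simpa using hzero
    | insert a s ha ih =>
      simp only [Finset.sum_insert ha]
      rw [hadd _ _ (hF a) (SmoothVF.sum fun i _ => hF i), ih]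
  obtain ⟨ι, _, φ, F, hφ, hF, h0, hZ⟩ := exists_smoothVF_sum (hX.sub hY) (x := x) (by simp [h])
  have h1 : Φ (fun y => X y - Y y) = 0 := by
    rw [hZ, hsum ι Finset.univ (fun i y => φ i y • F i y) fun i => (hF i).smul (hφ i)]
    refine Finset.sum_eq_zero fun i _ => ?_
    rw [hsmul _ _ (hφ i) (hF i), h0 i, zero_smul]
  have h2 := hadd (fun y => X y - Y y) Y (hX.sub hY) hY
  simp only [sub_add_cancel, h1, zero_add] at h2
  exact h2

end Bump

end Frames

/-! ### The metric, Gram matrices and the Koszul formula -/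

section Metric

variable {E : Type*} [NormedAddCommGroup E] [NormedSpace ℝ E]
  {M : Type*} [TopologicalSpace M] [ChartedSpace E M] [IsManifold 𝓘(ℝ, E) ∞ M]

section Inner

variable (g : RMetric E M) {x : M}

lemma inner_add_left (u v w : TangentSpace 𝓘(ℝ, E) x) :
    g.inner x (u + v) w = g.inner x u w + g.inner x v w := by simp
lemma inner_add_right (u v w : TangentSpace 𝓘(ℝ, E) x) :
    g.inner x w (u + v) = g.inner x w u + g.inner x w v := by simp
lemma inner_sub_left (u v w : TangentSpace 𝓘(ℝ, E) x) :
    g.inner x (u - v) w = g.inner x u w - g.inner x v w := by simp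
lemma inner_neg_left (u w : TangentSpace 𝓘(ℝ, E) x) :
    g.inner x (-u) w = - g.inner x u w := by simp
lemma inner_neg_right (u w : TangentSpace 𝓘(ℝ, E) x) :
    g.inner x w (-u) = - g.inner x w u := by simp
lemma inner_smul_left (c : ℝ) (u w : TangentSpace 𝓘(ℝ, E) x) :
    g.inner x (c • u) w = c * g.inner x u w := by simp
lemma inner_smul_right (c : ℝ) (u w : TangentSpace 𝓘(ℝ, E) x) :
    g.inner x w (c • u) = c * g.inner x w u := by simp
lemma inner_zero_left (w : TangentSpace 𝓘(ℝ, E) x) : g.inner x 0 w = 0 := by simp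
lemma inner_zero_right (w : TangentSpace 𝓘(ℝ, E) x) : g.inner x w 0 = 0 := by simp
lemma inner_sum_left {ι : Type*} (s : Finset ι) (u : ι → TangentSpace 𝓘(ℝ, E) x)
    (w : TangentSpace 𝓘(ℝ, E) x) : g.inner x (∑ i ∈ s, u i) w = ∑ i ∈ s, g.inner x (u i) w := by
  rw [map_sum]; simp
lemma inner_sum_right {ι : Type*} (s : Finset ι) (u : ι → TangentSpace 𝓘(ℝ, E) x)
    (w : TangentSpace 𝓘(ℝ, E) x) : g.inner x w (∑ i ∈ s, u i) = ∑ i ∈ s, g.inner x w (u i) := by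
  rw [map_sum]

end Inner

lemma contMDiffAt_inner (g : RMetric E M) {X Y : VField E M} {x : M} (hX : SmoothVFieldAt X x)
    (hY : SmoothVFieldAt Y x) :
    ContMDiffAt 𝓘(ℝ, E) 𝓘(ℝ, ℝ) ∞ (fun y => g.inner y (X y) (Y y)) x := by
  have h := ContMDiffAt.clm_bundle_apply₂ (F₁ := E) (F₂ := E) (F₃ := ℝ) (IB := 𝓘(ℝ, E))
    (E₁ := fun y : M => TangentSpace 𝓘(ℝ, E) y) (E₂ := fun y : M => TangentSpace 𝓘(ℝ, E) y)
    (E₃ := fun _ : M => ℝ) (b := fun y : M => y) (v := X) (w := Y) (g.contMDiff x) hX hY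
  exact (Bundle.contMDiffAt_section _).1 h |>.congr_of_eventuallyEq (by rfl)

lemma smooth_inner (g : RMetric E M) {X Y : VField E M} (hX : SmoothVF X) (hY : SmoothVF Y) :
    SmoothFn E (fun y => g.inner y (X y) (Y y)) := fun x => contMDiffAt_inner g (hX x) (hY x)

lemma koszul_congr (g : RMetric E M) {X X' Y Y' Z Z' : VField E M} {x : M} (hX : X =ᶠ[𝓝 x] X')
    (hY : Y =ᶠ[𝓝 x] Y') (hZ : Z =ᶠ[𝓝 x] Z') : koszul g X Y Z x = koszul g X' Y' Z' x := by
  have key : ∀ {A A' B B' : VField E M}, A =ᶠ[𝓝 x] A' → B =ᶠ[𝓝 x] B' →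
      (fun y => g.inner y (A y) (B y)) =ᶠ[𝓝 x] fun y => g.inner y (A' y) (B' y) :=
    fun hA hB => by
      filter_upwards [hA, hB] with y h1 h2
      rw [h1, h2]
  simp only [koszul]
  rw [dirDeriv_congr (key hY hZ), dirDeriv_congr (key hZ hX), dirDeriv_congr (key hX hY),
    hX.mlieBracket_vectorField_eq hY, hY.mlieBracket_vectorField_eq hZ,
    hZ.mlieBracket_vectorField_eq hX, hX.eq_of_nhds, hY.eq_of_nhds, hZ.eq_of_nhds]

variable [CompleteSpace E]

lemma mlieBracket_add_left' {X X' Y : VField E M} (hX : SmoothVF X) (hX' : SmoothVF X') (x : M) :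
    mlieBracket 𝓘(ℝ, E) (fun y => X y + X' y) Y x =
      mlieBracket 𝓘(ℝ, E) X Y x + mlieBracket 𝓘(ℝ, E) X' Y x :=
  mlieBracket_add_left (hX x).mdiff (hX' x).mdiff

lemma mlieBracket_add_right' {X Y Y' : VField E M} (hY : SmoothVF Y) (hY' : SmoothVF Y') (x : M) :
    mlieBracket 𝓘(ℝ, E) X (fun y => Y y + Y' y) x =
      mlieBracket 𝓘(ℝ, E) X Y x + mlieBracket 𝓘(ℝ, E) X Y' x :=
  mlieBracket_add_right (hY x).mdiff (hY' x).mdiff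

lemma mlieBracket_smul_left' {φ : M → ℝ} {X Y : VField E M} (hφ : SmoothFn E φ) (hX : SmoothVF X)
    (x : M) : mlieBracket 𝓘(ℝ, E) (fun y => φ y • X y) Y x =
      -(dirDeriv φ (Y x) • X x) + φ x • mlieBracket 𝓘(ℝ, E) X Y x := by
  rw [← neg_smul]
  exact mlieBracket_smul_left (hφ.diff x) (hX x).mdiff

lemma mlieBracket_smul_right' {φ : M → ℝ} {X Y : VField E M} (hφ : SmoothFn E φ) (hY : SmoothVF Y)
    (x : M) : mlieBracket 𝓘(ℝ, E) X (fun y => φ y • Y y) x =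
      dirDeriv φ (X x) • Y x + φ x • mlieBracket 𝓘(ℝ, E) X Y x :=
  mlieBracket_smul_right (hφ.diff x) (hY x).mdiff

section

variable (g : RMetric E M) {X X' Y Y' Z Z' : VField E M} {φ : M → ℝ}

lemma koszul_add_left (hX : SmoothVF X) (hX' : SmoothVF X') (hY : SmoothVF Y) (hZ : SmoothVF Z)
    (x : M) : koszul g (fun y => X y + X' y) Y Z x = koszul g X Y Z x + koszul g X' Y Z x := by
  simp only [koszul, inner_add_left, inner_add_right, dirDeriv_vadd]
  rw [dirDeriv_add ((smooth_inner g hZ hX).diff x) ((smooth_inner g hZ hX').diff x),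
    dirDeriv_add ((smooth_inner g hX hY).diff x) ((smooth_inner g hX' hY).diff x),
    mlieBracket_add_left' hX hX', mlieBracket_add_right' hX hX']
  simp only [inner_add_left]
  ring

lemma koszul_add_middle (hX : SmoothVF X) (hY : SmoothVF Y) (hY' : SmoothVF Y') (hZ : SmoothVF Z)
    (x : M) : koszul g X (fun y => Y y + Y' y) Z x = koszul g X Y Z x + koszul g X Y' Z x := by
  simp only [koszul, inner_add_left, inner_add_right, dirDeriv_vadd]
  rw [dirDeriv_add ((smooth_inner g hY hZ).diff x) ((smooth_inner g hY' hZ).diff x),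
    dirDeriv_add ((smooth_inner g hX hY).diff x) ((smooth_inner g hX hY').diff x),
    mlieBracket_add_left' hY hY', mlieBracket_add_right' hY hY']
  simp only [inner_add_left]
  ring

lemma koszul_add_right (hX : SmoothVF X) (hY : SmoothVF Y) (hZ : SmoothVF Z) (hZ' : SmoothVF Z')
    (x : M) : koszul g X Y (fun y => Z y + Z' y) x = koszul g X Y Z x + koszul g X Y Z' x := by
  simp only [koszul, inner_add_left, inner_add_right, dirDeriv_vadd]
  rw [dirDeriv_add ((smooth_inner g hY hZ).diff x) ((smooth_inner g hY hZ').diff x),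
    dirDeriv_add ((smooth_inner g hZ hX).diff x) ((smooth_inner g hZ' hX).diff x),
    mlieBracket_add_left' hZ hZ', mlieBracket_add_right' hZ hZ']
  simp only [inner_add_left]
  ring

lemma koszul_smul_left (hφ : SmoothFn E φ) (hX : SmoothVF X) (hY : SmoothVF Y) (hZ : SmoothVF Z)
    (x : M) : koszul g (fun y => φ y • X y) Y Z x = φ x * koszul g X Y Z x := by
  simp only [koszul, inner_smul_left, inner_smul_right, dirDeriv_vsmul]
  rw [dirDeriv_mul (hφ.diff x) ((smooth_inner g hZ hX).diff x),
    dirDeriv_mul (hφ.diff x) ((smooth_inner g hX hY).diff x),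
    mlieBracket_smul_left' hφ hX, mlieBracket_smul_right' hφ hX]
  simp only [inner_add_left, inner_neg_left, inner_smul_left]
  rw [g.symm x (Z x) (X x)]
  ring

lemma koszul_smul_right (hφ : SmoothFn E φ) (hX : SmoothVF X) (hY : SmoothVF Y) (hZ : SmoothVF Z)
    (x : M) : koszul g X Y (fun y => φ y • Z y) x = φ x * koszul g X Y Z x := by
  simp only [koszul, inner_smul_left, inner_smul_right, dirDeriv_vsmul]
  rw [dirDeriv_mul (hφ.diff x) ((smooth_inner g hY hZ).diff x),
    dirDeriv_mul (hφ.diff x) ((smooth_inner g hZ hX).diff x),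
    mlieBracket_smul_left' hφ hZ, mlieBracket_smul_right' hφ hZ]
  simp only [inner_add_left, inner_neg_left, inner_smul_left]
  rw [g.symm x (Y x) (Z x)]
  ring

lemma koszul_smul_middle (hφ : SmoothFn E φ) (hX : SmoothVF X) (hY : SmoothVF Y) (hZ : SmoothVF Z)
    (x : M) : koszul g X (fun y => φ y • Y y) Z x =
      φ x * koszul g X Y Z x + 2 * (dirDeriv φ (X x) * g.inner x (Y x) (Z x)) := by
  simp only [koszul, inner_smul_left, inner_smul_right, dirDeriv_vsmul]
  rw [dirDeriv_mul (hφ.diff x) ((smooth_inner g hY hZ).diff x),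
    dirDeriv_mul (hφ.diff x) ((smooth_inner g hX hY).diff x),
    mlieBracket_smul_left' hφ hY, mlieBracket_smul_right' hφ hY]
  simp only [inner_add_left, inner_neg_left, inner_smul_left]
  rw [g.symm x (X x) (Y x)]
  ring

end

end Metric

section OrthonormalFrames

variable {E : Type*} [NormedAddCommGroup E] [NormedSpace ℝ E] [FiniteDimensional ℝ E]
  {M : Type*} [TopologicalSpace M] [ChartedSpace E M] [IsManifold 𝓘(ℝ, E) ∞ M]
  (g : RMetric E M)

instance finiteDimensional_tangentSpace (x : M) : FiniteDimensional ℝ (TangentSpace 𝓘(ℝ, E) x) :=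
  inferInstanceAs (FiniteDimensional ℝ E)

lemma inner_onb (x : M) (a b : Fin (Module.finrank ℝ E)) :
    g.inner x (onb g x a) (onb g x b) = if a = b then 1 else 0 :=
  (exists_orthonormal_basis g x).choose_spec a b

lemma eq_of_inner_eq {x : M} {u v : TangentSpace 𝓘(ℝ, E) x}
    (h : ∀ w, g.inner x u w = g.inner x v w) : u = v := by
  by_contra hne
  have h1 := g.pos x (u - v) (sub_ne_zero.2 hne)
  rw [inner_sub_left, h, sub_self] at h1
  exact lt_irrefl _ h1

lemma sum_inner_onb {x : M} (v : TangentSpace 𝓘(ℝ, E) x) :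
    ∑ a, g.inner x v (onb g x a) • onb g x a = v := by
  conv_rhs => rw [← (onb g x).sum_repr v]
  refine Finset.sum_congr rfl fun a _ => ?_
  congr 1
  conv_lhs => rw [← (onb g x).sum_repr v]
  rw [inner_sum_left]
  simp [inner_onb]

/-- The Gram matrix of a family of tangent vectors. -/
def gram {x : M} {ι : Type*} (e : ι → TangentSpace 𝓘(ℝ, E) x) : Matrix ι ι ℝ :=
  Matrix.of fun a b => g.inner x (e a) (e b)

/-- The expansion of a vector in a basis that need not be orthonormal. -/
lemma sum_gram_inv {x : M} {e : Fin (Module.finrank ℝ E) → TangentSpace 𝓘(ℝ, E) x}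
    (h : (gram g e).det ≠ 0) (v : TangentSpace 𝓘(ℝ, E) x) :
    ∑ a, ∑ b, ((gram g e)⁻¹ a b * g.inner x v (e a)) • e b = v := by
  have hli : LinearIndependent ℝ e := by
    rw [Fintype.linearIndependent_iff]
    intro c hc
    have h1 : (gram g e).mulVec c = 0 := by
      funext a
      have := congrArg (fun w => g.inner x (e a) w) hc
      simp only [inner_sum_right, inner_smul_right, inner_zero_right] at this
      simpa [Matrix.mulVec, dotProduct, gram, mul_comm] using this
    exact congrFun (Matrix.eq_zero_of_mulVec_eq_zero h h1)
  have hspan : Submodule.span ℝ (Set.range e) = ⊤ :=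
    hli.span_eq_top_of_card_eq_finrank' (by
      rw [Fintype.card_fin]; rfl)
  apply eq_of_inner_eq g
  have hinv := Matrix.nonsing_inv_mul (gram g e) (isUnit_iff_ne_zero.2 h)
  have hbase : ∀ c, g.inner x (∑ a, ∑ b, ((gram g e)⁻¹ a b * g.inner x v (e a)) • e b) (e c) =
      g.inner x v (e c) := fun c => by
    simp only [inner_sum_left, inner_smul_left]
    have h2 : ∀ a, ∑ b, (gram g e)⁻¹ a b * g.inner x v (e a) * g.inner x (e b) (e c) =
        g.inner x v (e a) * (1 : Matrix _ _ ℝ) a c := fun a => by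
      rw [← hinv, Matrix.mul_apply, Finset.mul_sum]
      exact Finset.sum_congr rfl fun b _ => by simp only [gram, Matrix.of_apply]; ring
    simp only [h2, Matrix.one_apply]
    simp
  intro w
  have hw : w ∈ Submodule.span ℝ (Set.range e) := by rw [hspan]; trivial
  induction hw using Submodule.span_induction with
  | mem y hy => obtain ⟨c, rfl⟩ := hy; exact hbase c
  | zero => simp only [inner_zero_right]
  | add y z _ _ hy hz => simp only [inner_add_right, hy, hz]
  | smul r y _ hy => simp only [inner_smul_right, hy]

lemma contMDiffAt_det {ι : Type*} [Fintype ι] [DecidableEq ι] {A : M → Matrix ι ι ℝ} {x : M}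
    (h : ∀ i j, ContMDiffAt 𝓘(ℝ, E) 𝓘(ℝ, ℝ) ∞ (fun y => A y i j) x) :
    ContMDiffAt 𝓘(ℝ, E) 𝓘(ℝ, ℝ) ∞ (fun y => (A y).det) x := by
  simp only [Matrix.det_apply']
  refine ContMDiffAt.sum fun σ _ => contMDiffAt_const.mul ?_
  exact contMDiffAt_finsetProd fun i _ => h _ _

lemma contMDiffAt_matrix_inv {ι : Type*} [Fintype ι] [DecidableEq ι] {A : M → Matrix ι ι ℝ} {x : M}
    (h : ∀ i j, ContMDiffAt 𝓘(ℝ, E) 𝓘(ℝ, ℝ) ∞ (fun y => A y i j) x) (h0 : (A x).det ≠ 0)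
    (i j : ι) : ContMDiffAt 𝓘(ℝ, E) 𝓘(ℝ, ℝ) ∞ (fun y => (A y)⁻¹ i j) x := by
  simp only [Matrix.inv_def, Matrix.smul_apply, Matrix.adjugate_apply, smul_eq_mul,
    Ring.inverse_eq_inv']
  refine ContMDiffAt.mul ?_ (contMDiffAt_det fun k l => ?_)
  · exact (contMDiffAt_det h).inv₀ h0
  · by_cases hk : k = j
    · subst hk
      simpa using contMDiffAt_const
    · simpa [Matrix.updateRow_apply, hk] using h k l

end OrthonormalFrames

/-! ### Connections and the Levi-Civita connection -/

section Connections

variable {E : Type*} [NormedAddCommGroup E] [NormedSpace ℝ E] [FiniteDimensional ℝ E]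
  {M : Type*} [TopologicalSpace M] [ChartedSpace E M] [IsManifold 𝓘(ℝ, E) ∞ M]

omit [FiniteDimensional ℝ E] in
lemma gram_symm (g : RMetric E M) {x : M} {ι : Type*} (e : ι → TangentSpace 𝓘(ℝ, E) x) (a b : ι) :
    gram g e a b = gram g e b a := g.symm x _ _

lemma gram_onb (g : RMetric E M) (x : M) : gram g (onb g x) = 1 := by
  ext a b
  simp [gram, inner_onb, Matrix.one_apply]

/-- Near `x`, the Gram matrix of smooth fields that are orthonormal at `x` is invertible. -/
lemma eventually_det_gram_ne_zero (g : RMetric E M) {x : M}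
    {e : Fin (Module.finrank ℝ E) → VField E M} (he : ∀ a, SmoothVF (e a))
    (hx : ∀ a, e a x = onb g x a) : ∀ᶠ y in 𝓝 x, (gram g fun a => e a y).det ≠ 0 := by
  have h1 : ContMDiffAt 𝓘(ℝ, E) 𝓘(ℝ, ℝ) ∞ (fun y => (gram g fun a => e a y).det) x :=
    contMDiffAt_det fun i j => smooth_inner g (he i) (he j) x
  refine h1.continuousAt.eventually_ne ?_
  simp only [hx, gram_onb, Matrix.det_one]
  exact one_ne_zero

lemma contMDiffAt_gram_inv (g : RMetric E M) {x : M}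
    {e : Fin (Module.finrank ℝ E) → VField E M} (he : ∀ a, SmoothVF (e a))
    (hx : ∀ a, e a x = onb g x a) (a b : Fin (Module.finrank ℝ E)) :
    ContMDiffAt 𝓘(ℝ, E) 𝓘(ℝ, ℝ) ∞ (fun y => (gram g fun a => e a y)⁻¹ a b) x :=
  contMDiffAt_matrix_inv (A := fun y => gram g fun a => e a y)
    (fun i j => smooth_inner g (he i) (he j) x)
    (eventually_det_gram_ne_zero g he hx).self_of_nhds a b

variable [T2Space M]

lemma exists_smooth_frame (g : RMetric E M) (x : M) :
    ∃ e : Fin (Module.finrank ℝ E) → VField E M, (∀ a, SmoothVF (e a)) ∧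
      ∀ a, e a x = onb g x a :=
  ⟨fun a => (exists_smoothVF (onb g x a)).choose, fun a => (exists_smoothVF (onb g x a)).choose_spec.1,
    fun a => (exists_smoothVF (onb g x a)).choose_spec.2⟩

/-- A vector field is smooth if its inner products with all smooth vector fields are. -/
lemma smoothVF_of_inner (g : RMetric E M) {V : VField E M}
    (h : ∀ Z, SmoothVF Z → SmoothFn E (fun y => g.inner y (V y) (Z y))) : SmoothVF V := by
  intro x
  obtain ⟨e, he, hx⟩ := exists_smooth_frame g x
  have h1 : SmoothVFieldAt (fun y => ∑ a, ∑ b,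
      ((gram g fun a => e a y)⁻¹ a b * g.inner y (V y) (e a y)) • e b y) x :=
    SmoothVFieldAt.sum fun a _ => SmoothVFieldAt.sum fun b _ => SmoothVFieldAt.smul
      ((contMDiffAt_gram_inv g he hx a b).mul (h _ (he a) x)) (he b x)
  refine h1.congr ?_
  filter_upwards [eventually_det_gram_ne_zero g he hx] with y hy
  exact (sum_gram_inv g hy (V y)).symm

/-- Affine connections: operators that are linear in the direction, additive, local, satisfy the
Leibniz rule, and preserve smoothness. -/
structure IsConnection (D : Conn E M) : Prop where
  vadd : ∀ {Y}, SmoothVF Y → ∀ (x : M) (u v : TangentSpace 𝓘(ℝ, E) x),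
    D Y x (u + v) = D Y x u + D Y x v
  vsmul : ∀ {Y}, SmoothVF Y → ∀ (x : M) (c : ℝ) (u : TangentSpace 𝓘(ℝ, E) x),
    D Y x (c • u) = c • D Y x u
  add : ∀ {Y Z}, SmoothVF Y → SmoothVF Z → ∀ (x : M) (u : TangentSpace 𝓘(ℝ, E) x),
    D (fun y => Y y + Z y) x u = D Y x u + D Z x u
  leibniz : ∀ {φ Y}, SmoothFn E φ → SmoothVF Y → ∀ (x : M) (u : TangentSpace 𝓘(ℝ, E) x),
    D (fun y => φ y • Y y) x u = φ x • D Y x u + dirDeriv φ u • Y x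
  congr : ∀ {Y Z : VField E M} {x : M}, Y =ᶠ[𝓝 x] Z → D Y x = D Z x
  smooth : ∀ {X Y}, SmoothVF X → SmoothVF Y → SmoothVF (fun y => D Y y (X y))

instance (priority := low) completeSpace_model : CompleteSpace E := FiniteDimensional.complete ℝ E

section LeviCivita

variable (g : RMetric E M)

lemma koszul_eq_of_eq_left {X X' Y Z : VField E M} (hX : SmoothVF X) (hX' : SmoothVF X')
    (hY : SmoothVF Y) (hZ : SmoothVF Z) {x : M} (h : X x = X' x) :
    koszul g X Y Z x = koszul g X' Y Z x :=
  eq_of_tensorial (Φ := fun X => koszul g X Y Z x)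
    (fun _ _ h1 h2 => koszul_add_left g h1 h2 hY hZ x)
    (fun _ _ h1 h2 => koszul_smul_left g h1 h2 hY hZ x) hX hX' h

lemma koszul_eq_of_eq_right {X Y Z Z' : VField E M} (hX : SmoothVF X)
    (hY : SmoothVF Y) (hZ : SmoothVF Z) (hZ' : SmoothVF Z') {x : M} (h : Z x = Z' x) :
    koszul g X Y Z x = koszul g X Y Z' x :=
  eq_of_tensorial (Φ := fun Z => koszul g X Y Z x)
    (fun _ _ h1 h2 => koszul_add_right g hX hY h1 h2 x)
    (fun _ _ h1 h2 => koszul_smul_right g h1 hX hY h2 x) hZ hZ' h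

lemma koszul_sum_right {ι : Type*} (s : Finset ι) {X Y : VField E M} {Z : ι → VField E M}
    {c : ι → ℝ} (hX : SmoothVF X) (hY : SmoothVF Y) (hZ : ∀ i, SmoothVF (Z i)) (x : M) :
    koszul g X Y (fun y => ∑ i ∈ s, c i • Z i y) x = ∑ i ∈ s, c i * koszul g X Y (Z i) x := by
  classical
  induction s using Finset.induction_on with
  | empty =>
    have := koszul_smul_right (φ := fun _ => 0) g contMDiff_const hX hY hX x
    simpa using this
  | insert a s ha ih =>
    simp only [Finset.sum_insert ha]
    rw [koszul_add_right g hX hY ((hZ a).const_smul (c a))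
      (SmoothVF.sum fun i _ => (hZ i).const_smul (c i)), ih,
      koszul_smul_right (φ := fun _ => c a) g contMDiff_const hX hY (hZ a)]

/-- The Koszul formula. -/
lemma inner_leviCivita {X Y Z : VField E M} (hX : SmoothVF X) (hY : SmoothVF Y) (hZ : SmoothVF Z)
    (x : M) : g.inner x (leviCivita g Y x (X x)) (Z x) = 1 / 2 * koszul g X Y Z x := by
  obtain ⟨V, hV, hVx⟩ := exists_smoothVF_constExt (X x)
  choose e he hex using fun a => exists_smoothVF_constExt (onb g x a)
  have hex' : ∀ a, e a x = onb g x a := fun a => by rw [(hex a).eq_of_nhds, constExt_self]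
  have h1 : ∀ a, koszul g (constExt (X x)) Y (constExt (onb g x a)) x = koszul g X Y (e a) x :=
    fun a => by
    rw [koszul_congr g hVx.symm (EventuallyEq.refl _ Y) (hex a).symm]
    exact koszul_eq_of_eq_left g hV hX hY (he a) (by rw [hVx.eq_of_nhds, constExt_self])
  have h2 : koszul g X Y Z x = ∑ a, g.inner x (Z x) (onb g x a) * koszul g X Y (e a) x := by
    rw [← koszul_sum_right g _ hX hY he]
    refine koszul_eq_of_eq_right g hX hY hZ (SmoothVF.sum fun a _ => (he a).const_smul _) ?_
    simp only [hex', sum_inner_onb]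
  rw [h2, leviCivita, inner_sum_left, Finset.mul_sum]
  refine Finset.sum_congr rfl fun a _ => ?_
  rw [inner_smul_left, h1, g.symm x (Z x)]
  ring

lemma smooth_koszul {X Y Z : VField E M} (hX : SmoothVF X) (hY : SmoothVF Y) (hZ : SmoothVF Z) :
    SmoothFn E (koszul g X Y Z) :=
  (((((SmoothVF.dirDeriv (smooth_inner g hY hZ) hX).add
    (SmoothVF.dirDeriv (smooth_inner g hZ hX) hY)).sub
    (SmoothVF.dirDeriv (smooth_inner g hX hY) hZ)).add
    (smooth_inner g (hX.mlieBracket hY) hZ)).sub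
    (smooth_inner g (hY.mlieBracket hZ) hX)).add
    (smooth_inner g (hZ.mlieBracket hX) hY)

lemma isConnection_leviCivita : IsConnection (leviCivita g) where
  vadd := fun {Y} hY x u v => by
    obtain ⟨U, hU, rfl⟩ := exists_smoothVF u
    obtain ⟨V, hV, rfl⟩ := exists_smoothVF v
    refine eq_of_inner_eq g fun w => ?_
    obtain ⟨W, hW, rfl⟩ := exists_smoothVF w
    rw [inner_add_left, inner_leviCivita g hU hY hW, inner_leviCivita g hV hY hW]
    exact (inner_leviCivita g (hU.add hV) hY hW x).trans
      (by rw [koszul_add_left g hU hV hY hW]; ring)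
  vsmul := fun {Y} hY x c u => by
    obtain ⟨U, hU, rfl⟩ := exists_smoothVF u
    refine eq_of_inner_eq g fun w => ?_
    obtain ⟨W, hW, rfl⟩ := exists_smoothVF w
    rw [inner_smul_left, inner_leviCivita g hU hY hW]
    exact (inner_leviCivita g (hU.const_smul c) hY hW x).trans
      (by rw [koszul_smul_left (φ := fun _ => c) g contMDiff_const hU hY hW]; ring)
  add := fun {Y Z} hY hZ x u => by
    obtain ⟨U, hU, rfl⟩ := exists_smoothVF u
    refine eq_of_inner_eq g fun w => ?_
    obtain ⟨W, hW, rfl⟩ := exists_smoothVF w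
    rw [inner_add_left, inner_leviCivita g hU hY hW, inner_leviCivita g hU hZ hW,
      inner_leviCivita g hU (hY.add hZ) hW, koszul_add_middle g hU hY hZ hW]
    ring
  leibniz := fun {φ Y} hφ hY x u => by
    obtain ⟨U, hU, rfl⟩ := exists_smoothVF u
    refine eq_of_inner_eq g fun w => ?_
    obtain ⟨W, hW, rfl⟩ := exists_smoothVF w
    rw [inner_add_left, inner_smul_left, inner_smul_left, inner_leviCivita g hU hY hW,
      inner_leviCivita g hU (hY.smul hφ) hW, koszul_smul_middle g hφ hU hY hW]
    ring
  congr := fun {Y Z x} h => by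
    funext v
    simp only [leviCivita]
    refine Finset.sum_congr rfl fun a _ => ?_
    exact congrArg (fun r => ((1 / 2 : ℝ) * r) • onb g x a)
      (koszul_congr g (EventuallyEq.refl (𝓝 x) (constExt v)) h
        (EventuallyEq.refl (𝓝 x) (constExt (onb g x a))))
  smooth := fun {X Y} hX hY => smoothVF_of_inner g fun Z hZ => by
    simp only [inner_leviCivita g hX hY hZ]
    exact contMDiff_const.mul (smooth_koszul g hX hY hZ)

/-- The Levi-Civita connection is metric. -/
lemma dirDeriv_inner {Y Z : VField E M} (hY : SmoothVF Y) (hZ : SmoothVF Z) (x : M)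
    (v : TangentSpace 𝓘(ℝ, E) x) :
    dirDeriv (fun y => g.inner y (Y y) (Z y)) v =
      g.inner x (leviCivita g Y x v) (Z x) + g.inner x (Y x) (leviCivita g Z x v) := by
  obtain ⟨X, hX, rfl⟩ := exists_smoothVF v
  rw [g.symm x (Y x), inner_leviCivita g hX hY hZ, inner_leviCivita g hX hZ hY]
  simp only [koszul]
  rw [mlieBracket_swap_apply (V := X) (W := Z), mlieBracket_swap_apply (V := Y) (W := X),
    mlieBracket_swap_apply (V := Z) (W := Y)]
  simp only [inner_neg_left]
  have h1 : (fun y => g.inner y (Z y) (Y y)) = fun y => g.inner y (Y y) (Z y) := by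
    funext y; exact g.symm y _ _
  have h2 : (fun y => g.inner y (X y) (Z y)) = fun y => g.inner y (Z y) (X y) := by
    funext y; exact g.symm y _ _
  have h3 : (fun y => g.inner y (X y) (Y y)) = fun y => g.inner y (Y y) (X y) := by
    funext y; exact g.symm y _ _
  rw [h1, h2, h3]
  ring

/-- The Levi-Civita connection is torsion-free. -/
lemma leviCivita_sub_leviCivita {X Y : VField E M} (hX : SmoothVF X) (hY : SmoothVF Y) (x : M) :
    leviCivita g Y x (X x) - leviCivita g X x (Y x) = mlieBracket 𝓘(ℝ, E) X Y x := by
  refine eq_of_inner_eq g fun w => ?_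
  obtain ⟨Z, hZ, rfl⟩ := exists_smoothVF w
  rw [inner_sub_left, inner_leviCivita g hX hY hZ, inner_leviCivita g hY hX hZ]
  simp only [koszul]
  rw [mlieBracket_swap_apply (V := X) (W := Z), mlieBracket_swap_apply (V := Y) (W := X),
    mlieBracket_swap_apply (V := Z) (W := Y)]
  simp only [inner_neg_left]
  have h1 : (fun y => g.inner y (Z y) (Y y)) = fun y => g.inner y (Y y) (Z y) := by
    funext y; exact g.symm y _ _
  have h2 : (fun y => g.inner y (X y) (Z y)) = fun y => g.inner y (Z y) (X y) := by
    funext y; exact g.symm y _ _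
  have h3 : (fun y => g.inner y (X y) (Y y)) = fun y => g.inner y (Y y) (X y) := by
    funext y; exact g.symm y _ _
  rw [h1, h2, h3]
  ring

end LeviCivita

end Connections

section Tensors

variable {E : Type*} [NormedAddCommGroup E] [NormedSpace ℝ E]
  {M : Type*} [TopologicalSpace M] [ChartedSpace E M] [IsManifold 𝓘(ℝ, E) ∞ M]

/-- A variant of `IsTensorField` whose smoothness is tested on global smooth vector fields only. -/
structure IsTensor {k : ℕ} (T : TField E M k) : Prop where
  multilinear : ∀ x, ∃ A : MultilinearMap ℝ (fun _ : Fin k => TangentSpace 𝓘(ℝ, E) x) ℝ,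
    T x = fun w => A w
  smooth : ∀ X : Fin k → VField E M, (∀ i, SmoothVF (X i)) →
    SmoothFn E (fun y => T y (fun i => X i y))

lemma IsDiffForm.isTensor {k : ℕ} {T : TField E M k} (h : IsDiffForm T) : IsTensor T where
  multilinear := fun x => by
    obtain ⟨A, hA⟩ := h.alternating x
    exact ⟨A.toMultilinearMap, hA⟩
  smooth := fun X hX x => h.smooth x X fun i => hX i x

namespace IsTensor

variable {k : ℕ} {T : TField E M k} (h : IsTensor T)
include h

lemma update_add (x : M) (w : Fin k → TangentSpace 𝓘(ℝ, E) x) (i : Fin k)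
    (a b : TangentSpace 𝓘(ℝ, E) x) :
    T x (Function.update w i (a + b)) = T x (Function.update w i a) + T x (Function.update w i b) := by
  obtain ⟨A, hA⟩ := h.multilinear x
  simp only [hA, A.map_update_add]

lemma update_smul (x : M) (w : Fin k → TangentSpace 𝓘(ℝ, E) x) (i : Fin k)
    (c : ℝ) (a : TangentSpace 𝓘(ℝ, E) x) :
    T x (Function.update w i (c • a)) = c * T x (Function.update w i a) := by
  obtain ⟨A, hA⟩ := h.multilinear x
  simp only [hA, A.map_update_smul, smul_eq_mul]

lemma isLinear (x : M) (w : Fin k → TangentSpace 𝓘(ℝ, E) x) (i : Fin k) :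
    IsLinearMap ℝ (fun u => T x (Function.update w i u)) :=
  ⟨fun _ _ => h.update_add x w i _ _, fun _ _ => h.update_smul x w i _ _⟩

end IsTensor

end Tensors

/-! ### Covariant derivatives of tensors -/

section CovariantDerivative

variable {E : Type*} [NormedAddCommGroup E] [NormedSpace ℝ E]
  {M : Type*} [TopologicalSpace M] [ChartedSpace E M] [IsManifold 𝓘(ℝ, E) ∞ M]

/-- Linearity in each argument, in the form in which it is checked for the tensors below. -/
lemma IsTensor.of_isLinear {k : ℕ} {T : TField E M k}
    (h : ∀ (x : M) (w : Fin k → TangentSpace 𝓘(ℝ, E) x) (i : Fin k),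
      IsLinearMap ℝ (fun u => T x (Function.update w i u)))
    (hs : ∀ X : Fin k → VField E M, (∀ i, SmoothVF (X i)) →
      SmoothFn E (fun y => T y (fun i => X i y))) : IsTensor T where
  multilinear := fun x => by
    refine ⟨{ toFun := T x, map_update_add' := ?_, map_update_smul' := ?_ }, rfl⟩
    · intro inst w i a b
      rw [Subsingleton.elim inst (instDecidableEqFin k)]
      exact (h x w i).map_add a b
    · intro inst w i c a
      rw [Subsingleton.elim inst (instDecidableEqFin k)]
      exact (h x w i).map_smul c a
  smooth := hs

/-- The covariant derivative of `T` computed with the vector fields `W i` in its arguments. -/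
def covAux {k : ℕ} (D : Fin k → Conn E M) (T : TField E M k) (W : Fin k → VField E M) (x : M)
    (v : TangentSpace 𝓘(ℝ, E) x) : ℝ :=
  dirDeriv (fun y => T y (fun i => W i y)) v
    - ∑ i : Fin k, T x (Function.update (fun j => W j x) i (D i (W i) x v))

variable [FiniteDimensional ℝ E]

lemma update_apply_point {k : ℕ} (W : Fin k → VField E M) (i : Fin k) (X : VField E M) (y : M) :
    (fun j => Function.update W i X j y) = Function.update (fun j => W j y) i (X y) := by
  funext j
  by_cases h : j = i
  · subst h; simp
  · simp [h]

variable {k : ℕ} {D : Fin k → Conn E M} {T : TField E M k}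

lemma smoothVF_update {W : Fin k → VField E M} (hW : ∀ i, SmoothVF (W i)) (i : Fin k)
    {X : VField E M} (hX : SmoothVF X) (j : Fin k) : SmoothVF (Function.update W i X j) := by
  by_cases h : j = i
  · subst h; simpa using hX
  · simpa [h] using hW j

lemma smoothFn_update (hT : IsTensor T) {W : Fin k → VField E M} (hW : ∀ i, SmoothVF (W i))
    (i : Fin k) {X : VField E M} (hX : SmoothVF X) :
    SmoothFn E (fun y => T y (Function.update (fun j => W j y) i (X y))) := by
  have := hT.smooth _ (smoothVF_update hW i hX)
  simpa only [update_apply_point] using this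

lemma covAux_update_add (hD : ∀ i, IsConnection (D i)) (hT : IsTensor T) {W : Fin k → VField E M}
    (hW : ∀ i, SmoothVF (W i)) (i : Fin k) {X Y : VField E M} (hX : SmoothVF X) (hY : SmoothVF Y)
    (x : M) (v : TangentSpace 𝓘(ℝ, E) x) :
    covAux D T (Function.update W i fun y => X y + Y y) x v =
      covAux D T (Function.update W i X) x v + covAux D T (Function.update W i Y) x v := by
  simp only [covAux, update_apply_point, hT.update_add]
  rw [dirDeriv_add ((smoothFn_update hT hW i hX).diff x) ((smoothFn_update hT hW i hY).diff x)]
  have : ∀ j, T x (Function.update (Function.update (fun j => W j x) i (X x + Y x)) j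
      (D j (Function.update W i (fun y => X y + Y y) j) x v)) =
      T x (Function.update (Function.update (fun j => W j x) i (X x)) j
        (D j (Function.update W i X j) x v)) +
      T x (Function.update (Function.update (fun j => W j x) i (Y x)) j
        (D j (Function.update W i Y j) x v)) := by
    intro j
    by_cases h : j = i
    · subst h
      simp only [Function.update_self, Function.update_idem]
      rw [(hD j).add hX hY, hT.update_add]
    · simp only [Function.update_of_ne h]
      rw [Function.update_comm (Ne.symm h), Function.update_comm (Ne.symm h),
        Function.update_comm (Ne.symm h), hT.update_add]
  rw [Finset.sum_congr rfl fun j _ => this j, Finset.sum_add_distrib]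
  ring

lemma covAux_update_smul (hD : ∀ i, IsConnection (D i)) (hT : IsTensor T) {W : Fin k → VField E M}
    (hW : ∀ i, SmoothVF (W i)) (i : Fin k) {φ : M → ℝ} (hφ : SmoothFn E φ) {X : VField E M}
    (hX : SmoothVF X) (x : M) (v : TangentSpace 𝓘(ℝ, E) x) :
    covAux D T (Function.update W i fun y => φ y • X y) x v =
      φ x * covAux D T (Function.update W i X) x v := by
  simp only [covAux, update_apply_point, hT.update_smul]
  rw [dirDeriv_mul (hφ.diff x) ((smoothFn_update hT hW i hX).diff x)]
  have : ∀ j, T x (Function.update (Function.update (fun j => W j x) i (φ x • X x)) j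
      (D j (Function.update W i (fun y => φ y • X y) j) x v)) =
      φ x * T x (Function.update (Function.update (fun j => W j x) i (X x)) j
        (D j (Function.update W i X j) x v)) +
      if j = i then T x (Function.update (fun j => W j x) i (X x)) * dirDeriv φ v else 0 := by
    intro j
    by_cases h : j = i
    · subst h
      simp only [Function.update_self, Function.update_idem, if_true]
      rw [(hD j).leibniz hφ hX, hT.update_add, hT.update_smul, hT.update_smul]
      ring
    · simp only [Function.update_of_ne h, h, if_false, add_zero]
      rw [Function.update_comm (Ne.symm h), Function.update_comm (Ne.symm h), hT.update_smul]
  rw [Finset.sum_congr rfl fun j _ => this j, Finset.sum_add_distrib, ← Finset.mul_sum]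
  simp only [Finset.sum_ite_eq', Finset.mem_univ, if_true]
  ring

variable [T2Space M]

/-- The value of the covariant derivative does not depend on the extensions of the arguments. -/
lemma covAux_eq_of_eq (hD : ∀ i, IsConnection (D i)) (hT : IsTensor T) {W W' : Fin k → VField E M}
    (hW : ∀ i, SmoothVF (W i)) (hW' : ∀ i, SmoothVF (W' i)) {x : M}
    (h : ∀ i, W i x = W' i x) (v : TangentSpace 𝓘(ℝ, E) x) :
    covAux D T W x v = covAux D T W' x v := by
  classical
  have key : ∀ s : Finset (Fin k), covAux D T (s.piecewise W' W) x v = covAux D T W x v := by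
    intro s
    induction s using Finset.induction_on with
    | empty => simp
    | insert a s ha ih =>
      have hs : ∀ i, SmoothVF (s.piecewise W' W i) := fun i => by
        by_cases hi : i ∈ s
        · simpa [hi] using hW' i
        · simpa [hi] using hW i
      rw [Finset.piecewise_insert, ← ih]
      conv_rhs => rw [← Function.update_eq_self a (s.piecewise W' W)]
      refine eq_of_tensorial (Φ := fun X => covAux D T (Function.update (s.piecewise W' W) a X) x v)
        (fun X Y hX hY => covAux_update_add hD hT hs a hX hY x v)
        (fun φ X hφ hX => covAux_update_smul hD hT hs a hφ hX x v) (hW' a) (hs a) ?_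
      simp [ha, h]
  have := key Finset.univ
  rw [← this]
  simp

/-- The covariant derivative of a tensor field may be computed with arbitrary smooth extensions of
the arguments. -/
lemma covD_eq_covAux (hD : ∀ i, IsConnection (D i)) (hT : IsTensor T) {W : Fin k → VField E M}
    (hW : ∀ i, SmoothVF (W i)) {x : M} {w : Fin (k + 1) → TangentSpace 𝓘(ℝ, E) x}
    (h : ∀ i, W i x = w i.succ) : covD D T x w = covAux D T W x (w 0) := by
  choose U hU hUx using fun i : Fin k => exists_smoothVF_constExt (w i.succ)
  have h1 : covD D T x w = covAux D T U x (w 0) := by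
    rw [covD, covAux]
    have e1 : (fun y => T y fun i => constExt (w i.succ) y) =ᶠ[𝓝 x] fun y => T y fun i => U i y := by
      filter_upwards [eventually_all.2 hUx] with y hy
      simp only [hy]
    have e2 : ∀ i, w i.succ = U i x := fun i => by rw [(hUx i).eq_of_nhds, constExt_self]
    rw [dirDeriv_congr e1]
    congr 1
    refine Finset.sum_congr rfl fun i _ => ?_
    rw [(hD i).congr (hUx i)]
    congr 2
    funext j
    exact e2 j
  rw [h1]
  exact covAux_eq_of_eq hD hT hU hW
    (fun i => by rw [(hUx i).eq_of_nhds, constExt_self, h]) _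

lemma isTensor_covD (hD : ∀ i, IsConnection (D i)) (hT : IsTensor T) : IsTensor (covD D T) := by
  refine IsTensor.of_isLinear (fun x w i => ?_) fun X hX => ?_
  · choose W hW hWx using fun i => exists_smoothVF (w i)
    refine Fin.cases ?_ (fun i => ?_) i
    · have h0 : ∀ u, covD D T x (Function.update w 0 u) = covAux D T (fun i => W i.succ) x u :=
        fun u => by
        rw [covD_eq_covAux hD hT (W := fun i => W i.succ) (fun i => hW _) (by simp [hWx])]
        simp
      simp only [h0, covAux]
      constructor
      · intro u v
        simp only [(hD _).vadd (hW _), hT.update_add, dirDeriv_vadd, Finset.sum_add_distrib]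
        ring
      · intro c u
        simp only [(hD _).vsmul (hW _), hT.update_smul, dirDeriv_vsmul, ← Finset.mul_sum, smul_eq_mul]
        ring
    · have h0 : ∀ U, SmoothVF U → covD D T x (Function.update w i.succ (U x)) =
          covAux D T (Function.update (fun i => W i.succ) i U) x (w 0) := fun U hU => by
        rw [covD_eq_covAux hD hT (W := Function.update (fun i => W i.succ) i U)
          (smoothVF_update (fun i => hW _) i hU) (fun j => ?_)]
        · rw [Function.update_of_ne (Fin.succ_ne_zero i).symm]
        · by_cases hj : j = i
          · subst hj; simp
          · simp [hj, hWx]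
      constructor
      · intro u v
        obtain ⟨U, hU, rfl⟩ := exists_smoothVF u
        obtain ⟨V, hV, rfl⟩ := exists_smoothVF v
        exact (h0 _ (hU.add hV)).trans ((covAux_update_add hD hT (fun i => hW _) i hU hV x _).trans
          (by rw [← h0 U hU, ← h0 V hV]))
      · intro c u
        obtain ⟨U, hU, rfl⟩ := exists_smoothVF u
        exact (h0 _ (hU.const_smul c)).trans ((covAux_update_smul (φ := fun _ => c) hD hT
          (fun i => hW _) i contMDiff_const hU x _).trans (by rw [← h0 U hU]; rfl))
  · have : (fun y => covD D T y fun i => X i y) =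
        fun y => covAux D T (fun i => X i.succ) y (X 0 y) := by
      funext y
      exact covD_eq_covAux hD hT (fun i => hX _) fun i => rfl
    rw [this]
    refine ContMDiff.sub (SmoothVF.dirDeriv (hT.smooth _ fun i => hX _) (hX 0)) ?_
    refine contMDiff_finsetSum fun i _ => ?_
    exact smoothFn_update hT (fun i => hX _) i ((hD i).smooth (hX 0) (hX _))

end CovariantDerivative

/-! ### Tensors of low rank, parallel frames and traces -/

section Arity

variable {E : Type*} [NormedAddCommGroup E] [NormedSpace ℝ E]
  {M : Type*} [TopologicalSpace M] [ChartedSpace E M] [IsManifold 𝓘(ℝ, E) ∞ M]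

lemma IsTensor.linear₁ {T : TField E M 1} (hT : IsTensor T) (x : M) :
    IsLinearMap ℝ (fun u => T x ![u]) := by
  convert hT.isLinear x ![0] 0 using 3 with u
  funext i; fin_cases i; rfl

lemma IsTensor.linear₂₀ {T : TField E M 2} (hT : IsTensor T) (x : M)
    (v : TangentSpace 𝓘(ℝ, E) x) : IsLinearMap ℝ (fun u => T x ![u, v]) := by
  convert hT.isLinear x ![0, v] 0 using 3 with u
  funext i; fin_cases i <;> rfl

lemma IsTensor.linear₂₁ {T : TField E M 2} (hT : IsTensor T) (x : M)
    (v : TangentSpace 𝓘(ℝ, E) x) : IsLinearMap ℝ (fun u => T x ![v, u]) := by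
  convert hT.isLinear x ![v, 0] 1 using 3 with u
  funext i; fin_cases i <;> rfl

lemma IsTensor.linear₃₀ {T : TField E M 3} (hT : IsTensor T) (x : M)
    (v w : TangentSpace 𝓘(ℝ, E) x) : IsLinearMap ℝ (fun u => T x ![u, v, w]) := by
  convert hT.isLinear x ![0, v, w] 0 using 3 with u
  funext i; fin_cases i <;> rfl

lemma IsTensor.linear₃₁ {T : TField E M 3} (hT : IsTensor T) (x : M)
    (v w : TangentSpace 𝓘(ℝ, E) x) : IsLinearMap ℝ (fun u => T x ![v, u, w]) := by
  convert hT.isLinear x ![v, 0, w] 1 using 3 with u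
  funext i; fin_cases i <;> rfl

lemma IsTensor.linear₃₂ {T : TField E M 3} (hT : IsTensor T) (x : M)
    (v w : TangentSpace 𝓘(ℝ, E) x) : IsLinearMap ℝ (fun u => T x ![v, w, u]) := by
  convert hT.isLinear x ![v, w, 0] 2 using 3 with u
  funext i; fin_cases i <;> rfl

lemma IsTensor.smooth₁ {T : TField E M 1} (hT : IsTensor T) {X : VField E M} (hX : SmoothVF X) :
    SmoothFn E (fun y => T y ![X y]) := by
  convert hT.smooth ![X] (by simpa using hX) using 3 with y
  funext i; fin_cases i; rfl

lemma IsTensor.smooth₂ {T : TField E M 2} (hT : IsTensor T) {X Y : VField E M} (hX : SmoothVF X)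
    (hY : SmoothVF Y) : SmoothFn E (fun y => T y ![X y, Y y]) := by
  convert hT.smooth ![X, Y] (by simp [Fin.forall_fin_succ, hX, hY]) using 3 with y
  funext i; fin_cases i <;> rfl

lemma IsTensor.smooth₃ {T : TField E M 3} (hT : IsTensor T) {X Y Z : VField E M} (hX : SmoothVF X)
    (hY : SmoothVF Y) (hZ : SmoothVF Z) : SmoothFn E (fun y => T y ![X y, Y y, Z y]) := by
  convert hT.smooth ![X, Y, Z] (by simp [Fin.forall_fin_succ, hX, hY, hZ]) using 3 with y
  funext i; fin_cases i <;> rfl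

omit [IsManifold 𝓘(ℝ, E) ∞ M] in
lemma DiffFnAt.mul' {φ ψ : M → ℝ} {x : M} (hφ : DiffFnAt E φ x) (hψ : DiffFnAt E ψ x) :
    DiffFnAt E (fun y => φ y * ψ y) x := MDifferentiableAt.mul hφ hψ

lemma linear_apply_sum {ι V A : Type*} [AddCommGroup V] [Module ℝ V] [AddCommGroup A] [Module ℝ A]
    {L : V → A} (hL : IsLinearMap ℝ L) (s : Finset ι) (e : ι → V) :
    L (∑ i ∈ s, e i) = ∑ i ∈ s, L (e i) :=
  map_sum (IsLinearMap.mk' L hL) e s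

lemma linear_apply_sum_smul {ι V A : Type*} [AddCommGroup V] [Module ℝ V] [AddCommGroup A]
    [Module ℝ A] {L : V → A} (hL : IsLinearMap ℝ L) (s : Finset ι) (c : ι → ℝ) (e : ι → V) :
    L (∑ i ∈ s, c i • e i) = ∑ i ∈ s, c i • L (e i) := by
  rw [linear_apply_sum hL]
  exact Finset.sum_congr rfl fun i _ => hL.map_smul _ _

lemma linear_map_smul {V : Type*} [AddCommGroup V] [Module ℝ V] {L : V → ℝ}
    (hL : IsLinearMap ℝ L) (c : ℝ) (v : V) : L (c • v) = c * L v := hL.map_smul c v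

variable [FiniteDimensional ℝ E] [T2Space M]

lemma covD_one {D : Fin 1 → Conn E M} (hD : ∀ i, IsConnection (D i)) {T : TField E M 1}
    (hT : IsTensor T) {Y : VField E M} (hY : SmoothVF Y) (x : M) (v : TangentSpace 𝓘(ℝ, E) x) :
    covD D T x ![v, Y x] = dirDeriv (fun y => T y ![Y y]) v - T x ![D 0 Y x v] := by
  rw [covD_eq_covAux hD hT (W := ![Y]) (by simpa using hY) (by simp)]
  simp only [covAux, Fin.sum_univ_one]
  congr 2
  · funext y; congr 1; funext i; fin_cases i; rfl
  · funext i; fin_cases i; rfl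

lemma covD_two {D : Fin 2 → Conn E M} (hD : ∀ i, IsConnection (D i)) {T : TField E M 2}
    (hT : IsTensor T) {Y Z : VField E M} (hY : SmoothVF Y) (hZ : SmoothVF Z) (x : M)
    (v : TangentSpace 𝓘(ℝ, E) x) :
    covD D T x ![v, Y x, Z x] = dirDeriv (fun y => T y ![Y y, Z y]) v - T x ![D 0 Y x v, Z x]
      - T x ![Y x, D 1 Z x v] := by
  rw [covD_eq_covAux hD hT (W := ![Y, Z]) (by simp [Fin.forall_fin_succ, hY, hZ])
    (by simp [Fin.forall_fin_succ])]
  simp only [covAux, Fin.sum_univ_two, ← sub_sub]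
  refine congrArg₂ _ (congrArg₂ _ ?_ (congrArg _ ?_)) (congrArg _ ?_)
  · refine congrArg (fun φ => dirDeriv φ v) (funext fun y => congrArg (T y) (funext fun i => ?_))
    fin_cases i <;> rfl
  · funext i; fin_cases i <;> rfl
  · funext i; fin_cases i <;> rfl

lemma covD_three {D : Fin 3 → Conn E M} (hD : ∀ i, IsConnection (D i)) {T : TField E M 3}
    (hT : IsTensor T) {X Y Z : VField E M} (hX : SmoothVF X) (hY : SmoothVF Y) (hZ : SmoothVF Z)
    (x : M) (v : TangentSpace 𝓘(ℝ, E) x) :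
    covD D T x ![v, X x, Y x, Z x] = dirDeriv (fun y => T y ![X y, Y y, Z y]) v
      - T x ![D 0 X x v, Y x, Z x] - T x ![X x, D 1 Y x v, Z x] - T x ![X x, Y x, D 2 Z x v] := by
  rw [covD_eq_covAux hD hT (W := ![X, Y, Z]) (by simp [Fin.forall_fin_succ, hX, hY, hZ])
    (by simp [Fin.forall_fin_succ])]
  simp only [covAux, Fin.sum_univ_three, ← sub_sub]
  refine congrArg₂ _ (congrArg₂ _ (congrArg₂ _ ?_ (congrArg _ ?_)) (congrArg _ ?_)) (congrArg _ ?_)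
  · refine congrArg (fun φ => dirDeriv φ v) (funext fun y => congrArg (T y) (funext fun i => ?_))
    fin_cases i <;> rfl
  · funext i; fin_cases i <;> rfl
  · funext i; fin_cases i <;> rfl
  · funext i; fin_cases i <;> rfl

end Arity

section Trace

variable {E : Type*} [NormedAddCommGroup E] [NormedSpace ℝ E] [FiniteDimensional ℝ E]
  {M : Type*} [TopologicalSpace M] [ChartedSpace E M] [IsManifold 𝓘(ℝ, E) ∞ M]

/-- Smooth fields of bilinear forms. -/
structure IsBilin (B : ∀ x : M, TangentSpace 𝓘(ℝ, E) x → TangentSpace 𝓘(ℝ, E) x → ℝ) : Prop where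
  left : ∀ x v, IsLinearMap ℝ (fun u => B x u v)
  right : ∀ x u, IsLinearMap ℝ (fun v => B x u v)
  smooth : ∀ {X Y}, SmoothVF X → SmoothVF Y → SmoothFn E (fun y => B y (X y) (Y y))

variable (g : RMetric E M)

lemma IsConnection.sum {D : Conn E M} (hD : IsConnection D) {ι : Type*} (s : Finset ι)
    {Y : ι → VField E M} (hY : ∀ i, SmoothVF (Y i)) (x : M) (u : TangentSpace 𝓘(ℝ, E) x) :
    D (fun y => ∑ i ∈ s, Y i y) x u = ∑ i ∈ s, D (Y i) x u := by
  classical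
  induction s using Finset.induction_on with
  | empty =>
    have := hD.leibniz (φ := fun _ => 0) (Y := fun _ => 0) contMDiff_const SmoothVF.zero x u
    simpa [dirDeriv_const] using this
  | insert a s ha ih =>
    simp only [Finset.sum_insert ha]
    rw [hD.add (hY a) (SmoothVF.sum fun i _ => hY i), ih]

variable [T2Space M]

/-- Every tangent vector at `x` extends to a vector field that is parallel at `x`. -/
lemma exists_parallel_at {x : M} (v : TangentSpace 𝓘(ℝ, E) x) :
    ∃ W : VField E M, SmoothVF W ∧ W x = v ∧ ∀ u, leviCivita g W x u = 0 := by
  have hD := isConnection_leviCivita g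
  obtain ⟨X, hX, rfl⟩ := exists_smoothVF v
  obtain ⟨e, he, hex⟩ := exists_smooth_frame g x
  -- an arbitrary extension `X` is corrected by functions that vanish at `x`, with differential `l a`
  let l : Fin (Module.finrank ℝ E) → TangentSpace 𝓘(ℝ, E) x →ₗ[ℝ] ℝ := fun a =>
    { toFun := fun u => -g.inner x (leviCivita g X x u) (onb g x a)
      map_add' := fun u v => by rw [hD.vadd hX, inner_add_left]; ring
      map_smul' := fun c u => by rw [hD.vsmul hX, inner_smul_left, RingHom.id_apply, smul_eq_mul]; ring }
  let l' : Fin (Module.finrank ℝ E) → E →L[ℝ] ℝ := fun a =>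
    LinearMap.toContinuousLinearMap (show E →ₗ[ℝ] ℝ from l a)
  choose ψ hψ hψ0 hψd using fun a => exists_smoothFn_dirDeriv (x := x) (l' a)
  have hs : ∀ a, SmoothVF (fun y => ψ a y • e a y) := fun a => (he a).smul (hψ a)
  refine ⟨fun y => X y + ∑ a, ψ a y • e a y, hX.add (SmoothVF.sum fun a _ => hs a), ?_, fun u => ?_⟩
  · simp [hψ0]
  · rw [hD.add hX (SmoothVF.sum fun a _ => hs a), hD.sum _ hs]
    have : ∀ a, leviCivita g (fun y => ψ a y • e a y) x u =
        -(g.inner x (leviCivita g X x u) (onb g x a) • onb g x a) := fun a => by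
      rw [hD.leibniz (hψ a) (he a), hψ0, zero_smul, zero_add, hψd, hex, ← neg_smul]
      rfl
    simp only [this, Finset.sum_neg_distrib, sum_inner_onb, add_neg_cancel]

/-- Smooth fields `A a` that are orthonormal and parallel at `x`. -/
structure IsParallelFrame (x : M) (A : Fin (Module.finrank ℝ E) → VField E M) : Prop where
  smooth : ∀ a, SmoothVF (A a)
  apply : ∀ a, A a x = onb g x a
  parallel : ∀ a u, leviCivita g (A a) x u = 0

lemma exists_parallelFrame (x : M) : ∃ A, IsParallelFrame g x A :=
  ⟨fun a => (exists_parallel_at g (onb g x a)).choose,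
    fun a => (exists_parallel_at g (onb g x a)).choose_spec.1,
    fun a => (exists_parallel_at g (onb g x a)).choose_spec.2.1,
    fun a => (exists_parallel_at g (onb g x a)).choose_spec.2.2⟩

variable {g}

omit [T2Space M] in
/-- The trace of a bilinear form in an arbitrary basis. The orthonormal bases `onb g x` are chosen
pointwise and do not vary smoothly; this formula replaces them by smooth frames when a trace has to
be differentiated. -/
lemma sum_bilin_onb {x : M} {B : TangentSpace 𝓘(ℝ, E) x → TangentSpace 𝓘(ℝ, E) x → ℝ}
    (h1 : ∀ v, IsLinearMap ℝ (fun u => B u v)) (h2 : ∀ u, IsLinearMap ℝ (fun v => B u v))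
    {e : Fin (Module.finrank ℝ E) → TangentSpace 𝓘(ℝ, E) x} (he : (gram g e).det ≠ 0) :
    ∑ k, B (onb g x k) (onb g x k) = ∑ a, ∑ b, (gram g e)⁻¹ a b * B (e a) (e b) := by
  have h3 : ∀ k, B (onb g x k) (onb g x k) =
      ∑ a, ∑ b, (gram g e)⁻¹ a b * (g.inner x (e a) (onb g x k) * B (onb g x k) (e b)) := by
    intro k
    have h4 := congrArg (fun v => B (onb g x k) v) (sum_gram_inv g he (onb g x k))
    rw [← h4, linear_apply_sum (h2 _)]
    refine Finset.sum_congr rfl fun a _ => ?_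
    rw [linear_apply_sum_smul (h2 _)]
    refine Finset.sum_congr rfl fun b _ => ?_
    rw [smul_eq_mul, g.symm x (onb g x k), mul_assoc]
  have h4 : ∀ a b, ∑ k, g.inner x (e a) (onb g x k) * B (onb g x k) (e b) = B (e a) (e b) := by
    intro a b
    conv_rhs => rw [← sum_inner_onb g (e a)]
    exact (linear_apply_sum_smul (h1 (e b)) _ _ _).symm
  rw [Finset.sum_congr rfl fun k _ => h3 k, Finset.sum_comm]
  refine Finset.sum_congr rfl fun a _ => ?_
  rw [Finset.sum_comm]
  refine Finset.sum_congr rfl fun b _ => ?_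
  rw [← Finset.mul_sum, h4]

lemma IsBilin.trace_eventuallyEq {B : ∀ x : M, TangentSpace 𝓘(ℝ, E) x → TangentSpace 𝓘(ℝ, E) x → ℝ}
    (hB : IsBilin B) {x : M} {e : Fin (Module.finrank ℝ E) → VField E M} (he : ∀ a, SmoothVF (e a))
    (hx : ∀ a, e a x = onb g x a) :
    (fun y => ∑ k, B y (onb g y k) (onb g y k)) =ᶠ[𝓝 x]
      fun y => ∑ a, ∑ b, (gram g fun a => e a y)⁻¹ a b * B y (e a y) (e b y) := by
  filter_upwards [eventually_det_gram_ne_zero g he hx] with y hy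
  exact sum_bilin_onb (hB.left y) (hB.right y) hy

lemma IsBilin.smooth_trace {B : ∀ x : M, TangentSpace 𝓘(ℝ, E) x → TangentSpace 𝓘(ℝ, E) x → ℝ}
    (hB : IsBilin B) : SmoothFn E (fun y => ∑ k, B y (onb g y k) (onb g y k)) := by
  intro x
  obtain ⟨e, he, hx⟩ := exists_smooth_frame g x
  refine ContMDiffAt.congr_of_eventuallyEq ?_ (hB.trace_eventuallyEq he hx)
  refine contMDiffAt_finsetSum fun a _ => contMDiffAt_finsetSum fun b _ => ?_
  exact (contMDiffAt_gram_inv g he hx a b).mul (hB.smooth (he a) (he b) x)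

/-- The Gram matrix of a frame that is parallel at `x` is stationary at `x`. -/
lemma dirDeriv_gram_inv {x : M} {A : Fin (Module.finrank ℝ E) → VField E M}
    (hA : IsParallelFrame g x A) (v : TangentSpace 𝓘(ℝ, E) x) (a b : Fin (Module.finrank ℝ E)) :
    dirDeriv (fun y => (gram g fun a => A a y)⁻¹ a b) v = 0 := by
  have hdi : ∀ a b, DiffFnAt E (fun y => (gram g fun a => A a y)⁻¹ a b) x := fun a b =>
    (contMDiffAt_gram_inv g hA.smooth hA.apply a b).mdifferentiableAt (by simp)
  have hdg : ∀ a b, DiffFnAt E (fun y => (gram g fun a => A a y) a b) x := fun a b =>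
    (smooth_inner g (hA.smooth a) (hA.smooth b)).diff x
  have h1 : ∀ a b, dirDeriv (fun y => (gram g fun a => A a y) a b) v = 0 := fun a b => by
    refine (dirDeriv_inner g (hA.smooth a) (hA.smooth b) x v).trans ?_
    rw [hA.parallel, hA.parallel, inner_zero_left, inner_zero_right, add_zero]
  have hx : (gram g fun a => A a x) = 1 := by
    simp only [hA.apply, gram_onb]
  have h2 : (fun y => ∑ c, (gram g fun a => A a y)⁻¹ a c * (gram g fun a => A a y) c b) =ᶠ[𝓝 x]
      fun _ => (1 : Matrix _ _ ℝ) a b := by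
    filter_upwards [eventually_det_gram_ne_zero g hA.smooth hA.apply] with y hy
    rw [← Matrix.mul_apply, Matrix.nonsing_inv_mul _ (isUnit_iff_ne_zero.2 hy)]
  have h3 := dirDeriv_congr h2 v
  rw [dirDeriv_const, dirDeriv_sum fun c _ => (hdi a c).mul' (hdg c b)] at h3
  rw [Finset.sum_congr rfl fun c _ => dirDeriv_mul (hdi a c) (hdg c b) v] at h3
  simpa [h1, hx, Matrix.one_apply] using h3

/-- A trace may be differentiated at `x` in a frame that is orthonormal and parallel at `x`. -/
lemma IsBilin.dirDeriv_trace {B : ∀ x : M, TangentSpace 𝓘(ℝ, E) x → TangentSpace 𝓘(ℝ, E) x → ℝ}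
    (hB : IsBilin B) {x : M} {A : Fin (Module.finrank ℝ E) → VField E M}
    (hA : IsParallelFrame g x A) (v : TangentSpace 𝓘(ℝ, E) x) :
    dirDeriv (fun y => ∑ k, B y (onb g y k) (onb g y k)) v =
      ∑ k, dirDeriv (fun y => B y (A k y) (A k y)) v := by
  rw [dirDeriv_congr (hB.trace_eventuallyEq hA.smooth hA.apply) v]
  have hdi : ∀ a b, DiffFnAt E (fun y => (gram g fun a => A a y)⁻¹ a b) x := fun a b =>
    (contMDiffAt_gram_inv g hA.smooth hA.apply a b).mdifferentiableAt (by simp)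
  have hdB : ∀ a b, DiffFnAt E (fun y => B y (A a y) (A b y)) x := fun a b =>
    (hB.smooth (hA.smooth a) (hA.smooth b)).diff x
  have hx : (gram g fun a => A a x) = 1 := by
    simp only [hA.apply, gram_onb]
  rw [dirDeriv_sum fun a _ => DiffFnAt.sum fun b _ => (hdi a b).mul' (hdB a b)]
  refine Finset.sum_congr rfl fun a _ => ?_
  rw [dirDeriv_sum fun b _ => (hdi a b).mul' (hdB a b),
    Finset.sum_congr rfl fun b _ => dirDeriv_mul (hdi a b) (hdB a b) v]
  simp [dirDeriv_gram_inv hA, hx, Matrix.one_apply]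

end Trace

/-! ### Operations on tensors and the exterior derivative -/

section TensorOperations

variable {E : Type*} [NormedAddCommGroup E] [NormedSpace ℝ E]
  {M : Type*} [TopologicalSpace M] [ChartedSpace E M] [IsManifold 𝓘(ℝ, E) ∞ M] {k : ℕ}

lemma IsTensor.add {S T : TField E M k} (hS : IsTensor S) (hT : IsTensor T) : IsTensor (S + T) :=
  .of_isLinear (fun x w i => ⟨fun u v => by
      simp only [Pi.add_apply, hS.update_add, hT.update_add]; ring,
    fun c u => by simp only [Pi.add_apply, hS.update_smul, hT.update_smul, smul_eq_mul]; ring⟩)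
    fun X hX => (hS.smooth X hX).add (hT.smooth X hX)

lemma IsTensor.neg {T : TField E M k} (hT : IsTensor T) : IsTensor (-T) :=
  .of_isLinear (fun x w i => ⟨fun u v => by
      simp only [Pi.neg_apply, hT.update_add]; ring,
    fun c u => by simp only [Pi.neg_apply, hT.update_smul, smul_eq_mul]; ring⟩)
    fun X hX => (hT.smooth X hX).neg

lemma IsTensor.sub {S T : TField E M k} (hS : IsTensor S) (hT : IsTensor T) : IsTensor (S - T) := by
  rw [sub_eq_add_neg]; exact hS.add hT.neg

lemma IsTensor.comp_perm {T : TField E M k} (hT : IsTensor T) (e : Fin k ≃ Fin k) :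
    IsTensor (fun x w => T x (w ∘ e)) := by
  have h : ∀ (x : M) (w : Fin k → TangentSpace 𝓘(ℝ, E) x) (i : Fin k) u,
      Function.update w i u ∘ e = Function.update (w ∘ e) (e.symm i) u := by
    intro x w i u
    exact Function.update_comp_equiv w e i u
  refine .of_isLinear (fun x w i => ?_) fun X hX => hT.smooth (X ∘ e) fun i => hX _
  simp only [h]
  exact hT.isLinear _ _ _

lemma update_vecCons_zero {x : M} (a u : TangentSpace 𝓘(ℝ, E) x)
    (w : Fin k → TangentSpace 𝓘(ℝ, E) x) :
    Function.update (Matrix.vecCons a w) 0 u = Matrix.vecCons u w :=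
  Fin.update_cons_zero (α := fun _ => TangentSpace 𝓘(ℝ, E) x) a w u

lemma update_vecCons_succ {x : M} (a u : TangentSpace 𝓘(ℝ, E) x)
    (w : Fin k → TangentSpace 𝓘(ℝ, E) x) (i : Fin k) :
    Function.update (Matrix.vecCons a w) i.succ u = Matrix.vecCons a (Function.update w i u) :=
  (Fin.cons_update (α := fun _ => TangentSpace 𝓘(ℝ, E) x) a w i u).symm

lemma IsTensor.isLinear_vecCons {T : TField E M (k + 1)} (hT : IsTensor T) (x : M)
    (w : Fin k → TangentSpace 𝓘(ℝ, E) x) : IsLinearMap ℝ (fun u => T x (Matrix.vecCons u w)) := by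
  have := hT.isLinear x (Matrix.vecCons 0 w) 0
  simpa only [update_vecCons_zero] using this

lemma IsTensor.isLinear_vecCons₂ {T : TField E M (k + 2)} (hT : IsTensor T) (x : M)
    (v : TangentSpace 𝓘(ℝ, E) x) (w : Fin k → TangentSpace 𝓘(ℝ, E) x) :
    IsLinearMap ℝ (fun u => T x (Matrix.vecCons v (Matrix.vecCons u w))) := by
  have := hT.isLinear x (Matrix.vecCons v (Matrix.vecCons 0 w)) (Fin.succ 0)
  simpa only [update_vecCons_succ, update_vecCons_zero] using this

lemma vecCons_apply_point (V : VField E M) (X : Fin k → VField E M) (y : M) :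
    (fun i => (Matrix.vecCons V X : Fin (k + 1) → VField E M) i y) =
      Matrix.vecCons (V y) (fun i => X i y) := by
  funext i
  refine Fin.cases rfl (fun i => rfl) i

lemma smoothVF_vecCons {V : VField E M} {X : Fin k → VField E M} (hV : SmoothVF V)
    (hX : ∀ i, SmoothVF (X i)) (i : Fin (k + 1)) :
    SmoothVF ((Matrix.vecCons V X : Fin (k + 1) → VField E M) i) := by
  refine Fin.cases hV (fun i => hX i) i

lemma IsTensor.interior {T : TField E M (k + 1)} (hT : IsTensor T) {V : VField E M}
    (hV : SmoothVF V) : IsTensor (fun x w => T x (Matrix.vecCons (V x) w)) := by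
  refine .of_isLinear (fun x w i => ?_) fun X hX => ?_
  · simp only [← update_vecCons_succ]
    exact hT.isLinear _ _ _
  · have := hT.smooth _ (smoothVF_vecCons hV hX)
    simpa only [vecCons_apply_point] using this

variable [FiniteDimensional ℝ E] [T2Space M]

lemma IsTensor.isBilin {T : TField E M (k + 2)} (hT : IsTensor T) {X : Fin k → VField E M}
    (hX : ∀ i, SmoothVF (X i)) :
    IsBilin fun y u v => T y (Matrix.vecCons u (Matrix.vecCons v (fun i => X i y))) where
  left := fun x v => hT.isLinear_vecCons x _
  right := fun x u => hT.isLinear_vecCons₂ x u _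
  smooth := fun {U V} hU hV => by
    have := hT.smooth _ (smoothVF_vecCons hU (smoothVF_vecCons hV hX))
    simpa only [vecCons_apply_point] using this

/-- The metric contraction of the first two arguments. -/
lemma IsTensor.contract (g : RMetric E M) {T : TField E M (k + 2)} (hT : IsTensor T) :
    IsTensor (fun x w => ∑ a, T x (Matrix.vecCons (onb g x a) (Matrix.vecCons (onb g x a) w))) := by
  refine .of_isLinear (fun x w i => ?_) fun X hX => (hT.isBilin hX).smooth_trace
  simp only [← update_vecCons_succ]
  constructor
  · intro u v
    rw [← Finset.sum_add_distrib]
    exact Finset.sum_congr rfl fun a _ => hT.update_add _ _ _ _ _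
  · intro c u
    rw [smul_eq_mul, Finset.mul_sum]
    exact Finset.sum_congr rfl fun a _ => hT.update_smul _ _ _ _ _

/-! ### Gradient and twisted codifferential -/

omit [T2Space M] in
lemma inner_grad (g : RMetric E M) (f : M → ℝ) {x : M} (w : TangentSpace 𝓘(ℝ, E) x) :
    g.inner x (grad g f x) w = dirDeriv f w := by
  rw [grad, inner_sum_left]
  conv_rhs => rw [← sum_inner_onb g w]
  rw [dirDeriv_vsum]
  refine Finset.sum_congr rfl fun a _ => ?_
  rw [inner_smul_left, dirDeriv_vsmul, g.symm x w, mul_comm]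

lemma smoothVF_grad (g : RMetric E M) {f : M → ℝ} (hf : SmoothFn E f) : SmoothVF (grad g f) :=
  smoothVF_of_inner g fun Z hZ => by
    simp only [inner_grad]
    exact SmoothVF.dirDeriv hf hZ

omit [T2Space M] [FiniteDimensional ℝ E] in
lemma isTensor_dFun {f : M → ℝ} (hf : SmoothFn E f) : IsTensor (dFun (E := E) f) := by
  refine .of_isLinear (fun x w i => ?_) fun X hX => SmoothVF.dirDeriv hf (hX 0)
  have : i = 0 := Subsingleton.elim _ _
  subst this
  simp only [dFun, Function.update_self]
  exact ⟨fun u v => dirDeriv_vadd _ _ _, fun c u => dirDeriv_vsmul _ _ _⟩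

lemma isTensor_dStar (g : RMetric E M) {f : M → ℝ} (hf : SmoothFn E f) {T : TField E M (k + 1)}
    (hT : IsTensor T) : IsTensor (dStar g f T) :=
  ((isTensor_covD (fun _ => isConnection_leviCivita g) hT).contract g).neg.add
    (hT.interior (smoothVF_grad g hf))

end TensorOperations

section ExteriorDerivative

variable {E : Type*} [NormedAddCommGroup E] [NormedSpace ℝ E] [FiniteDimensional ℝ E]
  {M : Type*} [TopologicalSpace M] [T2Space M] [ChartedSpace E M] [IsManifold 𝓘(ℝ, E) ∞ M]
  (g : RMetric E M)

/-- Constant extensions of tangent vectors commute near `x`, so this is torsion-freeness. -/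
lemma leviCivita_constExt_comm {x : M} (u v : TangentSpace 𝓘(ℝ, E) x) :
    leviCivita g (constExt v) x u = leviCivita g (constExt u) x v := by
  obtain ⟨U, hU, hUx⟩ := exists_smoothVF_constExt u
  obtain ⟨V, hV, hVx⟩ := exists_smoothVF_constExt v
  have hu : u = U x := by rw [hUx.eq_of_nhds, constExt_self]
  have hv : v = V x := by rw [hVx.eq_of_nhds, constExt_self]
  have h := leviCivita_sub_leviCivita g hU hV x
  rw [hUx.mlieBracket_vectorField_eq hVx, mlieBracket_constExt, sub_eq_zero,
    (isConnection_leviCivita g).congr hUx, (isConnection_leviCivita g).congr hVx, ← hu, ← hv] at h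
  exact h

omit [FiniteDimensional ℝ E] [T2Space M] in
lemma extD_two_apply (T : TField E M 2) {x : M} (u v w : TangentSpace 𝓘(ℝ, E) x) :
    extD T x ![u, v, w] = dirDeriv (fun y => T y ![constExt v y, constExt w y]) u
      - dirDeriv (fun y => T y ![constExt u y, constExt w y]) v
      + dirDeriv (fun y => T y ![constExt u y, constExt v y]) w := by
  have h : ∀ (i : Fin 3) (S : M → ℝ), (∀ y, T y (fun j => constExt (![u, v, w] (i.succAbove j)) y) = S y) →
      dirDeriv (fun y => T y fun j => constExt (![u, v, w] (i.succAbove j)) y) (![u, v, w] i) = dirDeriv S (![u, v, w] i) :=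
    fun i S hS => by rw [funext hS]
  rw [extD, Fin.sum_univ_three]
  rw [h 0 _ fun y => congrArg (T y) (show _ = ![constExt v y, constExt w y] from by
      funext i; fin_cases i <;> rfl),
    h 1 _ fun y => congrArg (T y) (show _ = ![constExt u y, constExt w y] from by
      funext i; fin_cases i <;> rfl),
    h 2 _ fun y => congrArg (T y) (show _ = ![constExt u y, constExt v y] from by
      funext i; fin_cases i <;> rfl)]
  simp [pow_succ]
  try ring

omit [FiniteDimensional ℝ E] [T2Space M] in
lemma extD_three_apply (T : TField E M 3) {x : M} (t u v w : TangentSpace 𝓘(ℝ, E) x) :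
    extD T x ![t, u, v, w] = dirDeriv (fun y => T y ![constExt u y, constExt v y, constExt w y]) t
      - dirDeriv (fun y => T y ![constExt t y, constExt v y, constExt w y]) u
      + dirDeriv (fun y => T y ![constExt t y, constExt u y, constExt w y]) v
      - dirDeriv (fun y => T y ![constExt t y, constExt u y, constExt v y]) w := by
  have h : ∀ (i : Fin 4) (S : M → ℝ), (∀ y, T y (fun j => constExt (![t, u, v, w] (i.succAbove j)) y) = S y) →
      dirDeriv (fun y => T y fun j => constExt (![t, u, v, w] (i.succAbove j)) y) (![t, u, v, w] i) = dirDeriv S (![t, u, v, w] i) :=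
    fun i S hS => by rw [funext hS]
  rw [extD, Fin.sum_univ_four]
  rw [h 0 _ fun y => congrArg (T y) (show _ = ![constExt u y, constExt v y, constExt w y] from by
      funext i; fin_cases i <;> rfl),
    h 1 _ fun y => congrArg (T y) (show _ = ![constExt t y, constExt v y, constExt w y] from by
      funext i; fin_cases i <;> rfl),
    h 2 _ fun y => congrArg (T y) (show _ = ![constExt t y, constExt u y, constExt w y] from by
      funext i; fin_cases i <;> rfl),
    h 3 _ fun y => congrArg (T y) (show _ = ![constExt t y, constExt u y, constExt v y] from by
      funext i; fin_cases i <;> rfl)]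
  simp [pow_succ]
  try ring

omit [FiniteDimensional ℝ E] [T2Space M] in
lemma covD_one_apply (D : Conn E M) (T : TField E M 1) {x : M} (t u : TangentSpace 𝓘(ℝ, E) x) :
    covD (fun _ => D) T x ![t, u] = dirDeriv (fun y => T y ![constExt u y]) t
      - T x ![D (constExt u) x t] := by
  rw [covD, Fin.sum_univ_one]
  refine congrArg₂ _ ?_ (congrArg _ ?_)
  · refine congrArg (fun φ => dirDeriv φ t) (funext fun y => congrArg (T y) (funext fun i => ?_))
    fin_cases i; rfl
  · funext i; fin_cases i; rfl

omit [FiniteDimensional ℝ E] [T2Space M] in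
lemma covD_two_apply (D : Conn E M) (T : TField E M 2) {x : M} (t u v : TangentSpace 𝓘(ℝ, E) x) :
    covD (fun _ => D) T x ![t, u, v] = dirDeriv (fun y => T y ![constExt u y, constExt v y]) t
      - T x ![D (constExt u) x t, v] - T x ![u, D (constExt v) x t] := by
  rw [covD, Fin.sum_univ_two, ← sub_sub]
  refine congrArg₂ _ (congrArg₂ _ ?_ (congrArg _ ?_)) (congrArg _ ?_)
  · refine congrArg (fun φ => dirDeriv φ t) (funext fun y => congrArg (T y) (funext fun i => ?_))
    fin_cases i <;> rfl
  · funext i; fin_cases i <;> rfl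
  · funext i; fin_cases i <;> rfl

omit [FiniteDimensional ℝ E] [T2Space M] in
lemma covD_three_apply (D : Conn E M) (T : TField E M 3) {x : M}
    (t u v w : TangentSpace 𝓘(ℝ, E) x) :
    covD (fun _ => D) T x ![t, u, v, w] =
      dirDeriv (fun y => T y ![constExt u y, constExt v y, constExt w y]) t
      - T x ![D (constExt u) x t, v, w] - T x ![u, D (constExt v) x t, w]
      - T x ![u, v, D (constExt w) x t] := by
  rw [covD, Fin.sum_univ_three, ← sub_sub, ← sub_sub]
  refine congrArg₂ _ (congrArg₂ _ (congrArg₂ _ ?_ (congrArg _ ?_)) (congrArg _ ?_)) (congrArg _ ?_)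
  · refine congrArg (fun φ => dirDeriv φ t) (funext fun y => congrArg (T y) (funext fun i => ?_))
    fin_cases i <;> rfl
  · funext i; fin_cases i <;> rfl
  · funext i; fin_cases i <;> rfl
  · funext i; fin_cases i <;> rfl

/-- Skew-symmetric covariant `2`-tensors. -/
def IsSkew₂ (T : TField E M 2) : Prop :=
  ∀ (x : M) (u v : TangentSpace 𝓘(ℝ, E) x), T x ![u, v] = -T x ![v, u]

/-- Totally skew-symmetric covariant `3`-tensors. -/
def IsSkew₃ (T : TField E M 3) : Prop :=
  ∀ (x : M) (u v w : TangentSpace 𝓘(ℝ, E) x),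
    T x ![u, v, w] = -T x ![v, u, w] ∧ T x ![u, v, w] = -T x ![u, w, v]

lemma extD_two {T : TField E M 2} (hT : IsSkew₂ T) {x : M} (u v w : TangentSpace 𝓘(ℝ, E) x) :
    extD T x ![u, v, w] = covD (fun _ => leviCivita g) T x ![u, v, w]
      - covD (fun _ => leviCivita g) T x ![v, u, w]
      + covD (fun _ => leviCivita g) T x ![w, u, v] := by
  simp only [extD_two_apply, covD_two_apply, leviCivita_constExt_comm g u v,
    leviCivita_constExt_comm g u w, leviCivita_constExt_comm g v w]
  linarith [hT x v (leviCivita g (constExt u) x w)]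

lemma extD_three {T : TField E M 3} (hT : IsSkew₃ T) {x : M} (t u v w : TangentSpace 𝓘(ℝ, E) x) :
    extD T x ![t, u, v, w] = covD (fun _ => leviCivita g) T x ![t, u, v, w]
      - covD (fun _ => leviCivita g) T x ![u, t, v, w]
      + covD (fun _ => leviCivita g) T x ![v, t, u, w]
      - covD (fun _ => leviCivita g) T x ![w, t, u, v] := by
  simp only [extD_three_apply, covD_three_apply, leviCivita_constExt_comm g t u,
    leviCivita_constExt_comm g t v, leviCivita_constExt_comm g t w,
    leviCivita_constExt_comm g u v, leviCivita_constExt_comm g u w,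
    leviCivita_constExt_comm g v w]
  have h1 := fun a b c => (hT x a b c).1
  have h2 := fun a b c => (hT x a b c).2
  linarith [h1 u (leviCivita g (constExt t) x v) w, h2 u v (leviCivita g (constExt t) x w),
    h1 u (leviCivita g (constExt t) x w) v, h1 t (leviCivita g (constExt u) x v) w,
    h2 t v (leviCivita g (constExt u) x w), h1 t (leviCivita g (constExt u) x w) v,
    h2 t u (leviCivita g (constExt v) x w), h1 v (leviCivita g (constExt t) x w) u,
    h2 u (leviCivita g (constExt t) x w) v, h2 t (leviCivita g (constExt u) x w) v,
    h1 v (leviCivita g (constExt u) x w) t]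

end ExteriorDerivative

/-! ### Tensoriality of the exterior derivative -/

section Curvature

variable {E : Type*} [NormedAddCommGroup E] [NormedSpace ℝ E] [FiniteDimensional ℝ E]
  {M : Type*} [TopologicalSpace M] [T2Space M] [ChartedSpace E M] [IsManifold 𝓘(ℝ, E) ∞ M]
  (g : RMetric E M)

lemma eq_vec₁ {α : Type*} (w : Fin 1 → α) : w = ![w 0] := by
  funext i; fin_cases i; rfl
lemma eq_vec₂ {α : Type*} (w : Fin 2 → α) : w = ![w 0, w 1] := by
  funext i; fin_cases i <;> rfl
lemma eq_vec₃ {α : Type*} (w : Fin 3 → α) : w = ![w 0, w 1, w 2] := by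
  funext i; fin_cases i <;> rfl

include g in
lemma isTensor_extD_two {T : TField E M 2} (hT : IsTensor T) (hs : IsSkew₂ T) :
    IsTensor (extD T) := by
  have h0 := isTensor_covD (fun _ => isConnection_leviCivita g) hT
  have h1 := (h0.sub (h0.comp_perm (Equiv.swap 0 1))).add (h0.comp_perm (finRotate 3).symm)
  convert h1 using 1
  funext x w
  have e1 : w ∘ (Equiv.swap (0 : Fin 3) 1) = ![w 1, w 0, w 2] := by
    funext i; fin_cases i <;> rfl
  have e2 : w ∘ (finRotate 3).symm = ![w 2, w 0, w 1] := by
    funext i; fin_cases i <;> rfl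
  simp only [Pi.add_apply, Pi.sub_apply, e1, e2]
  conv_lhs => rw [eq_vec₃ w]
  conv_rhs => rw [eq_vec₃ w]
  exact extD_two g hs _ _ _

/-! ### Connections with skew torsion -/

/-- The vector `h(u, v)` with `⟨h(u, v), w⟩ = H(u, v, w)`. -/
def torsionVec (H : TField E M 3) {x : M} (u v : TangentSpace 𝓘(ℝ, E) x) : TangentSpace 𝓘(ℝ, E) x :=
  ∑ a, H x ![u, v, onb g x a] • onb g x a

omit [T2Space M] in
lemma inner_torsionVec {H : TField E M 3} (hH : IsTensor H) {x : M}
    (u v w : TangentSpace 𝓘(ℝ, E) x) : g.inner x (torsionVec g H u v) w = H x ![u, v, w] := by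
  rw [torsionVec, inner_sum_left]
  conv_rhs => rw [← sum_inner_onb g w]
  refine Eq.trans ?_ (linear_apply_sum_smul (hH.linear₃₂ x u v) _ _ _).symm
  refine Finset.sum_congr rfl fun a _ => ?_
  rw [inner_smul_left, g.symm x w, smul_eq_mul, mul_comm]

lemma smoothVF_torsionVec {H : TField E M 3} (hH : IsTensor H) {X Y : VField E M} (hX : SmoothVF X)
    (hY : SmoothVF Y) : SmoothVF (fun y => torsionVec g H (X y) (Y y)) :=
  smoothVF_of_inner g fun Z hZ => by
    simp only [inner_torsionVec g hH]
    exact hH.smooth₃ hX hY hZ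

omit [T2Space M] in
lemma isLinear_torsionVec_left {H : TField E M 3} (hH : IsTensor H) {x : M}
    (v : TangentSpace 𝓘(ℝ, E) x) : IsLinearMap ℝ (fun u => torsionVec g H u v) :=
  ⟨fun a b => eq_of_inner_eq g fun w => by
      rw [inner_add_left]; simp only [inner_torsionVec g hH]
      exact (hH.linear₃₀ x v w).map_add a b,
    fun c a => eq_of_inner_eq g fun w => by
      rw [inner_smul_left]; simp only [inner_torsionVec g hH]
      exact (hH.linear₃₀ x v w).map_smul c a⟩

omit [T2Space M] in
lemma isLinear_torsionVec_right {H : TField E M 3} (hH : IsTensor H) {x : M}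
    (v : TangentSpace 𝓘(ℝ, E) x) : IsLinearMap ℝ (fun u => torsionVec g H v u) :=
  ⟨fun a b => eq_of_inner_eq g fun w => by
      rw [inner_add_left]; simp only [inner_torsionVec g hH]
      exact (hH.linear₃₁ x v w).map_add a b,
    fun c a => eq_of_inner_eq g fun w => by
      rw [inner_smul_left]; simp only [inner_torsionVec g hH]
      exact (hH.linear₃₁ x v w).map_smul c a⟩

omit [T2Space M] in
lemma bismut_eq (H : TField E M 3) (s : ℝ) (Y : VField E M) (x : M) (v : TangentSpace 𝓘(ℝ, E) x) :
    bismut g H s Y x v = leviCivita g Y x v + (s / 2) • torsionVec g H v (Y x) := by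
  rw [bismut, torsionVec, Finset.smul_sum]
  simp only [smul_smul]

lemma isConnection_bismut {H : TField E M 3} (hH : IsTensor H) (s : ℝ) :
    IsConnection (bismut g H s) where
  vadd := fun {Y} hY x u v => by
    simp only [bismut_eq]
    rw [(isConnection_leviCivita g).vadd hY, (isLinear_torsionVec_left g hH (Y x)).map_add]
    module
  vsmul := fun {Y} hY x c u => by
    simp only [bismut_eq]
    rw [(isConnection_leviCivita g).vsmul hY, (isLinear_torsionVec_left g hH (Y x)).map_smul]
    module
  add := fun {Y Z} hY hZ x u => by
    simp only [bismut_eq]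
    rw [(isConnection_leviCivita g).add hY hZ, (isLinear_torsionVec_right g hH u).map_add]
    module
  leibniz := fun {φ Y} hφ hY x u => by
    simp only [bismut_eq]
    rw [(isConnection_leviCivita g).leibniz hφ hY, (isLinear_torsionVec_right g hH u).map_smul]
    module
  congr := fun {Y Z x} h => by
    funext v
    simp only [bismut_eq]
    rw [(isConnection_leviCivita g).congr h, h.eq_of_nhds]
  smooth := fun {X Y} hX hY => by
    simp only [bismut_eq]
    exact ((isConnection_leviCivita g).smooth hX hY).add
      ((smoothVF_torsionVec g hH hX hY).const_smul _)

/-! ### Curvature -/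

/-- The vector `R(X, Y)Z = ∇_X ∇_Y Z - ∇_Y ∇_X Z - ∇_{[X,Y]} Z`. -/
def curvVec (D : Conn E M) (X Y Z : VField E M) (x : M) : TangentSpace 𝓘(ℝ, E) x :=
  D (fun y => D Z y (Y y)) x (X x) - D (fun y => D Z y (X y)) x (Y x)
    - D Z x (mlieBracket 𝓘(ℝ, E) X Y x)

variable {D : Conn E M} (hD : IsConnection D)
include hD

lemma curvVec_swap (X Y Z : VField E M) (hZ : SmoothVF Z) (x : M) :
    curvVec D X Y Z x = -curvVec D Y X Z x := by
  rw [curvVec, curvVec, mlieBracket_swap_apply]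
  have := hD.vsmul hZ x (-1) (mlieBracket 𝓘(ℝ, E) Y X x)
  rw [neg_one_smul, neg_one_smul] at this
  rw [this]
  abel

lemma curvVec_add_left {X X' Y Z : VField E M} (hX : SmoothVF X) (hX' : SmoothVF X')
    (hY : SmoothVF Y) (hZ : SmoothVF Z) (x : M) :
    curvVec D (fun y => X y + X' y) Y Z x = curvVec D X Y Z x + curvVec D X' Y Z x := by
  simp only [curvVec]
  rw [mlieBracket_add_left' hX hX', hD.vadd hZ, hD.vadd (hD.smooth hY hZ)]
  simp only [hD.vadd hZ]
  rw [hD.add (hD.smooth hX hZ) (hD.smooth hX' hZ)]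
  abel

lemma curvVec_smul_left {φ : M → ℝ} {X Y Z : VField E M} (hφ : SmoothFn E φ) (hX : SmoothVF X)
    (hY : SmoothVF Y) (hZ : SmoothVF Z) (x : M) :
    curvVec D (fun y => φ y • X y) Y Z x = φ x • curvVec D X Y Z x := by
  simp only [curvVec]
  rw [mlieBracket_smul_left' hφ hX, hD.vadd hZ, ← neg_smul, hD.vsmul hZ, hD.vsmul hZ,
    hD.vsmul (hD.smooth hY hZ)]
  simp only [hD.vsmul hZ]
  rw [hD.leibniz hφ (hD.smooth hX hZ)]
  module

lemma curvVec_add_right {X Y Z Z' : VField E M} (hX : SmoothVF X)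
    (hY : SmoothVF Y) (hZ : SmoothVF Z) (hZ' : SmoothVF Z') (x : M) :
    curvVec D X Y (fun y => Z y + Z' y) x = curvVec D X Y Z x + curvVec D X Y Z' x := by
  simp only [curvVec, hD.add hZ hZ']
  rw [hD.add (hD.smooth hX hZ) (hD.smooth hX hZ'), hD.add (hD.smooth hY hZ) (hD.smooth hY hZ')]
  abel

lemma curvVec_smul_right {φ : M → ℝ} {X Y Z : VField E M} (hφ : SmoothFn E φ) (hX : SmoothVF X)
    (hY : SmoothVF Y) (hZ : SmoothVF Z) (x : M) :
    curvVec D X Y (fun y => φ y • Z y) x = φ x • curvVec D X Y Z x := by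
  simp only [curvVec, hD.leibniz hφ hZ]
  rw [hD.add ((hD.smooth hX hZ).smul hφ) (hZ.smul (SmoothVF.dirDeriv hφ hX)),
    hD.add ((hD.smooth hY hZ).smul hφ) (hZ.smul (SmoothVF.dirDeriv hφ hY)),
    hD.leibniz hφ (hD.smooth hX hZ), hD.leibniz hφ (hD.smooth hY hZ),
    hD.leibniz (SmoothVF.dirDeriv hφ hX) hZ, hD.leibniz (SmoothVF.dirDeriv hφ hY) hZ,
    mlieBracket_dirDeriv hX hY hφ]
  module

lemma curvVec_eq_of_eq {X X' Y Y' Z Z' : VField E M} (hX : SmoothVF X) (hX' : SmoothVF X')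
    (hY : SmoothVF Y) (hY' : SmoothVF Y') (hZ : SmoothVF Z) (hZ' : SmoothVF Z') {x : M}
    (h1 : X x = X' x) (h2 : Y x = Y' x) (h3 : Z x = Z' x) :
    curvVec D X Y Z x = curvVec D X' Y' Z' x := by
  have key : ∀ {X X' Y Z : VField E M}, SmoothVF X → SmoothVF X' → SmoothVF Y → SmoothVF Z →
      X x = X' x → curvVec D X Y Z x = curvVec D X' Y Z x := fun {_ _ Y Z} hX hX' hY hZ h =>
    eq_of_tensorial (Φ := fun X => curvVec D X Y Z x)
      (fun _ _ a b => curvVec_add_left hD a b hY hZ x)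
      (fun _ _ a b => curvVec_smul_left hD a b hY hZ x) hX hX' h
  rw [key hX hX' hY hZ h1, curvVec_swap hD _ _ _ hZ, key hY hY' hX' hZ h2,
    ← curvVec_swap hD _ _ _ hZ]
  exact eq_of_tensorial (Φ := fun Z => curvVec D X' Y' Z x)
    (fun _ _ a b => curvVec_add_right hD hX' hY' a b x)
    (fun _ _ a b => curvVec_smul_right hD a hX' hY' b x) hZ hZ' h3

/-- The curvature tensor may be computed with arbitrary smooth extensions of the arguments. -/
lemma curv_eq {X Y Z : VField E M} (hX : SmoothVF X) (hY : SmoothVF Y) (hZ : SmoothVF Z) (x : M)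
    (w : TangentSpace 𝓘(ℝ, E) x) :
    curv g D x ![X x, Y x, Z x, w] = g.inner x (curvVec D X Y Z x) w := by
  obtain ⟨X', hX', hXx⟩ := exists_smoothVF_constExt (X x)
  obtain ⟨Y', hY', hYx⟩ := exists_smoothVF_constExt (Y x)
  obtain ⟨Z', hZ', hZx⟩ := exists_smoothVF_constExt (Z x)
  have key : ∀ {V V' : VField E M}, V' =ᶠ[𝓝 x] V →
      (fun y => D (constExt (Z x)) y (V y)) =ᶠ[𝓝 x] fun y => D Z' y (V' y) := fun {V V'} hV => by
    filter_upwards [hZx.eventuallyEq_nhds, hV] with y h1 h2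
    rw [hD.congr h1, h2]
  have h : curvVec D X Y Z x = D (fun y => D (constExt (Z x)) y (constExt (Y x) y)) x (X x)
      - D (fun y => D (constExt (Z x)) y (constExt (X x) y)) x (Y x)
      - D (constExt (Z x)) x (mlieBracket 𝓘(ℝ, E) (constExt (X x)) (constExt (Y x)) x) := by
    rw [curvVec_eq_of_eq hD hX hX' hY hY' hZ hZ' (by rw [hXx.eq_of_nhds, constExt_self])
      (by rw [hYx.eq_of_nhds, constExt_self]) (by rw [hZx.eq_of_nhds, constExt_self]), curvVec,
      hD.congr (key hYx), hD.congr (key hXx), hD.congr hZx.symm, hXx.mlieBracket_vectorField_eq hYx,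
      hXx.eq_of_nhds, hYx.eq_of_nhds, constExt_self, constExt_self]
  rw [h]
  rfl

end Curvature

/-! ### Curvature identities -/

section CurvatureIdentities

variable {E : Type*} [NormedAddCommGroup E] [NormedSpace ℝ E] [FiniteDimensional ℝ E]
  {M : Type*} [TopologicalSpace M] [T2Space M] [ChartedSpace E M] [IsManifold 𝓘(ℝ, E) ∞ M]
  (g : RMetric E M)

lemma curv_swap_left {D : Conn E M} (hD : IsConnection D) {x : M}
    (u v w z : TangentSpace 𝓘(ℝ, E) x) :
    curv g D x ![u, v, w, z] = -curv g D x ![v, u, w, z] := by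
  obtain ⟨U, hU, rfl⟩ := exists_smoothVF u
  obtain ⟨V, hV, rfl⟩ := exists_smoothVF v
  obtain ⟨W, hW, rfl⟩ := exists_smoothVF w
  rw [curv_eq g hD hU hV hW, curv_eq g hD hV hU hW, curvVec_swap hD _ _ _ hW, inner_neg_left]

lemma curv_leviCivita_swap_right {x : M} (u v w z : TangentSpace 𝓘(ℝ, E) x) :
    curv g (leviCivita g) x ![u, v, w, z] = -curv g (leviCivita g) x ![u, v, z, w] := by
  have hD := isConnection_leviCivita g
  obtain ⟨U, hU, rfl⟩ := exists_smoothVF u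
  obtain ⟨V, hV, rfl⟩ := exists_smoothVF v
  obtain ⟨W, hW, rfl⟩ := exists_smoothVF w
  obtain ⟨Z, hZ, rfl⟩ := exists_smoothVF z
  rw [curv_eq g hD hU hV hW, curv_eq g hD hU hV hZ]
  have h := mlieBracket_dirDeriv hU hV (smooth_inner g hW hZ) x
  simp only [dirDeriv_inner g hW hZ] at h
  rw [dirDeriv_add ((smooth_inner g (hD.smooth hV hW) hZ).diff x)
      ((smooth_inner g hW (hD.smooth hV hZ)).diff x),
    dirDeriv_add ((smooth_inner g (hD.smooth hU hW) hZ).diff x)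
      ((smooth_inner g hW (hD.smooth hU hZ)).diff x),
    dirDeriv_inner g (hD.smooth hV hW) hZ, dirDeriv_inner g hW (hD.smooth hV hZ),
    dirDeriv_inner g (hD.smooth hU hW) hZ, dirDeriv_inner g hW (hD.smooth hU hZ)] at h
  simp only [curvVec, inner_sub_left]
  rw [g.symm x _ (W x), g.symm x _ (W x), g.symm x _ (W x)]
  linarith

/-- Tangent vectors extend to fields that commute near `x`: coordinate fields of a chart. -/
lemma exists_commuting {x : M} (u v w : TangentSpace 𝓘(ℝ, E) x) :
    ∃ U V W : VField E M, SmoothVF U ∧ SmoothVF V ∧ SmoothVF W ∧ U x = u ∧ V x = v ∧ W x = w ∧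
      ∀ᶠ y in 𝓝 x, mlieBracket 𝓘(ℝ, E) U V y = 0 ∧ mlieBracket 𝓘(ℝ, E) V W y = 0 ∧
        mlieBracket 𝓘(ℝ, E) W U y = 0 := by
  have ho := (chartAt E x).open_source
  have hx := mem_chart_source E x
  have ex : ∀ v : TangentSpace 𝓘(ℝ, E) x, ∃ Y : VField E M, SmoothVF Y ∧
      Y =ᶠ[𝓝 x] coordVF x (coordL x x v) := fun v =>
    exists_smoothVF_eventuallyEq ho hx fun _ hy => smooth_coordVF hy _
  obtain ⟨U, hU, hUx⟩ := ex u
  obtain ⟨V, hV, hVx⟩ := ex v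
  obtain ⟨W, hW, hWx⟩ := ex w
  refine ⟨U, V, W, hU, hV, hW, ?_, ?_, ?_, ?_⟩
  · rw [hUx.eq_of_nhds, coordVF_coordL hx]
  · rw [hVx.eq_of_nhds, coordVF_coordL hx]
  · rw [hWx.eq_of_nhds, coordVF_coordL hx]
  · filter_upwards [hUx.eventuallyEq_nhds, hVx.eventuallyEq_nhds, hWx.eventuallyEq_nhds,
      ho.mem_nhds hx] with y h1 h2 h3 hy
    rw [h1.mlieBracket_vectorField_eq h2, h2.mlieBracket_vectorField_eq h3,
      h3.mlieBracket_vectorField_eq h1]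
    exact ⟨mlieBracket_coordVF hy _ _, mlieBracket_coordVF hy _ _, mlieBracket_coordVF hy _ _⟩

/-- The first Bianchi identity, computed with commuting fields. -/
lemma curv_bianchi {x : M} (u v w z : TangentSpace 𝓘(ℝ, E) x) :
    curv g (leviCivita g) x ![u, v, w, z] + curv g (leviCivita g) x ![v, w, u, z]
      + curv g (leviCivita g) x ![w, u, v, z] = 0 := by
  have hD := isConnection_leviCivita g
  obtain ⟨U, V, W, hU, hV, hW, rfl, rfl, rfl, h⟩ := exists_commuting u v w
  rw [curv_eq g hD hU hV hW, curv_eq g hD hV hW hU, curv_eq g hD hW hU hV]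
  have h1 : (fun y => leviCivita g V y (U y)) =ᶠ[𝓝 x] fun y => leviCivita g U y (V y) := by
    filter_upwards [h] with y hy
    exact sub_eq_zero.1 ((leviCivita_sub_leviCivita g hU hV y).trans hy.1)
  have h2 : (fun y => leviCivita g W y (V y)) =ᶠ[𝓝 x] fun y => leviCivita g V y (W y) := by
    filter_upwards [h] with y hy
    exact sub_eq_zero.1 ((leviCivita_sub_leviCivita g hV hW y).trans hy.2.1)
  have h3 : (fun y => leviCivita g U y (W y)) =ᶠ[𝓝 x] fun y => leviCivita g W y (U y) := by
    filter_upwards [h] with y hy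
    exact sub_eq_zero.1 ((leviCivita_sub_leviCivita g hW hU y).trans hy.2.2)
  have hx := h.self_of_nhds
  have h0 : ∀ {Y : VField E M}, SmoothVF Y → leviCivita g Y x 0 = 0 := fun hY => by
    simpa using hD.vsmul hY x 0 0
  rw [← inner_add_left, ← inner_add_left]
  simp only [curvVec]
  rw [hx.1, hx.2.1, hx.2.2, h0 hU, h0 hV, h0 hW, hD.congr h1, hD.congr h2, hD.congr h3]
  convert inner_zero_left g z using 2
  abel_nf

end CurvatureIdentities

section ParallelFrames

variable {E : Type*} [NormedAddCommGroup E] [NormedSpace ℝ E] [FiniteDimensional ℝ E]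
  {M : Type*} [TopologicalSpace M] [T2Space M] [ChartedSpace E M] [IsManifold 𝓘(ℝ, E) ∞ M]
  {g : RMetric E M} {x : M}

lemma covD_one_parallel {T : TField E M 1} (hT : IsTensor T) {Y : VField E M} (hY : SmoothVF Y)
    (pY : ∀ u, leviCivita g Y x u = 0) (v : TangentSpace 𝓘(ℝ, E) x) :
    covD (fun _ => leviCivita g) T x ![v, Y x] = dirDeriv (fun y => T y ![Y y]) v := by
  rw [covD_one (fun _ => isConnection_leviCivita g) hT hY, pY, (hT.linear₁ x).map_zero, sub_zero]

lemma covD_two_parallel {T : TField E M 2} (hT : IsTensor T) {Y Z : VField E M} (hY : SmoothVF Y)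
    (hZ : SmoothVF Z) (pY : ∀ u, leviCivita g Y x u = 0) (pZ : ∀ u, leviCivita g Z x u = 0)
    (v : TangentSpace 𝓘(ℝ, E) x) :
    covD (fun _ => leviCivita g) T x ![v, Y x, Z x] = dirDeriv (fun y => T y ![Y y, Z y]) v := by
  rw [covD_two (fun _ => isConnection_leviCivita g) hT hY hZ, pY, pZ, (hT.linear₂₀ x _).map_zero,
    (hT.linear₂₁ x _).map_zero, sub_zero, sub_zero]

lemma covD_three_parallel {T : TField E M 3} (hT : IsTensor T) {X Y Z : VField E M}
    (hX : SmoothVF X) (hY : SmoothVF Y) (hZ : SmoothVF Z) (pX : ∀ u, leviCivita g X x u = 0)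
    (pY : ∀ u, leviCivita g Y x u = 0) (pZ : ∀ u, leviCivita g Z x u = 0)
    (v : TangentSpace 𝓘(ℝ, E) x) :
    covD (fun _ => leviCivita g) T x ![v, X x, Y x, Z x] =
      dirDeriv (fun y => T y ![X y, Y y, Z y]) v := by
  rw [covD_three (fun _ => isConnection_leviCivita g) hT hX hY hZ, pX, pY, pZ,
    (hT.linear₃₀ x _ _).map_zero, (hT.linear₃₁ x _ _).map_zero, (hT.linear₃₂ x _ _).map_zero,
    sub_zero, sub_zero, sub_zero]

lemma mlieBracket_parallel {X Y : VField E M} (hX : SmoothVF X) (hY : SmoothVF Y)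
    (pX : ∀ u, leviCivita g X x u = 0) (pY : ∀ u, leviCivita g Y x u = 0) :
    mlieBracket 𝓘(ℝ, E) X Y x = 0 := by
  rw [← leviCivita_sub_leviCivita g hX hY, pX, pY, sub_zero]

lemma curvVec_parallel {X Y Z : VField E M} (hX : SmoothVF X) (hY : SmoothVF Y) (hZ : SmoothVF Z)
    (pX : ∀ u, leviCivita g X x u = 0) (pY : ∀ u, leviCivita g Y x u = 0) :
    curvVec (leviCivita g) X Y Z x = leviCivita g (fun y => leviCivita g Z y (Y y)) x (X x)
      - leviCivita g (fun y => leviCivita g Z y (X y)) x (Y x) := by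
  have h0 := (isConnection_leviCivita g).vsmul hZ x 0 0
  rw [zero_smul, zero_smul] at h0
  rw [curvVec, mlieBracket_parallel hX hY pX pY, h0, sub_zero]

/-- The second covariant derivative at a point where all fields are parallel. -/
lemma covD_covD_parallel {T : TField E M 2} (hT : IsTensor T) {V X Y Z : VField E M}
    (hX : SmoothVF X) (hY : SmoothVF Y) (hZ : SmoothVF Z)
    (pX : ∀ u, leviCivita g X x u = 0)
    (pY : ∀ u, leviCivita g Y x u = 0) (pZ : ∀ u, leviCivita g Z x u = 0) :
    covD (fun _ => leviCivita g) (covD (fun _ => leviCivita g) T) x ![V x, X x, Y x, Z x] =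
      dirDeriv (fun y => dirDeriv (fun z => T z ![Y z, Z z]) (X y)) (V x)
        - T x ![leviCivita g (fun y => leviCivita g Y y (X y)) x (V x), Z x]
        - T x ![Y x, leviCivita g (fun y => leviCivita g Z y (X y)) x (V x)] := by
  have hD := fun i : Fin 2 => isConnection_leviCivita g
  have hc := isConnection_leviCivita g
  rw [covD_three_parallel (isTensor_covD hD hT) hX hY hZ pX pY pZ]
  simp only [covD_two hD hT hY hZ]
  have s1 := hT.smooth₂ (hc.smooth hX hY) hZ
  have s2 := hT.smooth₂ hY (hc.smooth hX hZ)
  have s0 := SmoothVF.dirDeriv (hT.smooth₂ hY hZ) hX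
  rw [dirDeriv_sub (SmoothFn.diff (s0.sub s1) x) (s2.diff x), dirDeriv_sub (s0.diff x) (s1.diff x)]
  have e1 := covD_two hD hT (hc.smooth hX hY) hZ x (V x)
  have e2 := covD_two hD hT hY (hc.smooth hX hZ) x (V x)
  have l1 := (isTensor_covD hD hT).linear₃₁ x (V x) (Z x)
  have l2 := (isTensor_covD hD hT).linear₃₂ x (V x) (Y x)
  simp only [pY, pZ, l1.map_zero, l2.map_zero, (hT.linear₂₁ x _).map_zero,
    (hT.linear₂₀ x _).map_zero] at e1 e2
  linarith

/-- The Ricci identity for `2`-tensors. -/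
lemma ricci_identity {T : TField E M 2} (hT : IsTensor T) {V X Y Z : VField E M}
    (hV : SmoothVF V) (hX : SmoothVF X) (hY : SmoothVF Y) (hZ : SmoothVF Z)
    (pV : ∀ u, leviCivita g V x u = 0) (pX : ∀ u, leviCivita g X x u = 0)
    (pY : ∀ u, leviCivita g Y x u = 0) (pZ : ∀ u, leviCivita g Z x u = 0) :
    covD (fun _ => leviCivita g) (covD (fun _ => leviCivita g) T) x ![V x, X x, Y x, Z x]
      - covD (fun _ => leviCivita g) (covD (fun _ => leviCivita g) T) x ![X x, V x, Y x, Z x] =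
      - T x ![curvVec (leviCivita g) V X Y x, Z x] - T x ![Y x, curvVec (leviCivita g) V X Z x] := by
  rw [covD_covD_parallel hT hX hY hZ pX pY pZ, covD_covD_parallel hT hV hY hZ pV pY pZ,
    curvVec_parallel hV hX hY pV pX, curvVec_parallel hV hX hZ pV pX,
    (hT.linear₂₀ x _).map_sub, (hT.linear₂₁ x _).map_sub]
  have h := mlieBracket_dirDeriv hV hX (hT.smooth₂ hY hZ) x
  rw [mlieBracket_parallel hV hX pV pX] at h
  have h0 : dirDeriv (fun y => T y ![Y y, Z y]) (0 : TangentSpace 𝓘(ℝ, E) x) = 0 :=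
    map_zero (mvfderiv 𝓘(ℝ, E) (fun y => T y ![Y y, Z y]) x)
  rw [h0] at h
  linarith

/-- The curvature of `∇⁺` in terms of the Riemannian curvature and the torsion. -/
lemma curv_bismutPlus {H : TField E M 3} (hH : IsTensor H) {X Y Z W : VField E M}
    (hX : SmoothVF X) (hY : SmoothVF Y) (hZ : SmoothVF Z) (hW : SmoothVF W)
    (pX : ∀ u, leviCivita g X x u = 0) (pY : ∀ u, leviCivita g Y x u = 0)
    (pZ : ∀ u, leviCivita g Z x u = 0) (pW : ∀ u, leviCivita g W x u = 0) :
    curv g (bismutPlus g H) x ![X x, Y x, Z x, W x] =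
      curv g (leviCivita g) x ![X x, Y x, Z x, W x]
      + 1 / 2 * (covD (fun _ => leviCivita g) H x ![X x, Y x, Z x, W x]
        - covD (fun _ => leviCivita g) H x ![Y x, X x, Z x, W x])
      + 1 / 4 * (H x ![X x, torsionVec g H (Y x) (Z x), W x]
        - H x ![Y x, torsionVec g H (X x) (Z x), W x]) := by
  have hc := isConnection_leviCivita g
  have hB : IsConnection (bismutPlus g H) := isConnection_bismut g hH 1
  have key : ∀ {X Y : VField E M}, SmoothVF X → SmoothVF Y → (∀ u, leviCivita g Y x u = 0) →
      g.inner x (bismutPlus g H (fun y => bismutPlus g H Z y (Y y)) x (X x)) (W x) =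
      g.inner x (leviCivita g (fun y => leviCivita g Z y (Y y)) x (X x)) (W x)
      + 1 / 2 * covD (fun _ => leviCivita g) H x ![X x, Y x, Z x, W x]
      + 1 / 4 * H x ![X x, torsionVec g H (Y x) (Z x), W x] := fun {X Y} hX hY pY => by
    have ht := smoothVF_torsionVec g hH hY hZ
    have e : (fun y => bismutPlus g H Z y (Y y)) =
        fun y => leviCivita g Z y (Y y) + (1 / 2 : ℝ) • torsionVec g H (Y y) (Z y) := by
      funext y; exact bismut_eq g H 1 Z y (Y y)
    rw [e, hB.add (hc.smooth hY hZ) (ht.const_smul _),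
      hB.leibniz (φ := fun _ => (1 / 2 : ℝ)) contMDiff_const ht, dirDeriv_const, zero_smul, add_zero]
    rw [show bismutPlus g H = bismut g H 1 from rfl, bismut_eq, bismut_eq, pZ,
      (isLinear_torsionVec_right g hH (X x)).map_zero, smul_zero, add_zero, inner_add_left,
      inner_smul_left, inner_add_left, inner_smul_left, inner_torsionVec g hH,
      covD_three_parallel hH hY hZ hW pY pZ pW]
    have h1 := dirDeriv_inner g ht hW x (X x)
    rw [pW, inner_zero_right, add_zero] at h1
    rw [← h1]
    simp only [inner_torsionVec g hH]
    ring
  rw [curv_eq g hB hX hY hZ, curv_eq g hc hX hY hZ, curvVec_parallel hX hY hZ pX pY, curvVec,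
    mlieBracket_parallel hX hY pX pY]
  have h0 := hB.vsmul hZ x 0 0
  rw [zero_smul, zero_smul] at h0
  rw [h0, sub_zero, inner_sub_left, inner_sub_left, key hX hY pY, key hY hX pX]
  ring

end ParallelFrames

/-! ### Mixed derivatives and the twisted codifferential in a frame -/

section Components

variable {E : Type*} [NormedAddCommGroup E] [NormedSpace ℝ E] [FiniteDimensional ℝ E]
  {M : Type*} [TopologicalSpace M] [T2Space M] [ChartedSpace E M] [IsManifold 𝓘(ℝ, E) ∞ M]
  {g : RMetric E M}

/-- Smooth fields of linear forms. -/
structure IsCovec (P : ∀ x : M, TangentSpace 𝓘(ℝ, E) x → ℝ) : Prop where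
  linear : ∀ x, IsLinearMap ℝ (P x)
  smooth : ∀ {X}, SmoothVF X → SmoothFn E (fun y => P y (X y))

lemma IsCovec.isBilin_mul {P Q : ∀ x : M, TangentSpace 𝓘(ℝ, E) x → ℝ} (hP : IsCovec P)
    (hQ : IsCovec Q) : IsBilin (fun x u v => P x u * Q x v) where
  left := fun x v => ⟨fun a b => by rw [(hP.linear x).map_add]; ring,
    fun c a => by rw [(hP.linear x).map_smul, smul_eq_mul, smul_eq_mul]; ring⟩
  right := fun x v => ⟨fun a b => by rw [(hQ.linear x).map_add]; ring,
    fun c a => by rw [(hQ.linear x).map_smul, smul_eq_mul, smul_eq_mul]; ring⟩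
  smooth := fun hX hY => (hP.smooth hX).mul (hQ.smooth hY)

lemma IsCovec.smooth_trace_mul {P Q : ∀ x : M, TangentSpace 𝓘(ℝ, E) x → ℝ} (hP : IsCovec P)
    (hQ : IsCovec Q) : SmoothFn E (fun y => ∑ m, P y (onb g y m) * Q y (onb g y m)) :=
  (hP.isBilin_mul hQ).smooth_trace

lemma IsCovec.dirDeriv_trace_mul {P Q : ∀ x : M, TangentSpace 𝓘(ℝ, E) x → ℝ} (hP : IsCovec P)
    (hQ : IsCovec Q) {x : M} {A : Fin (Module.finrank ℝ E) → VField E M}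
    (hA : IsParallelFrame g x A) (v : TangentSpace 𝓘(ℝ, E) x) :
    dirDeriv (fun y => ∑ m, P y (onb g y m) * Q y (onb g y m)) v =
      ∑ m, (dirDeriv (fun y => P y (A m y)) v * Q x (onb g x m)
        + P x (onb g x m) * dirDeriv (fun y => Q y (A m y)) v) := by
  rw [(hP.isBilin_mul hQ).dirDeriv_trace hA]
  refine Finset.sum_congr rfl fun m _ => ?_
  rw [dirDeriv_mul ((hP.smooth (hA.smooth m)).diff x) ((hQ.smooth (hA.smooth m)).diff x), hA.apply]
  ring

/-- Smooth fields of linear forms pair to a smooth field of bilinear forms under a trace over a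
further argument. -/
lemma isBilin_trace_mul {P Q : ∀ x : M, TangentSpace 𝓘(ℝ, E) x → TangentSpace 𝓘(ℝ, E) x → ℝ}
    (hP : IsBilin P) (hQ : IsBilin Q) :
    IsBilin (fun x u v => ∑ m, P x u (onb g x m) * Q x v (onb g x m)) where
  left := fun x v => ⟨fun a b => by
      simp only [(hP.left x _).map_add, add_mul, Finset.sum_add_distrib],
    fun c a => by
      simp only [(hP.left x _).map_smul, smul_eq_mul, Finset.mul_sum, mul_assoc]⟩
  right := fun x v => ⟨fun a b => by
      simp only [(hQ.left x _).map_add, mul_add, Finset.sum_add_distrib],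
    fun c a => by
      simp only [(hQ.left x _).map_smul, smul_eq_mul, Finset.mul_sum, mul_left_comm]⟩
  smooth := fun {X Y} hX hY => by
    have h1 : IsCovec (fun y v => P y (X y) v) := ⟨fun y => hP.right y _, fun hZ => hP.smooth hX hZ⟩
    have h2 : IsCovec (fun y v => Q y (Y y) v) := ⟨fun y => hQ.right y _, fun hZ => hQ.smooth hY hZ⟩
    exact h1.smooth_trace_mul h2

/-- The derivative of a scalar product `⟨P, Q⟩` of `2`-tensors, computed in a parallel frame. -/
lemma dirDeriv_trace_trace_mul
    {P Q : ∀ x : M, TangentSpace 𝓘(ℝ, E) x → TangentSpace 𝓘(ℝ, E) x → ℝ}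
    (hP : IsBilin P) (hQ : IsBilin Q) {x : M} {A : Fin (Module.finrank ℝ E) → VField E M}
    (hA : IsParallelFrame g x A) (v : TangentSpace 𝓘(ℝ, E) x) :
    dirDeriv (fun y => ∑ k, ∑ l, P y (onb g y k) (onb g y l) * Q y (onb g y k) (onb g y l)) v =
      ∑ k, ∑ l, (dirDeriv (fun y => P y (A k y) (A l y)) v * Q x (onb g x k) (onb g x l)
        + P x (onb g x k) (onb g x l) * dirDeriv (fun y => Q y (A k y) (A l y)) v) := by
  rw [(isBilin_trace_mul hP hQ).dirDeriv_trace hA]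
  refine Finset.sum_congr rfl fun k _ => ?_
  have h1 : IsCovec (fun y v => P y (A k y) v) :=
    ⟨fun y => hP.right y _, fun hZ => hP.smooth (hA.smooth k) hZ⟩
  have h2 : IsCovec (fun y v => Q y (A k y) v) :=
    ⟨fun y => hQ.right y _, fun hZ => hQ.smooth (hA.smooth k) hZ⟩
  rw [h1.dirDeriv_trace_mul h2 hA, hA.apply]

lemma IsTensor.covec₁ {T : TField E M 1} (hT : IsTensor T) : IsCovec (fun y u => T y ![u]) :=
  ⟨fun x => hT.linear₁ x, fun hX => hT.smooth₁ hX⟩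

lemma IsTensor.covec₂₀ {T : TField E M 2} (hT : IsTensor T) {Y : VField E M} (hY : SmoothVF Y) :
    IsCovec (fun y u => T y ![u, Y y]) :=
  ⟨fun x => hT.linear₂₀ x _, fun hX => hT.smooth₂ hX hY⟩

lemma IsTensor.covec₂₁ {T : TField E M 2} (hT : IsTensor T) {Y : VField E M} (hY : SmoothVF Y) :
    IsCovec (fun y u => T y ![Y y, u]) :=
  ⟨fun x => hT.linear₂₁ x _, fun hX => hT.smooth₂ hY hX⟩

lemma IsTensor.covec₃₂ {T : TField E M 3} (hT : IsTensor T) {Y Z : VField E M} (hY : SmoothVF Y)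
    (hZ : SmoothVF Z) : IsCovec (fun y u => T y ![Y y, Z y, u]) :=
  ⟨fun x => hT.linear₃₂ x _ _, fun hX => hT.smooth₃ hY hZ hX⟩

lemma IsTensor.isBilin₂ {T : TField E M 2} (hT : IsTensor T) : IsBilin (fun y u v => T y ![u, v]) :=
  ⟨fun x v => hT.linear₂₀ x v, fun x v => hT.linear₂₁ x v, fun hX hY => hT.smooth₂ hX hY⟩

lemma IsTensor.isBilin₃ {T : TField E M 3} (hT : IsTensor T) {Y : VField E M} (hY : SmoothVF Y) :
    IsBilin (fun y u v => T y ![Y y, u, v]) :=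
  ⟨fun x v => hT.linear₃₁ x _ v, fun x v => hT.linear₃₂ x _ v, fun hX hZ => hT.smooth₃ hY hX hZ⟩

/-! ### Codifferentials in a frame -/

lemma covD_one_frame {T : TField E M 1} (hT : IsTensor T) {x : M}
    {A : Fin (Module.finrank ℝ E) → VField E M} (hA : IsParallelFrame g x A)
    (v : TangentSpace 𝓘(ℝ, E) x) (b) :
    covD (fun _ => leviCivita g) T x ![v, onb g x b] = dirDeriv (fun y => T y ![A b y]) v := by
  rw [← covD_one_parallel hT (hA.smooth b) (hA.parallel b), hA.apply]

lemma covD_two_frame {T : TField E M 2} (hT : IsTensor T) {x : M}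
    {A : Fin (Module.finrank ℝ E) → VField E M} (hA : IsParallelFrame g x A)
    (v : TangentSpace 𝓘(ℝ, E) x) (b c) :
    covD (fun _ => leviCivita g) T x ![v, onb g x b, onb g x c] =
      dirDeriv (fun y => T y ![A b y, A c y]) v := by
  rw [← covD_two_parallel hT (hA.smooth b) (hA.smooth c) (hA.parallel b) (hA.parallel c),
    hA.apply, hA.apply]

lemma covD_three_frame {T : TField E M 3} (hT : IsTensor T) {x : M}
    {A : Fin (Module.finrank ℝ E) → VField E M} (hA : IsParallelFrame g x A)
    (v : TangentSpace 𝓘(ℝ, E) x) (b c d) :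
    covD (fun _ => leviCivita g) T x ![v, onb g x b, onb g x c, onb g x d] =
      dirDeriv (fun y => T y ![A b y, A c y, A d y]) v := by
  rw [← covD_three_parallel hT (hA.smooth b) (hA.smooth c) (hA.smooth d) (hA.parallel b)
    (hA.parallel c) (hA.parallel d), hA.apply, hA.apply, hA.apply]

omit [T2Space M] in
lemma apply_vecCons_grad {k : ℕ} {T : TField E M (k + 1)} (hT : IsTensor T) (f : M → ℝ) (x : M)
    (w : Fin k → TangentSpace 𝓘(ℝ, E) x) : T x (Matrix.vecCons (grad g f x) w) =
      ∑ a, dirDeriv f (onb g x a) * T x (Matrix.vecCons (onb g x a) w) :=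
  linear_apply_sum_smul (hT.isLinear_vecCons x w) _ _ _

omit [T2Space M] in
lemma dStar_apply {k : ℕ} {T : TField E M (k + 1)} (hT : IsTensor T) (f : M → ℝ) (x : M)
    (w : Fin k → TangentSpace 𝓘(ℝ, E) x) : dStar g f T x w =
      -∑ a, covD (fun _ => leviCivita g) T x (Matrix.vecCons (onb g x a) (Matrix.vecCons (onb g x a) w))
      + ∑ a, dirDeriv f (onb g x a) * T x (Matrix.vecCons (onb g x a) w) := by
  rw [dStar, adjD, apply_vecCons_grad hT]

/-- The covariant derivative of `d_f^* T` for a `2`-tensor `T`. -/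
lemma covD_dStar_two {f : M → ℝ} (hf : SmoothFn E f) {T : TField E M 2} (hT : IsTensor T) {x : M}
    (v : TangentSpace 𝓘(ℝ, E) x) (c) :
    covD (fun _ => leviCivita g) (dStar g f T) x ![v, onb g x c] =
      -∑ a, covD (fun _ => leviCivita g) (covD (fun _ => leviCivita g) T) x
          ![v, onb g x a, onb g x a, onb g x c]
      + ∑ a, (hessian g f x ![v, onb g x a] * T x ![onb g x a, onb g x c]
        + dirDeriv f (onb g x a) * covD (fun _ => leviCivita g) T x ![v, onb g x a, onb g x c]) := by
  obtain ⟨A, hA⟩ := exists_parallelFrame g x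
  have h1 := isTensor_covD (fun _ => isConnection_leviCivita g) hT
  have hdf := isTensor_dFun (E := E) hf
  rw [covD_one_frame (isTensor_dStar g hf hT) hA]
  simp only [dStar_apply hT]
  have hB : IsBilin (fun y u v => covD (fun _ => leviCivita g) T y ![u, v, A c y]) :=
    ⟨fun y w => h1.linear₃₀ y w _, fun y w => h1.linear₃₁ y w _,
      fun hX hY => h1.smooth₃ hX hY (hA.smooth c)⟩
  have s1 := hB.smooth_trace (g := g)
  have s2 := hdf.covec₁.smooth_trace_mul (g := g) (hT.covec₂₀ (hA.smooth c))
  have e := dirDeriv_add (SmoothFn.diff s1.neg x) (SmoothFn.diff s2 x) v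
  refine e.trans ?_
  rw [hdf.covec₁.dirDeriv_trace_mul (hT.covec₂₀ (hA.smooth c)) hA]
  refine congrArg₂ _ ?_ (Finset.sum_congr rfl fun a _ => ?_)
  · refine (dirDeriv_neg _ v).trans (congrArg _ ?_)
    rw [hB.dirDeriv_trace hA]
    exact Finset.sum_congr rfl fun a _ => (covD_three_frame h1 hA v a a c).symm
  · rw [hessian, covD_one_frame hdf hA, covD_two_frame hT hA, hA.apply]
    rfl

/-! ### The operator `L̄_f` in a frame -/

lemma mixedD_apply {H : TField E M 3} (hH : IsTensor H) {T : TField E M 2} (hT : IsTensor T) (x : M)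
    (u v w : TangentSpace 𝓘(ℝ, E) x) :
    mixedD g H T x ![u, v, w] = covD (fun _ => leviCivita g) T x ![u, v, w]
      + 1 / 2 * ∑ m, H x ![u, v, onb g x m] * T x ![onb g x m, w]
      - 1 / 2 * ∑ m, H x ![u, w, onb g x m] * T x ![v, onb g x m] := by
  obtain ⟨V, hV, rfl⟩ := exists_smoothVF v
  obtain ⟨W, hW, rfl⟩ := exists_smoothVF w
  have hD : ∀ i : Fin 2, IsConnection (![bismutMinus g H, bismutPlus g H] i) := by
    simp [Fin.forall_fin_succ, bismutMinus, bismutPlus, isConnection_bismut g hH]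
  rw [mixedD, covD_two hD hT hV hW, covD_two (fun _ => isConnection_leviCivita g) hT hV hW]
  have e1 : T x ![![bismutMinus g H, bismutPlus g H] 0 V x u, W x] =
      T x ![leviCivita g V x u, W x]
        - 1 / 2 * ∑ m, H x ![u, V x, onb g x m] * T x ![onb g x m, W x] := by
    change T x ![bismut g H (-1) V x u, W x] = _
    rw [bismut_eq, (hT.linear₂₀ x _).map_add, linear_map_smul (hT.linear₂₀ x _), torsionVec,
      linear_apply_sum_smul (hT.linear₂₀ x _)]
    simp only [smul_eq_mul]
    ring
  have e2 : T x ![V x, ![bismutMinus g H, bismutPlus g H] 1 W x u] =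
      T x ![V x, leviCivita g W x u]
        + 1 / 2 * ∑ m, H x ![u, W x, onb g x m] * T x ![V x, onb g x m] := by
    change T x ![V x, bismut g H 1 W x u] = _
    rw [bismut_eq, (hT.linear₂₁ x _).map_add, linear_map_smul (hT.linear₂₁ x _), torsionVec,
      linear_apply_sum_smul (hT.linear₂₁ x _)]
    simp only [smul_eq_mul]
  rw [e1, e2]
  ring

lemma isTensor_mixedD {H : TField E M 3} (hH : IsTensor H) {T : TField E M 2} (hT : IsTensor T) :
    IsTensor (mixedD g H T) :=
  isTensor_covD (by simp [Fin.forall_fin_succ, bismutMinus, bismutPlus, isConnection_bismut g hH]) hT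

/-- The mixed derivative of a tensor with three arguments, with `∇`, `∇⁻` and `∇⁺` acting on the first,
second and third argument, in terms of the Levi-Civita derivative. -/
lemma covD_mixed_three {H : TField E M 3} (hH : IsTensor H) {T : TField E M 3} (hT : IsTensor T)
    (x : M) (v : TangentSpace 𝓘(ℝ, E) x) (a b c) :
    covD ![leviCivita g, bismutMinus g H, bismutPlus g H] T x ![v, onb g x a, onb g x b, onb g x c] =
      covD (fun _ => leviCivita g) T x ![v, onb g x a, onb g x b, onb g x c]
      + 1 / 2 * ∑ m, H x ![v, onb g x b, onb g x m] * T x ![onb g x a, onb g x m, onb g x c]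
      - 1 / 2 * ∑ m, H x ![v, onb g x c, onb g x m] * T x ![onb g x a, onb g x b, onb g x m] := by
  obtain ⟨A, hA⟩ := exists_parallelFrame g x
  have hD : ∀ i : Fin 3, IsConnection (![leviCivita g, bismutMinus g H, bismutPlus g H] i) := by
    simp [Fin.forall_fin_succ, bismutMinus, bismutPlus, isConnection_bismut g hH,
      isConnection_leviCivita g]
  have h := covD_three hD hT (hA.smooth a) (hA.smooth b) (hA.smooth c) x v
  have e0 : T x ![![leviCivita g, bismutMinus g H, bismutPlus g H] 0 (A a) x v, A b x, A c x] = 0 := by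
    change T x ![leviCivita g (A a) x v, A b x, A c x] = 0
    rw [hA.parallel, (hT.linear₃₀ x _ _).map_zero]
  have e1 : T x ![A a x, ![leviCivita g, bismutMinus g H, bismutPlus g H] 1 (A b) x v, A c x] =
      - (1 / 2 * ∑ m, H x ![v, A b x, onb g x m] * T x ![A a x, onb g x m, A c x]) := by
    change T x ![A a x, bismut g H (-1) (A b) x v, A c x] = _
    rw [bismut_eq, hA.parallel, zero_add, linear_map_smul (hT.linear₃₁ x _ _), torsionVec,
      linear_apply_sum_smul (hT.linear₃₁ x _ _)]
    simp only [smul_eq_mul]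
    ring
  have e2 : T x ![A a x, A b x, ![leviCivita g, bismutMinus g H, bismutPlus g H] 2 (A c) x v] =
      1 / 2 * ∑ m, H x ![v, A c x, onb g x m] * T x ![A a x, A b x, onb g x m] := by
    change T x ![A a x, A b x, bismut g H 1 (A c) x v] = _
    rw [bismut_eq, hA.parallel, zero_add, linear_map_smul (hT.linear₃₂ x _ _), torsionVec,
      linear_apply_sum_smul (hT.linear₃₂ x _ _)]
    simp only [smul_eq_mul]
  rw [e0, e1, e2, ← covD_three_parallel hT (hA.smooth a) (hA.smooth b) (hA.smooth c) (hA.parallel a)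
    (hA.parallel b) (hA.parallel c)] at h
  simp only [hA.apply] at h
  rw [h]
  ring

lemma covD_mixedD {H : TField E M 3} (hH : IsTensor H) {T : TField E M 2} (hT : IsTensor T)
    (x : M) (v : TangentSpace 𝓘(ℝ, E) x) (a b c) :
    covD (fun _ => leviCivita g) (mixedD g H T) x ![v, onb g x a, onb g x b, onb g x c] =
      covD (fun _ => leviCivita g) (covD (fun _ => leviCivita g) T) x
        ![v, onb g x a, onb g x b, onb g x c]
      + 1 / 2 * ∑ m, (covD (fun _ => leviCivita g) H x ![v, onb g x a, onb g x b, onb g x m]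
          * T x ![onb g x m, onb g x c]
        + H x ![onb g x a, onb g x b, onb g x m]
          * covD (fun _ => leviCivita g) T x ![v, onb g x m, onb g x c])
      - 1 / 2 * ∑ m, (covD (fun _ => leviCivita g) H x ![v, onb g x a, onb g x c, onb g x m]
          * T x ![onb g x b, onb g x m]
        + H x ![onb g x a, onb g x c, onb g x m]
          * covD (fun _ => leviCivita g) T x ![v, onb g x b, onb g x m]) := by
  obtain ⟨A, hA⟩ := exists_parallelFrame g x
  have h1 := isTensor_covD (fun _ => isConnection_leviCivita g) hT
  rw [covD_three_frame (isTensor_mixedD hH hT) hA]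
  simp only [mixedD_apply hH hT]
  have p1 := hH.covec₃₂ (hA.smooth a) (hA.smooth b)
  have p2 := hH.covec₃₂ (hA.smooth a) (hA.smooth c)
  have q1 := hT.covec₂₀ (hA.smooth c)
  have q2 := hT.covec₂₁ (hA.smooth b)
  have s0 := h1.smooth₃ (hA.smooth a) (hA.smooth b) (hA.smooth c)
  have s1 := p1.smooth_trace_mul (g := g) q1
  have s2 := p2.smooth_trace_mul (g := g) q2
  have c0 : SmoothFn E (fun _ : M => (1 / 2 : ℝ)) := contMDiff_const
  have e := dirDeriv_sub (SmoothFn.diff (s0.add (c0.mul s1)) x) (SmoothFn.diff (c0.mul s2) x) v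
  refine e.trans ?_
  have e' := dirDeriv_add (SmoothFn.diff s0 x) (SmoothFn.diff (c0.mul s1) x) v
  refine (congrArg (· - _) e').trans ?_
  have k1 := dirDeriv_const_mul (1 / 2) (SmoothFn.diff s1 x) v
  have k2 := dirDeriv_const_mul (1 / 2) (SmoothFn.diff s2 x) v
  rw [p1.dirDeriv_trace_mul q1 hA] at k1
  rw [p2.dirDeriv_trace_mul q2 hA] at k2
  refine congrArg₂ _ (congrArg₂ _ (covD_three_frame h1 hA v a b c).symm (k1.trans ?_)) (k2.trans ?_)
  · simp only [covD_three_frame hH hA, covD_two_frame hT hA, hA.apply]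
  · simp only [covD_three_frame hH hA, covD_two_frame hT hA, hA.apply]

end Components

/-! ### The operator `L̄_f` on arrays of components -/

section Algebra

variable {ι : Type*} [Fintype ι]

/-- Components of `∇̄ξ` in terms of those of `ξ`, `∇ξ` and `H`. Here and below `X`, `DX`, `DDX` stand for
the components of `ξ`, `∇ξ`, `∇²ξ` in an orthonormal frame, with the indices of derivatives first;
likewise `H`, `DH` for the torsion and `F`, `FF` for `∇f`, `∇²f`, and `R` is the Riemannian
curvature. -/
def mixedDComp (X : ι → ι → ℝ) (DX H : ι → ι → ι → ℝ) (a b c : ι) : ℝ :=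
  DX a b c + 1 / 2 * ∑ m, H a b m * X m c - 1 / 2 * ∑ m, H a c m * X b m

/-- Components of the second mixed covariant derivative of `ξ`. -/
def mixedDDComp (X : ι → ι → ℝ) (DX H : ι → ι → ι → ℝ) (DDX DH : ι → ι → ι → ι → ℝ)
    (d a b c : ι) : ℝ :=
  DDX d a b c + 1 / 2 * ∑ m, (DH d a b m * X m c + H a b m * DX d m c)
    - 1 / 2 * ∑ m, (DH d a c m * X b m + H a c m * DX d b m)
    + 1 / 2 * ∑ m, H d b m * mixedDComp X DX H a m c
    - 1 / 2 * ∑ m, H d c m * mixedDComp X DX H a b m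

/-- Components of the curvature of `∇⁺`. -/
def curvPlusComp (H : ι → ι → ι → ℝ) (DH R : ι → ι → ι → ι → ℝ) (a b c d : ι) : ℝ :=
  R a b c d + 1 / 2 * (DH a b c d - DH b a c d)
    + 1 / 4 * (∑ m, H b c m * H a m d - ∑ m, H a c m * H b m d)

/-- Components of `2 L̄_f ξ`. -/
def twoLbarComp (X : ι → ι → ℝ) (DX H : ι → ι → ι → ℝ) (DDX DH R : ι → ι → ι → ι → ℝ)
    (F : ι → ℝ) (b c : ι) : ℝ :=
  ∑ a, mixedDDComp X DX H DDX DH a a b c - ∑ a, F a * mixedDComp X DX H a b c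
    + 2 * ∑ k, ∑ l, curvPlusComp H DH R b k l c * X k l

/-- The contraction `H_{bkl} H_{ckl}`. -/
def sqComp (H : ι → ι → ι → ℝ) (b c : ι) : ℝ := ∑ k, ∑ l, H b k l * H c k l

variable {X : ι → ι → ℝ} {DX H : ι → ι → ι → ℝ} {DDX DH R : ι → ι → ι → ι → ℝ} {F : ι → ℝ}

/-- The contraction of two copies of `H` against a vector is `-H²`. -/
lemma sum_H_H_X (hH1 : ∀ a b c, H a b c = -H b a c) (hH2 : ∀ a b c, H a b c = -H a c b)
    (b : ι) (Y : ι → ℝ) :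
    ∑ a, ∑ m, H a b m * ∑ p, H a m p * Y p = -∑ p, sqComp H b p * Y p := by
  have h : ∀ a m p, H a b m * (H a m p * Y p) = -(H b m a * H p m a * Y p) := fun a m p => by
    have e1 : H a b m = H b m a := by rw [hH1 a b m, hH2 b a m]; ring
    have e2 : H a m p = -H p m a := by linarith [hH1 a m p, hH2 m a p, hH1 m p a]
    rw [e1, e2]; ring
  simp only [Finset.mul_sum, sqComp, Finset.sum_mul, h, Finset.sum_neg_distrib, neg_inj]
  rw [Finset.sum_comm]
  rw [Finset.sum_congr rfl fun m _ => Finset.sum_comm]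
  rw [Finset.sum_comm]

/-- The normal form of `2 L̄_f ξ`: the terms quadratic in `H` and linear in `ξ` cancel up to `H²` and
`η`, and `d_f^* H = 0` removes the divergence of `H`. -/
lemma twoLbarComp_eq (hX : ∀ a b, X a b = -X b a) (hDX : ∀ a b c, DX a b c = -DX a c b)
    (hH1 : ∀ a b c, H a b c = -H b a c) (hH2 : ∀ a b c, H a b c = -H a c b)
    (hdiv : ∀ b c, ∑ a, DH a a b c = ∑ a, F a * H a b c) (b c : ι) :
    twoLbarComp X DX H DDX DH R F b c =
      ∑ a, DDX a a b c - ∑ a, F a * DX a b c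
      + ∑ a, ∑ m, H a b m * DX a m c + ∑ a, ∑ m, H a c m * DX a m b
      - 1 / 4 * (∑ p, sqComp H b p * X p c + ∑ p, sqComp H c p * X b p)
      - 1 / 2 * ∑ m, H b c m * ∑ k, ∑ l, H m k l * X k l
      + 2 * ∑ k, ∑ l, R b k l c * X k l
      + ∑ k, ∑ l, (DH b k l c - DH k b l c) * X k l := by
  have q1 : ∑ a, mixedDDComp X DX H DDX DH a a b c = ∑ a, DDX a a b c
      + 1 / 2 * ∑ a, ∑ m, DH a a b m * X m c + 1 / 2 * ∑ a, ∑ m, H a b m * DX a m c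
      - 1 / 2 * ∑ a, ∑ m, DH a a c m * X b m - 1 / 2 * ∑ a, ∑ m, H a c m * DX a b m
      + 1 / 2 * ∑ a, ∑ m, H a b m * mixedDComp X DX H a m c
      - 1 / 2 * ∑ a, ∑ m, H a c m * mixedDComp X DX H a b m := by
    simp only [mixedDDComp, Finset.sum_add_distrib, Finset.sum_sub_distrib, ← Finset.mul_sum,
      mul_add]
    ring
  have q2 : ∑ a, ∑ m, H a b m * mixedDComp X DX H a m c = ∑ a, ∑ m, H a b m * DX a m c
      - 1 / 2 * ∑ p, sqComp H b p * X p c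
      - 1 / 2 * ∑ a, ∑ m, ∑ p, H a b m * H a c p * X m p := by
    have := sum_H_H_X hH1 hH2 b (fun p => X p c)
    have e : ∀ a m, H a b m * mixedDComp X DX H a m c = H a b m * DX a m c
      + 1 / 2 * (H a b m * ∑ p, H a m p * X p c) - 1 / 2 * ∑ p, H a b m * H a c p * X m p := by
      intro a m
      simp only [mixedDComp, mul_assoc, ← Finset.mul_sum]
      ring
    simp only [e, Finset.sum_add_distrib, Finset.sum_sub_distrib, ← Finset.mul_sum]
    rw [this]
    ring
  have q3 : ∑ a, ∑ m, H a c m * mixedDComp X DX H a b m = -∑ a, ∑ m, H a c m * DX a m b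
      + 1 / 2 * ∑ a, ∑ m, ∑ p, H a b m * H a c p * X m p
      + 1 / 2 * ∑ p, sqComp H c p * X b p := by
    have := sum_H_H_X hH1 hH2 c (fun p => X b p)
    have e : ∀ a m, H a c m * mixedDComp X DX H a b m = -(H a c m * DX a m b)
      + 1 / 2 * (∑ p, H a b p * H a c m * X p m) - 1 / 2 * (H a c m * ∑ p, H a m p * X b p) := by
      intro a m
      have : ∑ p, H a b p * H a c m * X p m = H a c m * ∑ p, H a b p * X p m := by
        rw [Finset.mul_sum]; exact Finset.sum_congr rfl fun p _ => by ring
      rw [this, mixedDComp, hDX a b m]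
      ring
    simp only [e, Finset.sum_add_distrib, Finset.sum_sub_distrib, ← Finset.mul_sum,
      Finset.sum_neg_distrib]
    rw [this, Finset.sum_congr rfl fun a _ => Finset.sum_comm]
    ring
  have q4 : ∑ a, F a * mixedDComp X DX H a b c = ∑ a, F a * DX a b c
      + 1 / 2 * ∑ a, ∑ m, DH a a b m * X m c - 1 / 2 * ∑ a, ∑ m, DH a a c m * X b m := by
    have e1 : ∑ a, ∑ m, DH a a b m * X m c = ∑ a, F a * ∑ m, H a b m * X m c := by
      simp only [Finset.mul_sum, ← mul_assoc]
      rw [Finset.sum_comm]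
      conv_rhs => rw [Finset.sum_comm]
      simp only [← Finset.sum_mul, hdiv]
    have e2 : ∑ a, ∑ m, DH a a c m * X b m = ∑ a, F a * ∑ m, H a c m * X b m := by
      simp only [Finset.mul_sum, ← mul_assoc]
      rw [Finset.sum_comm]
      conv_rhs => rw [Finset.sum_comm]
      simp only [← Finset.sum_mul, hdiv]
    rw [e1, e2, Finset.mul_sum, Finset.mul_sum, ← Finset.sum_add_distrib, ← Finset.sum_sub_distrib]
    exact Finset.sum_congr rfl fun a _ => by rw [mixedDComp]; ring
  have q5 : ∑ k, ∑ l, curvPlusComp H DH R b k l c * X k l = ∑ k, ∑ l, R b k l c * X k l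
      + 1 / 2 * ∑ k, ∑ l, (DH b k l c - DH k b l c) * X k l
      + 1 / 4 * (∑ k, ∑ l, (∑ m, H k l m * H b m c) * X k l
        - ∑ k, ∑ l, (∑ m, H b l m * H k m c) * X k l) := by
    simp only [Finset.mul_sum, ← Finset.sum_add_distrib, ← Finset.sum_sub_distrib]
    exact Finset.sum_congr rfl fun k _ => Finset.sum_congr rfl fun l _ => by
      rw [curvPlusComp]; ring
  have q6 : ∑ k, ∑ l, (∑ m, H k l m * H b m c) * X k l
      = -∑ m, H b c m * ∑ k, ∑ l, H m k l * X k l := by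
    simp only [Finset.sum_mul, Finset.mul_sum]
    rw [Finset.sum_congr rfl fun k _ => Finset.sum_comm, Finset.sum_comm, ← Finset.sum_neg_distrib]
    refine Finset.sum_congr rfl fun m _ => ?_
    rw [← Finset.sum_neg_distrib]
    refine Finset.sum_congr rfl fun k _ => ?_
    rw [← Finset.sum_neg_distrib]
    refine Finset.sum_congr rfl fun l _ => ?_
    rw [hH2 b m c, hH2 k l m, hH1 k m l]
    ring
  have q7 : ∑ k, ∑ l, (∑ m, H b l m * H k m c) * X k l
      = -∑ a, ∑ m, ∑ p, H a b m * H a c p * X m p := by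
    simp only [Finset.sum_mul]
    rw [Finset.sum_comm, Finset.sum_congr rfl fun l _ => Finset.sum_comm, Finset.sum_comm,
      ← Finset.sum_neg_distrib]
    refine Finset.sum_congr rfl fun m _ => ?_
    rw [← Finset.sum_neg_distrib]
    refine Finset.sum_congr rfl fun k _ => ?_
    rw [← Finset.sum_neg_distrib]
    refine Finset.sum_congr rfl fun l _ => ?_
    have e1 : H b k m = H m b k := by rw [hH2 b k m, hH1 b m k]; ring
    have e2 : H l m c = H m c l := by rw [hH1 l m c, hH2 m l c]; ring
    rw [hX l k, e1, e2]
    ring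
  rw [twoLbarComp, q1, q2, q3, q4, q5, q6, q7]
  have q8 : ∑ a, ∑ m, H a c m * DX a b m = -∑ a, ∑ m, H a c m * DX a m b := by
    rw [← Finset.sum_neg_distrib]
    refine Finset.sum_congr rfl fun a _ => ?_
    rw [← Finset.sum_neg_distrib]
    exact Finset.sum_congr rfl fun m _ => by rw [hDX a b m]; ring
  rw [q8]
  ring

/-- The terms of `L̄_f ξ` that contain the derivative of `H` are symmetric if `dH = 0`. -/
lemma sum_DH_eq (hX : ∀ a b, X a b = -X b a)
    (hDH1 : ∀ d a b c, DH d a b c = -DH d b a c) (hDH2 : ∀ d a b c, DH d a b c = -DH d a c b)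
    (hcl : ∀ a b c d, DH a b c d - DH b a c d + DH c a b d - DH d a b c = 0) (b c : ι) :
    ∑ k, ∑ l, (DH b k l c - DH k b l c) * X k l =
      1 / 2 * (∑ k, ∑ l, DH b c k l * X k l + ∑ k, ∑ l, DH c b k l * X k l) := by
  have h1 : ∑ k, ∑ l, DH b k l c * X k l = ∑ k, ∑ l, DH b c k l * X k l :=
    Finset.sum_congr rfl fun k _ => Finset.sum_congr rfl fun l _ => by
      rw [hDH2 b k l c, hDH1 b k c l]; ring
  have h2 : ∑ k, ∑ l, DH l b c k * X k l = ∑ k, ∑ l, DH k b l c * X k l := by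
    rw [Finset.sum_comm]
    exact Finset.sum_congr rfl fun k _ => Finset.sum_congr rfl fun l _ => by
      rw [hDH2 k b c l, hX l k]; ring
  have h3 : ∑ k, ∑ l, DH k b c l * X k l = -∑ k, ∑ l, DH k b l c * X k l := by
    rw [← Finset.sum_neg_distrib]
    refine Finset.sum_congr rfl fun k _ => ?_
    rw [← Finset.sum_neg_distrib]
    exact Finset.sum_congr rfl fun l _ => by rw [hDH2 k b c l]; ring
  have h4 : ∑ k, ∑ l, (DH b c k l - DH c b k l + DH k b c l - DH l b c k) * X k l = 0 := by
    simp only [hcl, zero_mul, Finset.sum_const_zero]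
  simp only [sub_mul, add_mul, Finset.sum_sub_distrib, Finset.sum_add_distrib] at h4 ⊢
  rw [h2, h3] at h4
  rw [h1]
  linarith

/-- The skew part of `2 L̄_f ξ` is `2 Δ_{d,f} ξ - i_η H`. -/
lemma twoLbarComp_sub {FF : ι → ι → ℝ} (hX : ∀ a b, X a b = -X b a)
    (hDX : ∀ a b c, DX a b c = -DX a c b)
    (hH1 : ∀ a b c, H a b c = -H b a c) (hH2 : ∀ a b c, H a b c = -H a c b)
    (hdiv : ∀ b c, ∑ a, DH a a b c = ∑ a, F a * H a b c)
    (hDH1 : ∀ d a b c, DH d a b c = -DH d b a c) (hDH2 : ∀ d a b c, DH d a b c = -DH d a c b)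
    (hcl : ∀ a b c d, DH a b c d - DH b a c d + DH c a b d - DH d a b c = 0)
    (hDDX : ∀ d a b c, DDX d a b c = -DDX d a c b)
    (hR1 : ∀ a b c d, R a b c d = -R b a c d) (hR2 : ∀ a b c d, R a b c d = -R a b d c)
    (hric : ∀ d a b c, DDX d a b c - DDX a d b c =
      -(∑ m, R d a b m * X m c) - ∑ m, R d a c m * X b m)
    (hsol : ∀ b c, ∑ a, R a b c a - 1 / 4 * sqComp H b c + FF b c = 0) (b c : ι) :
    twoLbarComp X DX H DDX DH R F b c - twoLbarComp X DX H DDX DH R F c b =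
      -2 * (((-(∑ a, DDX b a a c) + ∑ a, (FF b a * X a c + F a * DX b a c))
          - (-(∑ a, DDX c a a b) + ∑ a, (FF c a * X a b + F a * DX c a b)))
        + (-(∑ a, (DDX a a b c - DDX a b a c + DDX a c a b))
          + ∑ a, F a * (DX a b c - DX b a c + DX c a b)))
      - ∑ m, H b c m * ∑ k, ∑ l, H m k l * X k l := by
  rw [twoLbarComp_eq hX hDX hH1 hH2 hdiv b c, twoLbarComp_eq hX hDX hH1 hH2 hdiv c b,
    sum_DH_eq hX hDH1 hDH2 hcl b c, sum_DH_eq hX hDH1 hDH2 hcl c b]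
  have k1 : ∑ a, DDX a a c b = -∑ a, DDX a a b c := by
    rw [← Finset.sum_neg_distrib]
    exact Finset.sum_congr rfl fun a _ => hDDX a a c b
  have k2 : ∑ a, F a * DX a c b = -∑ a, F a * DX a b c := by
    rw [← Finset.sum_neg_distrib]
    exact Finset.sum_congr rfl fun a _ => by rw [hDX a c b]; ring
  have k3 : ∀ b c, ∑ p, sqComp H c p * X p b = -∑ p, sqComp H c p * X b p := fun b c => by
    rw [← Finset.sum_neg_distrib]
    exact Finset.sum_congr rfl fun a _ => by rw [hX a b]; ring
  have k4 : ∑ m, H c b m * ∑ k, ∑ l, H m k l * X k l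
      = -∑ m, H b c m * ∑ k, ∑ l, H m k l * X k l := by
    rw [← Finset.sum_neg_distrib]
    exact Finset.sum_congr rfl fun a _ => by rw [hH1 c b a]; ring
  -- commuting the two derivatives in the terms of `dδξ` and `δdξ` produces the Ricci tensor
  have k5 : ∀ b c, ∑ a, DDX b a a c - ∑ a, DDX a b a c =
      -(∑ m, (∑ a, R a b m a) * X m c) + ∑ k, ∑ l, R b k l c * X k l := fun b c => by
    rw [← Finset.sum_sub_distrib]
    simp only [hric, Finset.sum_sub_distrib, Finset.sum_neg_distrib]
    have e1 : ∑ a, ∑ m, R b a a m * X m c = ∑ m, (∑ a, R a b m a) * X m c := by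
      rw [Finset.sum_comm]
      simp only [Finset.sum_mul]
      exact Finset.sum_congr rfl fun m _ => Finset.sum_congr rfl fun a _ => by
        rw [hR1 b a a m, hR2 a b a m]; ring
    have e2 : ∑ k, ∑ l, R b k l c * X k l = -∑ a, ∑ m, R b a c m * X a m := by
      rw [← Finset.sum_neg_distrib]
      refine Finset.sum_congr rfl fun a _ => ?_
      rw [← Finset.sum_neg_distrib]
      exact Finset.sum_congr rfl fun m _ => by rw [hR2 b a m c]; ring
    rw [e1, e2]
    ring
  have k6 : ∀ b c, ∑ m, (∑ a, R a b m a) * X m c =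
      1 / 4 * ∑ p, sqComp H b p * X p c - ∑ a, FF b a * X a c := fun b c => by
    rw [Finset.mul_sum, ← Finset.sum_sub_distrib]
    exact Finset.sum_congr rfl fun m _ => by linear_combination X m c * hsol b m
  have k7 := k5 b c
  have k8 := k5 c b
  rw [k6] at k7 k8
  have k9 := k3 b c
  have k10 := k3 c b
  simp only [mul_add, mul_sub, Finset.sum_add_distrib, Finset.sum_sub_distrib]
  rw [k1, k2, k4]
  linarith

/-- Pair symmetry of algebraic curvature tensors. -/
lemma curv_pair_symm (hR1 : ∀ a b c d, R a b c d = -R b a c d)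
    (hR2 : ∀ a b c d, R a b c d = -R a b d c)
    (hR3 : ∀ a b c d, R a b c d + R b c a d + R c a b d = 0) (a b c d : ι) :
    R a b c d = R c d a b := by
  linarith [hR3 a b c d, hR3 b c d a, hR3 c d a b, hR3 d a b c, hR1 a b c d, hR2 a b c d,
    hR1 b c a d, hR2 b c a d, hR1 c a b d, hR2 c a b d, hR1 b c d a, hR2 c d b a, hR1 c d b a,
    hR2 d b c a, hR1 d b c a, hR2 c d a b, hR1 c d a b, hR2 d a c b, hR1 d a c b, hR2 a c d b,
    hR1 a c d b, hR2 d a b c, hR1 d a b c, hR2 a b d c, hR1 a b d c, hR2 b d a c, hR1 b d a c]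

/-- For closed `ξ`, the symmetric part of `2 L̄_f ξ` is the symmetrized derivative of `η`. -/
lemma twoLbarComp_add (hX : ∀ a b, X a b = -X b a)
    (hDX : ∀ a b c, DX a b c = -DX a c b)
    (hH1 : ∀ a b c, H a b c = -H b a c) (hH2 : ∀ a b c, H a b c = -H a c b)
    (hdiv : ∀ b c, ∑ a, DH a a b c = ∑ a, F a * H a b c)
    (hDH1 : ∀ d a b c, DH d a b c = -DH d b a c) (hDH2 : ∀ d a b c, DH d a b c = -DH d a c b)
    (hcl : ∀ a b c d, DH a b c d - DH b a c d + DH c a b d - DH d a b c = 0)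
    (hDDX : ∀ d a b c, DDX d a b c = -DDX d a c b)
    (hR1 : ∀ a b c d, R a b c d = -R b a c d) (hR2 : ∀ a b c d, R a b c d = -R a b d c)
    (hR3 : ∀ a b c d, R a b c d + R b c a d + R c a b d = 0)
    (hclX : ∀ a b c, DX a b c - DX b a c + DX c a b = 0) (b c : ι) :
    twoLbarComp X DX H DDX DH R F b c + twoLbarComp X DX H DDX DH R F c b =
      ∑ k, ∑ l, (DH b c k l * X k l + H c k l * DX b k l)
      + ∑ k, ∑ l, (DH c b k l * X k l + H b k l * DX c k l) := by
  rw [twoLbarComp_eq hX hDX hH1 hH2 hdiv b c, twoLbarComp_eq hX hDX hH1 hH2 hdiv c b,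
    sum_DH_eq hX hDH1 hDH2 hcl b c, sum_DH_eq hX hDH1 hDH2 hcl c b]
  have k1 : ∑ a, DDX a a c b = -∑ a, DDX a a b c := by
    rw [← Finset.sum_neg_distrib]
    exact Finset.sum_congr rfl fun a _ => hDDX a a c b
  have k2 : ∑ a, F a * DX a c b = -∑ a, F a * DX a b c := by
    rw [← Finset.sum_neg_distrib]
    exact Finset.sum_congr rfl fun a _ => by rw [hDX a c b]; ring
  have k3 : ∀ b c, ∑ p, sqComp H c p * X p b = -∑ p, sqComp H c p * X b p := fun b c => by
    rw [← Finset.sum_neg_distrib]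
    exact Finset.sum_congr rfl fun a _ => by rw [hX a b]; ring
  have k4 : ∑ m, H c b m * ∑ k, ∑ l, H m k l * X k l
      = -∑ m, H b c m * ∑ k, ∑ l, H m k l * X k l := by
    rw [← Finset.sum_neg_distrib]
    exact Finset.sum_congr rfl fun a _ => by rw [hH1 c b a]; ring
  have k5 : ∑ k, ∑ l, R c k l b * X k l = -∑ k, ∑ l, R b k l c * X k l := by
    rw [Finset.sum_comm, ← Finset.sum_neg_distrib]
    refine Finset.sum_congr rfl fun k _ => ?_
    rw [← Finset.sum_neg_distrib]
    refine Finset.sum_congr rfl fun l _ => ?_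
    rw [curv_pair_symm hR1 hR2 hR3 c l k b, hR1 k b c l, hR2 b k c l, hX l k]
    ring
  have k6 : ∀ b c, ∑ k, ∑ l, H c k l * DX b k l = 2 * ∑ a, ∑ m, H a c m * DX a m b := fun b c => by
    have e1 : ∑ k, ∑ l, H c k l * DX l b k = -∑ a, ∑ m, H a c m * DX a m b := by
      rw [Finset.sum_comm, ← Finset.sum_neg_distrib]
      refine Finset.sum_congr rfl fun k _ => ?_
      rw [← Finset.sum_neg_distrib]
      refine Finset.sum_congr rfl fun l _ => ?_
      rw [hDX k b l, hH2 c l k, hH1 c k l]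
      ring
    have e2 : ∑ k, ∑ l, H c k l * DX k b l = ∑ a, ∑ m, H a c m * DX a m b := by
      refine Finset.sum_congr rfl fun k _ => Finset.sum_congr rfl fun l _ => ?_
      rw [hDX k b l, hH1 c k l]
      ring
    have e3 : ∀ k l, H c k l * DX b k l = H c k l * DX k b l - H c k l * DX l b k := fun k l => by
      linear_combination H c k l * hclX b k l
    simp only [e3, Finset.sum_sub_distrib, e1, e2]
    ring
  have k9 := k3 b c
  have k10 := k3 c b
  simp only [Finset.sum_add_distrib, k6]
  rw [k1, k2, k4, k5]
  linarith

/-- The terms of the integrand: contracting the skew part of `L̄_f ξ = 0` with `ξ` exhibits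
`|η|² + 4 |d_f^* ξ|² + ⅔ |dξ|²` as a divergence. -/
lemma energy_comp {β : ι → ℝ} {Dβ : ι → ι → ℝ} {σ : ι → ι → ι → ℝ} {Dσ : ι → ι → ι → ι → ℝ}
    (hX : ∀ a b, X a b = -X b a) (hDX : ∀ a b c, DX a b c = -DX a c b)
    (hH1 : ∀ a b c, H a b c = -H b a c) (hH2 : ∀ a b c, H a b c = -H a c b)
    (hβ : ∀ c, β c = -(∑ a, DX a a c) + ∑ a, F a * X a c)
    (hσ : ∀ a b c, σ a b c = DX a b c - DX b a c + DX c a b)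
    (hskew : ∀ b c, -2 * ((Dβ b c - Dβ c b) + (-(∑ a, Dσ a a b c) + ∑ a, F a * σ a b c))
      - ∑ m, H b c m * ∑ k, ∑ l, H m k l * X k l = 0) :
    ∑ m, (∑ k, ∑ l, H m k l * X k l) ^ 2 + 4 * ∑ c, β c ^ 2
      + 2 / 3 * ∑ a, ∑ b, ∑ c, σ a b c ^ 2 =
    4 * (-(∑ a, ∑ c, (Dβ a c * X a c + β c * DX a a c)) + ∑ a, F a * ∑ c, β c * X a c)
      - 2 * (-(∑ a, ∑ b, ∑ c, (Dσ a a b c * X b c + σ a b c * DX a b c))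
        + ∑ a, F a * ∑ b, ∑ c, σ a b c * X b c) := by
  have k1 : ∑ b, ∑ c, (∑ m, H b c m * ∑ k, ∑ l, H m k l * X k l) * X b c =
      ∑ m, (∑ k, ∑ l, H m k l * X k l) ^ 2 := by
    simp only [Finset.sum_mul]
    rw [Finset.sum_congr rfl fun b _ => Finset.sum_comm, Finset.sum_comm]
    refine Finset.sum_congr rfl fun m _ => ?_
    rw [sq, Finset.sum_mul]
    refine Finset.sum_congr rfl fun b _ => ?_
    rw [Finset.sum_mul]
    exact Finset.sum_congr rfl fun c _ => by rw [hH2 b c m, hH1 b m c]; ring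
  have k2 : ∑ b, ∑ c, Dβ c b * X b c = -∑ b, ∑ c, Dβ b c * X b c := by
    rw [Finset.sum_comm, ← Finset.sum_neg_distrib]
    refine Finset.sum_congr rfl fun b _ => ?_
    rw [← Finset.sum_neg_distrib]
    exact Finset.sum_congr rfl fun c _ => by rw [hX c b]; ring
  have k3 : ∑ b, ∑ c, (-2 * ((Dβ b c - Dβ c b) + (-(∑ a, Dσ a a b c) + ∑ a, F a * σ a b c))
      - ∑ m, H b c m * ∑ k, ∑ l, H m k l * X k l) * X b c = 0 := by
    simp only [hskew, zero_mul, Finset.sum_const_zero]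
  have k4 : ∑ b, ∑ c, (-2 * ((Dβ b c - Dβ c b) + (-(∑ a, Dσ a a b c) + ∑ a, F a * σ a b c))
      - ∑ m, H b c m * ∑ k, ∑ l, H m k l * X k l) * X b c =
      -2 * (∑ b, ∑ c, Dβ b c * X b c - ∑ b, ∑ c, Dβ c b * X b c
        - ∑ b, ∑ c, (∑ a, Dσ a a b c) * X b c + ∑ b, ∑ c, (∑ a, F a * σ a b c) * X b c)
      - ∑ b, ∑ c, (∑ m, H b c m * ∑ k, ∑ l, H m k l * X k l) * X b c := by
    simp only [Finset.mul_sum, ← Finset.sum_sub_distrib, ← Finset.sum_add_distrib]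
    exact Finset.sum_congr rfl fun b _ => Finset.sum_congr rfl fun c _ => by
      simp only [← Finset.mul_sum]; ring
  have k5 : ∑ b, ∑ c, (∑ a, Dσ a a b c) * X b c = ∑ a, ∑ b, ∑ c, Dσ a a b c * X b c := by
    simp only [Finset.sum_mul]
    rw [Finset.sum_congr rfl fun b _ => Finset.sum_comm, Finset.sum_comm]
  have k6 : ∑ b, ∑ c, (∑ a, F a * σ a b c) * X b c = ∑ a, F a * ∑ b, ∑ c, σ a b c * X b c := by
    simp only [Finset.sum_mul, Finset.mul_sum, mul_assoc]
    rw [Finset.sum_congr rfl fun b _ => Finset.sum_comm, Finset.sum_comm]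
  have k7 : -∑ a, ∑ c, β c * DX a a c + ∑ a, F a * ∑ c, β c * X a c = ∑ c, β c ^ 2 := by
    have : ∀ c, β c ^ 2 = -∑ a, β c * DX a a c + ∑ a, F a * (β c * X a c) := fun c => by
      rw [sq]
      nth_rewrite 2 [hβ c]
      rw [mul_add, mul_neg, Finset.mul_sum, Finset.mul_sum]
      exact congrArg _ (Finset.sum_congr rfl fun a _ => by ring)
    simp only [this, Finset.sum_add_distrib, Finset.sum_neg_distrib, Finset.mul_sum]
    rw [Finset.sum_comm]
    refine congrArg _ ?_
    rw [Finset.sum_comm]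
  -- `σ` is totally skew, so that contracting it with `∇ξ` gives a third of `|σ|²`
  have k8 : ∑ a, ∑ b, ∑ c, σ a b c ^ 2 = 3 * ∑ a, ∑ b, ∑ c, σ a b c * DX a b c := by
    have s1 : ∀ a b c, σ a b c = -σ b a c := fun a b c => by
      rw [hσ, hσ, hDX c b a]; ring
    have s2 : ∀ a b c, σ a b c = -σ a c b := fun a b c => by
      rw [hσ, hσ, hDX a c b]; ring
    have e1 : ∑ a, ∑ b, ∑ c, σ a b c * DX b a c = -∑ a, ∑ b, ∑ c, σ a b c * DX a b c := by
      rw [Finset.sum_comm, ← Finset.sum_neg_distrib]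
      refine Finset.sum_congr rfl fun a _ => ?_
      rw [← Finset.sum_neg_distrib]
      refine Finset.sum_congr rfl fun b _ => ?_
      rw [← Finset.sum_neg_distrib]
      exact Finset.sum_congr rfl fun c _ => by rw [s1 b a c]; ring
    have e2 : ∑ a, ∑ b, ∑ c, σ a b c * DX c a b = ∑ a, ∑ b, ∑ c, σ a b c * DX a b c := by
      rw [Finset.sum_congr rfl fun a _ => Finset.sum_comm, Finset.sum_comm]
      exact Finset.sum_congr rfl fun a _ => Finset.sum_congr rfl fun b _ =>
        Finset.sum_congr rfl fun c _ => by rw [s2 b c a, s1 b a c]; ring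
    have e3 : ∀ a b c, σ a b c ^ 2 =
        σ a b c * DX a b c - σ a b c * DX b a c + σ a b c * DX c a b := fun a b c => by
      rw [sq]; nth_rewrite 2 [hσ a b c]; ring
    simp only [e3, Finset.sum_add_distrib, Finset.sum_sub_distrib, e1, e2]
    ring
  rw [k4, k1, k2, k5, k6] at k3
  simp only [Finset.sum_add_distrib]
  rw [k8]
  linarith

end Algebra

/-! ### Steady solitons and `L̄_f` in a frame -/

section SolitonComponents

variable {E : Type*} [NormedAddCommGroup E] [NormedSpace ℝ E] [FiniteDimensional ℝ E]
  {M : Type*} [TopologicalSpace M] [T2Space M] [ChartedSpace E M] [IsManifold 𝓘(ℝ, E) ∞ M]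
  {g : RMetric E M}

lemma covD_two_skew {T : TField E M 2} (hT : IsTensor T) (hs : IsSkew₂ T) {x : M}
    (u v w : TangentSpace 𝓘(ℝ, E) x) :
    covD (fun _ => leviCivita g) T x ![u, v, w] = -covD (fun _ => leviCivita g) T x ![u, w, v] := by
  obtain ⟨V, hV, rfl, pV⟩ := exists_parallel_at g v
  obtain ⟨W, hW, rfl, pW⟩ := exists_parallel_at g w
  rw [covD_two_parallel hT hV hW pV pW, covD_two_parallel hT hW hV pW pV, ← dirDeriv_neg]
  exact congrArg (fun φ => dirDeriv φ u) (funext fun y => hs y _ _)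

lemma covD_three_skew_right {T : TField E M 3} (hT : IsTensor T)
    (hs : ∀ (x : M) (u v w : TangentSpace 𝓘(ℝ, E) x), T x ![u, v, w] = -T x ![u, w, v]) {x : M}
    (t u v w : TangentSpace 𝓘(ℝ, E) x) :
    covD (fun _ => leviCivita g) T x ![t, u, v, w]
      = -covD (fun _ => leviCivita g) T x ![t, u, w, v] := by
  obtain ⟨U, hU, rfl, pU⟩ := exists_parallel_at g u
  obtain ⟨V, hV, rfl, pV⟩ := exists_parallel_at g v
  obtain ⟨W, hW, rfl, pW⟩ := exists_parallel_at g w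
  rw [covD_three_parallel hT hU hV hW pU pV pW, covD_three_parallel hT hU hW hV pU pW pV,
    ← dirDeriv_neg]
  exact congrArg (fun φ => dirDeriv φ t) (funext fun y => hs y _ _ _)

lemma covD_three_skew_left {T : TField E M 3} (hT : IsTensor T)
    (hs : ∀ (x : M) (u v w : TangentSpace 𝓘(ℝ, E) x), T x ![u, v, w] = -T x ![v, u, w]) {x : M}
    (t u v w : TangentSpace 𝓘(ℝ, E) x) :
    covD (fun _ => leviCivita g) T x ![t, u, v, w]
      = -covD (fun _ => leviCivita g) T x ![t, v, u, w] := by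
  obtain ⟨U, hU, rfl, pU⟩ := exists_parallel_at g u
  obtain ⟨V, hV, rfl, pV⟩ := exists_parallel_at g v
  obtain ⟨W, hW, rfl, pW⟩ := exists_parallel_at g w
  rw [covD_three_parallel hT hU hV hW pU pV pW, covD_three_parallel hT hV hU hW pV pU pW,
    ← dirDeriv_neg]
  exact congrArg (fun φ => dirDeriv φ t) (funext fun y => hs y _ _ _)

/-- Steady generalized Ricci solitons `(M, g, H, f)` with closed torsion `H`. -/
structure IsSteadySoliton (g : RMetric E M) (H : TField E M 3) (f : M → ℝ) : Prop where
  tensor : IsTensor H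
  skew : IsSkew₃ H
  closed : extD H = 0
  smooth : SmoothFn E f
  ricci_eq : ricci g - (1 / 4 : ℝ) • Hsq g H + hessian g f = 0
  dStar_eq : dStar g f H = 0

lemma curvVec_frame {x : M} {A : Fin (Module.finrank ℝ E) → VField E M}
    (hA : IsParallelFrame g x A) (a b c) :
    curvVec (leviCivita g) (A a) (A b) (A c) x =
      ∑ m, curv g (leviCivita g) x ![onb g x a, onb g x b, onb g x c, onb g x m] • onb g x m := by
  have h := fun w => curv_eq g (isConnection_leviCivita g) (hA.smooth a) (hA.smooth b) (hA.smooth c) x w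
  simp only [hA.apply] at h
  conv_lhs => rw [← sum_inner_onb g (curvVec (leviCivita g) (A a) (A b) (A c) x)]
  simp only [h]

/-- The Ricci identity in components. -/
lemma ricci_identity_frame {T : TField E M 2} (hT : IsTensor T) (x : M) (d a b c) :
    covD (fun _ => leviCivita g) (covD (fun _ => leviCivita g) T) x
        ![onb g x d, onb g x a, onb g x b, onb g x c]
      - covD (fun _ => leviCivita g) (covD (fun _ => leviCivita g) T) x
        ![onb g x a, onb g x d, onb g x b, onb g x c] =
      -(∑ m, curv g (leviCivita g) x ![onb g x d, onb g x a, onb g x b, onb g x m]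
          * T x ![onb g x m, onb g x c])
      - ∑ m, curv g (leviCivita g) x ![onb g x d, onb g x a, onb g x c, onb g x m]
          * T x ![onb g x b, onb g x m] := by
  obtain ⟨A, hA⟩ := exists_parallelFrame g x
  have h := ricci_identity hT (hA.smooth d) (hA.smooth a) (hA.smooth b) (hA.smooth c)
    (hA.parallel d) (hA.parallel a) (hA.parallel b) (hA.parallel c)
  rw [curvVec_frame hA, curvVec_frame hA, linear_apply_sum_smul (hT.linear₂₀ x _),
    linear_apply_sum_smul (hT.linear₂₁ x _)] at h
  simpa only [hA.apply, smul_eq_mul] using h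

lemma curv_bismutPlus_frame {H : TField E M 3} (hH : IsTensor H) (x : M) (a b c d) :
    curv g (bismutPlus g H) x ![onb g x a, onb g x b, onb g x c, onb g x d] =
      curvPlusComp (fun a b c => H x ![onb g x a, onb g x b, onb g x c])
        (fun a b c d => covD (fun _ => leviCivita g) H x
          ![onb g x a, onb g x b, onb g x c, onb g x d])
        (fun a b c d => curv g (leviCivita g) x ![onb g x a, onb g x b, onb g x c, onb g x d])
        a b c d := by
  obtain ⟨A, hA⟩ := exists_parallelFrame g x
  have h := curv_bismutPlus hH (hA.smooth a) (hA.smooth b) (hA.smooth c) (hA.smooth d)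
    (hA.parallel a) (hA.parallel b) (hA.parallel c) (hA.parallel d)
  rw [torsionVec, torsionVec, linear_apply_sum_smul (hH.linear₃₁ x _ _),
    linear_apply_sum_smul (hH.linear₃₁ x _ _)] at h
  simp only [hA.apply, smul_eq_mul] at h
  exact h

/-- `2 L̄_f ξ` in components. -/
lemma Lbar_frame {H : TField E M 3} (hH : IsTensor H) (f : M → ℝ)
    {T : TField E M 2} (hT : IsTensor T) (x : M) (b c) :
    2 * Lbar g H f T x ![onb g x b, onb g x c] =
      twoLbarComp (fun a b => T x ![onb g x a, onb g x b])
        (fun a b c => covD (fun _ => leviCivita g) T x ![onb g x a, onb g x b, onb g x c])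
        (fun a b c => H x ![onb g x a, onb g x b, onb g x c])
        (fun a b c d => covD (fun _ => leviCivita g) (covD (fun _ => leviCivita g) T) x
          ![onb g x a, onb g x b, onb g x c, onb g x d])
        (fun a b c d => covD (fun _ => leviCivita g) H x
          ![onb g x a, onb g x b, onb g x c, onb g x d])
        (fun a b c d => curv g (leviCivita g) x ![onb g x a, onb g x b, onb g x c, onb g x d])
        (fun a => dirDeriv f (onb g x a)) b c := by
  have hm := isTensor_mixedD (g := g) hH hT
  have h1 : ∀ a b c, mixedD g H T x ![onb g x a, onb g x b, onb g x c] =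
      mixedDComp (fun a b => T x ![onb g x a, onb g x b])
        (fun a b c => covD (fun _ => leviCivita g) T x ![onb g x a, onb g x b, onb g x c])
        (fun a b c => H x ![onb g x a, onb g x b, onb g x c]) a b c := fun a b c =>
    mixedD_apply hH hT x _ _ _
  have h2 : mixedLap g H f T x ![onb g x b, onb g x c] =
      ∑ a, covD ![leviCivita g, bismutMinus g H, bismutPlus g H] (mixedD g H T) x
        ![onb g x a, onb g x a, onb g x b, onb g x c]
      - ∑ a, dirDeriv f (onb g x a) * mixedD g H T x ![onb g x a, onb g x b, onb g x c] := by
    change -(adjD g _ f (mixedD g H T) x ![onb g x b, onb g x c]) = _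
    rw [adjD, apply_vecCons_grad hm]
    ring
  have h3 : ringR g H T x ![onb g x b, onb g x c] = ∑ k, ∑ l,
      curv g (bismutPlus g H) x ![onb g x b, onb g x k, onb g x l, onb g x c]
        * T x ![onb g x k, onb g x l] := rfl
  have h4 : Lbar g H f T x ![onb g x b, onb g x c] =
      1 / 2 * mixedLap g H f T x ![onb g x b, onb g x c] + ringR g H T x ![onb g x b, onb g x c] := rfl
  rw [h4, h2, h3]
  simp only [curv_bismutPlus_frame hH, covD_mixed_three hH hm, covD_mixedD hH hT, h1]
  rw [twoLbarComp]
  simp only [mixedDDComp]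
  ring

lemma linear_eq_zero_of_onb {x : M} {L : TangentSpace 𝓘(ℝ, E) x → ℝ} (hL : IsLinearMap ℝ L)
    (h : ∀ a, L (onb g x a) = 0) (v : TangentSpace 𝓘(ℝ, E) x) : L v = 0 := by
  rw [← sum_inner_onb g v, linear_apply_sum_smul hL]
  simp [h]

lemma IsTensor.eq_zero_one {T : TField E M 1} (hT : IsTensor T) {x : M}
    (h : ∀ a, T x ![onb g x a] = 0) : T x = 0 := by
  funext w
  rw [eq_vec₁ w]
  exact linear_eq_zero_of_onb (g := g) (hT.linear₁ x) h _

lemma bilinear_eq_zero_of_onb {x : M}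
    {B : TangentSpace 𝓘(ℝ, E) x → TangentSpace 𝓘(ℝ, E) x → ℝ}
    (h1 : ∀ v, IsLinearMap ℝ (fun u => B u v)) (h2 : ∀ u, IsLinearMap ℝ (fun v => B u v))
    (h : ∀ a b, B (onb g x a) (onb g x b) = 0) (u v : TangentSpace 𝓘(ℝ, E) x) : B u v = 0 :=
  linear_eq_zero_of_onb (g := g) (h1 v) (fun a => linear_eq_zero_of_onb (g := g) (h2 _) (h a) v) u

lemma IsTensor.eq_zero_three {T : TField E M 3} (hT : IsTensor T) {x : M}
    (h : ∀ a b c, T x ![onb g x a, onb g x b, onb g x c] = 0) : T x = 0 := by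
  funext w
  rw [eq_vec₃ w]
  exact linear_eq_zero_of_onb (g := g) (hT.linear₃₀ x _ _) (fun a => bilinear_eq_zero_of_onb (g := g)
    (B := fun u v => T x ![onb g x a, u, v])
    (fun v => hT.linear₃₁ x _ v) (fun u => hT.linear₃₂ x _ u) (h a) _ _) _

omit [T2Space M] in
lemma Lbar_apply (H : TField E M 3) (f : M → ℝ) (T : TField E M 2) {x : M}
    (u v : TangentSpace 𝓘(ℝ, E) x) : Lbar g H f T x ![u, v] =
      1 / 2 * (∑ a, covD ![leviCivita g, bismutMinus g H, bismutPlus g H] (mixedD g H T) x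
          ![onb g x a, onb g x a, u, v] - mixedD g H T x ![grad g f x, u, v])
        + ∑ k, ∑ l, curv g (bismutPlus g H) x ![u, onb g x k, onb g x l, v]
          * T x ![onb g x k, onb g x l] := by
  change 1 / 2 * -(-∑ a, covD _ (mixedD g H T) x ![onb g x a, onb g x a, u, v]
    + mixedD g H T x ![grad g f x, u, v]) + _ = _
  rw [neg_add, neg_neg]
  rfl

/-- `L̄_f T` is a field of bilinear forms. -/
lemma Lbar_eq_zero_of_onb {H : TField E M 3} (hH : IsTensor H) (f : M → ℝ)
    {T : TField E M 2} (hT : IsTensor T) {x : M}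
    (h : ∀ b c, Lbar g H f T x ![onb g x b, onb g x c] = 0) : Lbar g H f T x = 0 := by
  have hm := isTensor_mixedD (g := g) hH hT
  have hB : IsConnection (bismutPlus g H) := isConnection_bismut g hH 1
  have hD : ∀ i : Fin 3, IsConnection (![leviCivita g, bismutMinus g H, bismutPlus g H] i) := by
    simp [Fin.forall_fin_succ, bismutMinus, bismutPlus, isConnection_bismut g hH,
      isConnection_leviCivita g]
  have e := fun u v => Lbar_apply (g := g) H f T (x := x) u v
  have c1 := (isTensor_covD hD hm).contract g
  have l0 : ∀ v, IsLinearMap ℝ (fun u => ∑ a, covD ![leviCivita g, bismutMinus g H, bismutPlus g H]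
      (mixedD g H T) x ![onb g x a, onb g x a, u, v]) := fun v => c1.linear₂₀ x v
  have l1 : ∀ v, IsLinearMap ℝ (fun u => ∑ a, covD ![leviCivita g, bismutMinus g H, bismutPlus g H]
      (mixedD g H T) x ![onb g x a, onb g x a, v, u]) := fun v => c1.linear₂₁ x v
  have r0 : ∀ a b c : TangentSpace 𝓘(ℝ, E) x,
      IsLinearMap ℝ (fun u => curv g (bismutPlus g H) x ![u, a, b, c]) := fun a b c => by
    obtain ⟨Y, hY, rfl⟩ := exists_smoothVF a
    obtain ⟨Z, hZ, rfl⟩ := exists_smoothVF b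
    constructor
    · intro u v
      obtain ⟨U, hU, rfl⟩ := exists_smoothVF u
      obtain ⟨V, hV, rfl⟩ := exists_smoothVF v
      rw [curv_eq g hB hU hY hZ, curv_eq g hB hV hY hZ, ← inner_add_left,
        ← curvVec_add_left hB hU hV hY hZ]
      exact curv_eq g hB (hU.add hV) hY hZ x c
    · intro r u
      obtain ⟨U, hU, rfl⟩ := exists_smoothVF u
      rw [curv_eq g hB hU hY hZ, smul_eq_mul, ← inner_smul_left,
        ← curvVec_smul_left (φ := fun _ => r) hB contMDiff_const hU hY hZ]
      exact curv_eq g hB (hU.const_smul r) hY hZ x c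
  have r1 : ∀ a b c : TangentSpace 𝓘(ℝ, E) x,
      IsLinearMap ℝ (fun u => curv g (bismutPlus g H) x ![a, b, c, u]) := fun a b c => by
    obtain ⟨X, hX, rfl⟩ := exists_smoothVF a
    obtain ⟨Y, hY, rfl⟩ := exists_smoothVF b
    obtain ⟨Z, hZ, rfl⟩ := exists_smoothVF c
    constructor
    · intro u v
      simp only [curv_eq g hB hX hY hZ, inner_add_right]
    · intro r u
      simp only [curv_eq g hB hX hY hZ, inner_smul_right, smul_eq_mul]
  funext w
  rw [eq_vec₂ w]
  refine bilinear_eq_zero_of_onb (g := g) (B := fun u v => Lbar g H f T x ![u, v]) (fun v => ?_)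
    (fun v => ?_) h _ _
  · constructor
    · intro u u'
      simp only [e, (l0 v).map_add, (hm.linear₃₁ x _ v).map_add, (r0 _ _ v).map_add, add_mul,
        Finset.sum_add_distrib]
      ring
    · intro r u
      simp only [e, (l0 v).map_smul, (hm.linear₃₁ x _ v).map_smul, (r0 _ _ v).map_smul, smul_eq_mul,
        mul_assoc, ← Finset.mul_sum]
      ring
  · constructor
    · intro u u'
      simp only [e, (l1 v).map_add, (hm.linear₃₂ x _ v).map_add, (r1 v _ _).map_add, add_mul,
        Finset.sum_add_distrib]
      ring
    · intro r u
      simp only [e, (l1 v).map_smul, (hm.linear₃₂ x _ v).map_smul, (r1 v _ _).map_smul, smul_eq_mul,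
        mul_assoc, ← Finset.mul_sum]
      ring

end SolitonComponents

/-! ### The kernel of `L̄_f` on `2`-forms and the energy identity -/

section EnergyIdentity

variable {E : Type*} [NormedAddCommGroup E] [NormedSpace ℝ E] [FiniteDimensional ℝ E]
  {M : Type*} [TopologicalSpace M] [T2Space M] [ChartedSpace E M] [IsManifold 𝓘(ℝ, E) ∞ M]
  {g : RMetric E M}

omit [FiniteDimensional ℝ E] [T2Space M] in
lemma IsCovec.isTensor {P : ∀ x : M, TangentSpace 𝓘(ℝ, E) x → ℝ} (hP : IsCovec P) :
    IsTensor (fun x (w : Fin 1 → TangentSpace 𝓘(ℝ, E) x) => P x (w 0)) := by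
  refine .of_isLinear (fun x w i => ?_) fun X hX => hP.smooth (hX 0)
  have : i = 0 := Subsingleton.elim _ _
  subst this
  simp only [Function.update_self]
  exact hP.linear x

/-- The contraction `v ↦ ∑_c S(e_c) T(v, e_c)`. -/
def contr₁ (g : RMetric E M) (S : TField E M 1) (T : TField E M 2) : TField E M 1 := fun x w =>
  ∑ c, S x ![onb g x c] * T x ![w 0, onb g x c]

/-- The contraction `v ↦ ∑_{b,c} S(v, e_b, e_c) T(e_b, e_c)`. -/
def contr₂ (g : RMetric E M) (S : TField E M 3) (T : TField E M 2) : TField E M 1 := fun x w =>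
  ∑ b, ∑ c, S x ![w 0, onb g x b, onb g x c] * T x ![onb g x b, onb g x c]

lemma isTensor_contr₁ {S : TField E M 1} (hS : IsTensor S) {T : TField E M 2} (hT : IsTensor T) :
    IsTensor (contr₁ g S T) := by
  refine IsCovec.isTensor (P := fun x v => ∑ c, S x ![onb g x c] * T x ![v, onb g x c])
    ⟨fun x => ⟨fun u v => ?_, fun r u => ?_⟩, fun {X} hX => ?_⟩
  · simp only [(hT.linear₂₀ x _).map_add, mul_add, Finset.sum_add_distrib]
  · simp only [(hT.linear₂₀ x _).map_smul, smul_eq_mul, Finset.mul_sum, mul_left_comm]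
  · exact hS.covec₁.smooth_trace_mul (hT.covec₂₁ hX)

lemma isTensor_contr₂ {S : TField E M 3} (hS : IsTensor S) {T : TField E M 2} (hT : IsTensor T) :
    IsTensor (contr₂ g S T) := by
  refine IsCovec.isTensor
    (P := fun x v => ∑ b, ∑ c, S x ![v, onb g x b, onb g x c] * T x ![onb g x b, onb g x c])
    ⟨fun x => ⟨fun u v => ?_, fun r u => ?_⟩, fun {X} hX => ?_⟩
  · simp only [(hS.linear₃₀ x _ _).map_add, add_mul, Finset.sum_add_distrib]
  · simp only [(hS.linear₃₀ x _ _).map_smul, smul_eq_mul, Finset.mul_sum, mul_assoc]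
  · exact (isBilin_trace_mul (hS.isBilin₃ hX) hT.isBilin₂).smooth_trace

lemma covD_contr₁ {S : TField E M 1} (hS : IsTensor S) {T : TField E M 2} (hT : IsTensor T) (x : M)
    (v : TangentSpace 𝓘(ℝ, E) x) (a) :
    covD (fun _ => leviCivita g) (contr₁ g S T) x ![v, onb g x a] =
      ∑ c, (covD (fun _ => leviCivita g) S x ![v, onb g x c] * T x ![onb g x a, onb g x c]
        + S x ![onb g x c] * covD (fun _ => leviCivita g) T x ![v, onb g x a, onb g x c]) := by
  obtain ⟨A, hA⟩ := exists_parallelFrame g x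
  rw [covD_one_frame (isTensor_contr₁ hS hT) hA]
  refine (hS.covec₁.dirDeriv_trace_mul (hT.covec₂₁ (hA.smooth a)) hA v).trans ?_
  simp only [covD_one_frame hS hA, covD_two_frame hT hA, hA.apply]

lemma covD_contr₂ {S : TField E M 3} (hS : IsTensor S) {T : TField E M 2} (hT : IsTensor T) (x : M)
    (v : TangentSpace 𝓘(ℝ, E) x) (a) :
    covD (fun _ => leviCivita g) (contr₂ g S T) x ![v, onb g x a] =
      ∑ k, ∑ l, (covD (fun _ => leviCivita g) S x ![v, onb g x a, onb g x k, onb g x l]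
          * T x ![onb g x k, onb g x l]
        + S x ![onb g x a, onb g x k, onb g x l]
          * covD (fun _ => leviCivita g) T x ![v, onb g x k, onb g x l]) := by
  obtain ⟨A, hA⟩ := exists_parallelFrame g x
  rw [covD_one_frame (isTensor_contr₂ hS hT) hA]
  refine (dirDeriv_trace_trace_mul (hS.isBilin₃ (hA.smooth a)) hT.isBilin₂ hA v).trans ?_
  simp only [covD_three_frame hS hA, covD_two_frame hT hA, hA.apply]

lemma dStar_one {T : TField E M 1} (hT : IsTensor T) (f : M → ℝ) (x : M) : dStar g f T x ![] =
    -∑ a, covD (fun _ => leviCivita g) T x ![onb g x a, onb g x a]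
      + ∑ a, dirDeriv f (onb g x a) * T x ![onb g x a] := dStar_apply hT f x ![]

lemma dStar_two {T : TField E M 2} (hT : IsTensor T) (f : M → ℝ) (x : M)
    (u : TangentSpace 𝓘(ℝ, E) x) : dStar g f T x ![u] =
    -∑ a, covD (fun _ => leviCivita g) T x ![onb g x a, onb g x a, u]
      + ∑ a, dirDeriv f (onb g x a) * T x ![onb g x a, u] := dStar_apply hT f x ![u]

lemma dStar_three {T : TField E M 3} (hT : IsTensor T) (f : M → ℝ) (x : M)
    (u v : TangentSpace 𝓘(ℝ, E) x) : dStar g f T x ![u, v] =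
    -∑ a, covD (fun _ => leviCivita g) T x ![onb g x a, onb g x a, u, v]
      + ∑ a, dirDeriv f (onb g x a) * T x ![onb g x a, u, v] := dStar_apply hT f x ![u, v]

lemma covD_extD_two {T : TField E M 2} (hT : IsTensor T) (hs : IsSkew₂ T) (x : M)
    (v : TangentSpace 𝓘(ℝ, E) x) (a b c) :
    covD (fun _ => leviCivita g) (extD T) x ![v, onb g x a, onb g x b, onb g x c] =
      covD (fun _ => leviCivita g) (covD (fun _ => leviCivita g) T) x
        ![v, onb g x a, onb g x b, onb g x c]
      - covD (fun _ => leviCivita g) (covD (fun _ => leviCivita g) T) x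
        ![v, onb g x b, onb g x a, onb g x c]
      + covD (fun _ => leviCivita g) (covD (fun _ => leviCivita g) T) x
        ![v, onb g x c, onb g x a, onb g x b] := by
  obtain ⟨A, hA⟩ := exists_parallelFrame g x
  have h1 := isTensor_covD (fun _ => isConnection_leviCivita g) hT
  rw [covD_three_frame (isTensor_extD_two g hT hs) hA, covD_three_frame h1 hA,
    covD_three_frame h1 hA, covD_three_frame h1 hA]
  simp only [extD_two g hs]
  have s1 := SmoothFn.diff (h1.smooth₃ (hA.smooth a) (hA.smooth b) (hA.smooth c)) x
  have s2 := SmoothFn.diff (h1.smooth₃ (hA.smooth b) (hA.smooth a) (hA.smooth c)) x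
  have s3 := SmoothFn.diff (h1.smooth₃ (hA.smooth c) (hA.smooth a) (hA.smooth b)) x
  refine (dirDeriv_add (s1.sub s2) s3 v).trans ?_
  exact congrArg (· + _) (dirDeriv_sub s1 s2 v)

lemma isTensor_dStarB {H : TField E M 3} (hH : IsTensor H) {f : M → ℝ} (hf : SmoothFn E f) {k : ℕ}
    {T : TField E M (k + 1)} (hT : IsTensor T) : IsTensor (dStarB g H f T) :=
  ((isTensor_covD (fun _ => isConnection_bismut g hH 1) hT).contract g).neg.add
    (hT.interior (smoothVF_grad g hf))

/-- `(d_f^B)^* T = d_f^* T - ½ η` for a `2`-form `T`, where `η` is the contraction of `H` with `T`. -/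
lemma dStarB_frame {H : TField E M 3} (hH : IsTensor H) (hs : IsSkew₃ H) (f : M → ℝ)
    {T : TField E M 2} (hT : IsTensor T) (x : M) (c) :
    dStarB g H f T x ![onb g x c] =
      dStar g f T x ![onb g x c] - 1 / 2 * contr₂ g H T x ![onb g x c] := by
  obtain ⟨A, hA⟩ := exists_parallelFrame g x
  have hB : IsConnection (bismutPlus g H) := isConnection_bismut g hH 1
  have h1 : ∀ a, covD (fun _ => bismutPlus g H) T x ![onb g x a, onb g x a, onb g x c] =
      covD (fun _ => leviCivita g) T x ![onb g x a, onb g x a, onb g x c]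
      - 1 / 2 * ∑ m, H x ![onb g x a, onb g x c, onb g x m] * T x ![onb g x a, onb g x m] := by
    intro a
    have h := covD_two (fun _ => hB) hT (hA.smooth a) (hA.smooth c) x (onb g x a)
    have e1 : T x ![bismutPlus g H (A a) x (onb g x a), A c x] = 0 := by
      have : torsionVec g H (onb g x a) (onb g x a) = 0 := by
        have h0 : ∀ m, H x ![onb g x a, onb g x a, onb g x m] = 0 := fun m => by
          linarith [(hs x (onb g x a) (onb g x a) (onb g x m)).1]
        simp [torsionVec, h0]
      rw [bismutPlus, bismut_eq, hA.parallel, zero_add, hA.apply, this, smul_zero,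
        (hT.linear₂₀ x _).map_zero]
    have e2 : T x ![A a x, bismutPlus g H (A c) x (onb g x a)] =
        1 / 2 * ∑ m, H x ![onb g x a, onb g x c, onb g x m] * T x ![onb g x a, onb g x m] := by
      rw [bismutPlus, bismut_eq, hA.parallel, zero_add, linear_map_smul (hT.linear₂₁ x _),
        torsionVec, linear_apply_sum_smul (hT.linear₂₁ x _)]
      simp only [smul_eq_mul, hA.apply]
    rw [e1, e2, ← covD_two_parallel hT (hA.smooth a) (hA.smooth c) (hA.parallel a) (hA.parallel c)] at h
    simp only [hA.apply] at h
    rw [h]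
    ring
  have h2 : dStarB g H f T x ![onb g x c] =
      -∑ a, covD (fun _ => bismutPlus g H) T x ![onb g x a, onb g x a, onb g x c]
      + ∑ a, dirDeriv f (onb g x a) * T x ![onb g x a, onb g x c] := by
    rw [← apply_vecCons_grad hT]
    rfl
  have h3 : contr₂ g H T x ![onb g x c] =
      -∑ a, ∑ m, H x ![onb g x a, onb g x c, onb g x m] * T x ![onb g x a, onb g x m] := by
    simp only [← Finset.sum_neg_distrib]
    exact Finset.sum_congr rfl fun a _ => Finset.sum_congr rfl fun m _ => by
      rw [(hs x (onb g x a) (onb g x c) (onb g x m)).1, neg_mul, neg_neg]; rfl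
  rw [h2, dStar_two hT, h3]
  simp only [h1, Finset.sum_sub_distrib, ← Finset.mul_sum]
  ring

variable {H : TField E M 3} {f : M → ℝ} {T : TField E M 2}

lemma IsSteadySoliton.sum_covD_frame (h : IsSteadySoliton g H f) (x : M) (b c) :
    ∑ a, covD (fun _ => leviCivita g) H x ![onb g x a, onb g x a, onb g x b, onb g x c] =
      ∑ a, dirDeriv f (onb g x a) * H x ![onb g x a, onb g x b, onb g x c] := by
  have h1 := dStar_three (g := g) h.tensor f x (onb g x b) (onb g x c)
  rw [h.dStar_eq] at h1
  have h2 : (0 : TField E M 2) x ![onb g x b, onb g x c] = 0 := rfl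
  rw [h2] at h1
  linarith

lemma IsSteadySoliton.closed_frame (h : IsSteadySoliton g H f) (x : M) (a b c d) :
    covD (fun _ => leviCivita g) H x ![onb g x a, onb g x b, onb g x c, onb g x d]
      - covD (fun _ => leviCivita g) H x ![onb g x b, onb g x a, onb g x c, onb g x d]
      + covD (fun _ => leviCivita g) H x ![onb g x c, onb g x a, onb g x b, onb g x d]
      - covD (fun _ => leviCivita g) H x ![onb g x d, onb g x a, onb g x b, onb g x c] = 0 := by
  rw [← extD_three g h.skew, h.closed]
  rfl

lemma IsSteadySoliton.ricci_frame (h : IsSteadySoliton g H f) (x : M) (b c) :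
    ∑ a, curv g (leviCivita g) x ![onb g x a, onb g x b, onb g x c, onb g x a]
      - 1 / 4 * sqComp (fun a b c => H x ![onb g x a, onb g x b, onb g x c]) b c
      + hessian g f x ![onb g x b, onb g x c] = 0 :=
  congrFun (congrFun h.ricci_eq x) ![onb g x b, onb g x c]

/-- The skew part of `L̄_f T`. -/
lemma Lbar_sub_frame (h : IsSteadySoliton g H f) (hT : IsTensor T) (hs : IsSkew₂ T) (x : M) (b c) :
    2 * Lbar g H f T x ![onb g x b, onb g x c] - 2 * Lbar g H f T x ![onb g x c, onb g x b] =
      -2 * ((covD (fun _ => leviCivita g) (dStar g f T) x ![onb g x b, onb g x c]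
          - covD (fun _ => leviCivita g) (dStar g f T) x ![onb g x c, onb g x b])
        + (-(∑ a, covD (fun _ => leviCivita g) (extD T) x
            ![onb g x a, onb g x a, onb g x b, onb g x c])
          + ∑ a, dirDeriv f (onb g x a) * extD T x ![onb g x a, onb g x b, onb g x c]))
      - ∑ m, H x ![onb g x b, onb g x c, onb g x m] * contr₂ g H T x ![onb g x m] := by
  have hd := isTensor_covD (fun _ => isConnection_leviCivita g) hT
  have key := twoLbarComp_sub (X := fun a b => T x ![onb g x a, onb g x b])
    (DX := fun a b c => covD (fun _ => leviCivita g) T x ![onb g x a, onb g x b, onb g x c])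
    (H := fun a b c => H x ![onb g x a, onb g x b, onb g x c])
    (DDX := fun a b c d => covD (fun _ => leviCivita g) (covD (fun _ => leviCivita g) T) x
      ![onb g x a, onb g x b, onb g x c, onb g x d])
    (DH := fun a b c d => covD (fun _ => leviCivita g) H x
      ![onb g x a, onb g x b, onb g x c, onb g x d])
    (R := fun a b c d => curv g (leviCivita g) x ![onb g x a, onb g x b, onb g x c, onb g x d])
    (F := fun a => dirDeriv f (onb g x a))
    (FF := fun a b => hessian g f x ![onb g x a, onb g x b])
    (fun a b => hs x _ _) (fun a b c => covD_two_skew hT hs _ _ _)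
    (fun a b c => (h.skew x _ _ _).1) (fun a b c => (h.skew x _ _ _).2) (h.sum_covD_frame x)
    (fun d a b c => covD_three_skew_left h.tensor (fun x u v w => (h.skew x u v w).1) _ _ _ _)
    (fun d a b c => covD_three_skew_right h.tensor (fun x u v w => (h.skew x u v w).2) _ _ _ _)
    (h.closed_frame x)
    (fun d a b c => covD_three_skew_right hd (fun x u v w => covD_two_skew hT hs u v w) _ _ _ _)
    (fun a b c d => curv_swap_left g (isConnection_leviCivita g) _ _ _ _)
    (fun a b c d => curv_leviCivita_swap_right g _ _ _ _)
    (ricci_identity_frame hT x) (h.ricci_frame x) b c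
  have eη : ∀ m, contr₂ g H T x ![onb g x m] = ∑ k, ∑ l,
    H x ![onb g x m, onb g x k, onb g x l] * T x ![onb g x k, onb g x l] := fun _ => rfl
  rw [Lbar_frame h.tensor f hT, Lbar_frame h.tensor f hT, key]
  simp only [covD_dStar_two h.smooth hT, covD_extD_two hT hs, extD_two g hs, eη]

/-- The symmetric part of `L̄_f T` for closed `T`. -/
lemma Lbar_add_frame (h : IsSteadySoliton g H f) (hT : IsTensor T) (hs : IsSkew₂ T)
    (hcl : extD T = 0) (x : M) (b c) :
    2 * Lbar g H f T x ![onb g x b, onb g x c] + 2 * Lbar g H f T x ![onb g x c, onb g x b] =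
      covD (fun _ => leviCivita g) (contr₂ g H T) x ![onb g x b, onb g x c]
      + covD (fun _ => leviCivita g) (contr₂ g H T) x ![onb g x c, onb g x b] := by
  have hd := isTensor_covD (fun _ => isConnection_leviCivita g) hT
  have key := twoLbarComp_add (X := fun a b => T x ![onb g x a, onb g x b])
    (DX := fun a b c => covD (fun _ => leviCivita g) T x ![onb g x a, onb g x b, onb g x c])
    (H := fun a b c => H x ![onb g x a, onb g x b, onb g x c])
    (DDX := fun a b c d => covD (fun _ => leviCivita g) (covD (fun _ => leviCivita g) T) x
      ![onb g x a, onb g x b, onb g x c, onb g x d])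
    (DH := fun a b c d => covD (fun _ => leviCivita g) H x
      ![onb g x a, onb g x b, onb g x c, onb g x d])
    (R := fun a b c d => curv g (leviCivita g) x ![onb g x a, onb g x b, onb g x c, onb g x d])
    (F := fun a => dirDeriv f (onb g x a))
    (fun a b => hs x _ _) (fun a b c => covD_two_skew hT hs _ _ _)
    (fun a b c => (h.skew x _ _ _).1) (fun a b c => (h.skew x _ _ _).2) (h.sum_covD_frame x)
    (fun d a b c => covD_three_skew_left h.tensor (fun x u v w => (h.skew x u v w).1) _ _ _ _)
    (fun d a b c => covD_three_skew_right h.tensor (fun x u v w => (h.skew x u v w).2) _ _ _ _)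
    (h.closed_frame x)
    (fun d a b c => covD_three_skew_right hd (fun x u v w => covD_two_skew hT hs u v w) _ _ _ _)
    (fun a b c d => curv_swap_left g (isConnection_leviCivita g) _ _ _ _)
    (fun a b c d => curv_leviCivita_swap_right g _ _ _ _)
    (fun a b c d => curv_bianchi g _ _ _ _)
    (fun a b c => by rw [← extD_two g hs, hcl]; rfl) b c
  rw [Lbar_frame h.tensor f hT, Lbar_frame h.tensor f hT, covD_contr₂ h.tensor hT,
    covD_contr₂ h.tensor hT, key]

/-- The conditions `dT = 0`, `d_f^* T = 0`, `(d_f^B)^* T = 0` imply `L̄_f T = 0`. -/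
lemma Lbar_eq_zero (h : IsSteadySoliton g H f) (hT : IsTensor T) (hs : IsSkew₂ T)
    (h1 : extD T = 0) (h2 : dStar g f T = 0) (h3 : dStarB g H f T = 0) : Lbar g H f T = 0 := by
  have hη : contr₂ g H T = 0 := by
    funext x
    refine (isTensor_contr₂ (g := g) h.tensor hT).eq_zero_one (g := g) fun a => ?_
    have := dStarB_frame (g := g) h.tensor h.skew f hT x a
    rw [h2, h3] at this
    simpa using this
  have z1 : ∀ x : M, ∀ u v : TangentSpace 𝓘(ℝ, E) x,
      covD (fun _ => leviCivita g) (0 : TField E M 1) x ![u, v] = 0 := fun x u v => by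
    rw [covD_one_apply]
    simp [dirDeriv_const]
  have z2 : ∀ x : M, ∀ t u v w : TangentSpace 𝓘(ℝ, E) x,
      covD (fun _ => leviCivita g) (0 : TField E M 3) x ![t, u, v, w] = 0 := fun x t u v w => by
    rw [covD_three_apply]
    simp [dirDeriv_const]
  funext x
  refine Lbar_eq_zero_of_onb h.tensor f hT fun b c => ?_
  have e1 := Lbar_sub_frame h hT hs x b c
  have e2 := Lbar_add_frame h hT hs h1 x b c
  rw [hη] at e1 e2
  rw [h1, h2] at e1
  simp only [z1, z2] at e1 e2
  simp only [Pi.zero_apply, mul_zero, Finset.sum_const_zero] at e1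
  linarith

/-- If `L̄_f T = 0`, then `|η|² + 4 |d_f^* T|² + ⅔ |dT|²` is a twisted divergence. -/
lemma energy_identity (h : IsSteadySoliton g H f) (hT : IsTensor T) (hs : IsSkew₂ T)
    (hL : Lbar g H f T = 0) (x : M) :
    ∑ m, contr₂ g H T x ![onb g x m] ^ 2 + 4 * ∑ c, dStar g f T x ![onb g x c] ^ 2
      + 2 / 3 * ∑ a, ∑ b, ∑ c, extD T x ![onb g x a, onb g x b, onb g x c] ^ 2 =
    4 * dStar g f (contr₁ g (dStar g f T) T) x ![] - 2 * dStar g f (contr₂ g (extD T) T) x ![] := by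
  have hβ := isTensor_dStar g h.smooth hT
  have hσ := isTensor_extD_two g hT hs
  rw [dStar_one (isTensor_contr₁ hβ hT), dStar_one (isTensor_contr₂ hσ hT)]
  simp only [covD_contr₁ hβ hT, covD_contr₂ hσ hT]
  refine energy_comp (X := fun a b => T x ![onb g x a, onb g x b])
    (DX := fun a b c => covD (fun _ => leviCivita g) T x ![onb g x a, onb g x b, onb g x c])
    (H := fun a b c => H x ![onb g x a, onb g x b, onb g x c])
    (F := fun a => dirDeriv f (onb g x a))
    (β := fun c => dStar g f T x ![onb g x c])
    (Dβ := fun a c => covD (fun _ => leviCivita g) (dStar g f T) x ![onb g x a, onb g x c])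
    (σ := fun a b c => extD T x ![onb g x a, onb g x b, onb g x c])
    (Dσ := fun a b c d => covD (fun _ => leviCivita g) (extD T) x
      ![onb g x a, onb g x b, onb g x c, onb g x d])
    (fun a b => hs x _ _) (fun a b c => covD_two_skew hT hs _ _ _)
    (fun a b c => (h.skew x _ _ _).1) (fun a b c => (h.skew x _ _ _).2)
    (fun c => dStar_two hT f x _) (fun a b c => extD_two g hs _ _ _) (fun b c => ?_)
  have e := Lbar_sub_frame h hT hs x b c
  rw [hL] at e
  refine e.symm.trans ?_
  simp

end EnergyIdentity

/-! ### Divergence in coordinates -/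

section Determinants

variable {E : Type*} [NormedAddCommGroup E] [NormedSpace ℝ E]
  {M : Type*} [TopologicalSpace M] [ChartedSpace E M]

lemma DiffFnAt.prod {ι : Type*} {s : Finset ι} {φ : ι → M → ℝ} {x : M}
    (h : ∀ i ∈ s, DiffFnAt E (φ i) x) : DiffFnAt E (fun y => ∏ i ∈ s, φ i y) x := by
  classical
  induction s using Finset.induction_on with
  | empty => simpa using (mdifferentiableAt_const : DiffFnAt E (fun _ : M => (1 : ℝ)) x)
  | insert a s ha ih =>
    simp only [Finset.prod_insert ha]
    exact MDifferentiableAt.mul (h a (Finset.mem_insert_self _ _))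
      (ih fun i hi => h i (Finset.mem_insert_of_mem hi))

lemma dirDeriv_prod {ι : Type*} [DecidableEq ι] {s : Finset ι} {φ : ι → M → ℝ} {x : M}
    (h : ∀ i ∈ s, DiffFnAt E (φ i) x) (v : TangentSpace 𝓘(ℝ, E) x) :
    dirDeriv (fun y => ∏ i ∈ s, φ i y) v =
      ∑ i ∈ s, dirDeriv (φ i) v * ∏ j ∈ s.erase i, φ j x := by
  induction s using Finset.induction_on with
  | empty => simp [dirDeriv_const]
  | insert a s ha ih =>
    have h1 : ∀ i ∈ s, DiffFnAt E (φ i) x := fun i hi => h i (Finset.mem_insert_of_mem hi)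
    simp only [Finset.prod_insert ha]
    refine (dirDeriv_mul (h a (Finset.mem_insert_self _ _)) (DiffFnAt.prod h1) v).trans ?_
    rw [ih h1, Finset.sum_insert ha, Finset.erase_insert ha, Finset.mul_sum, add_comm, mul_comm]
    refine congrArg _ (Finset.sum_congr rfl fun i hi => ?_)
    have hai : a ≠ i := fun h => ha (h ▸ hi)
    rw [Finset.erase_insert_of_ne hai, Finset.prod_insert fun h => ha (Finset.mem_of_mem_erase h)]
    ring

/-- Jacobi's formula for the derivative of a determinant. -/
lemma dirDeriv_det {ι : Type*} [Fintype ι] [DecidableEq ι] {A : M → Matrix ι ι ℝ} {x : M}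
    (h : ∀ i j, DiffFnAt E (fun y => A y i j) x) (v : TangentSpace 𝓘(ℝ, E) x) :
    dirDeriv (fun y => (A y).det) v =
      ∑ i, ∑ j, (A x).adjugate i j * dirDeriv (fun y => A y j i) v := by
  have h1 : ∀ i, ∑ j, (A x).adjugate i j * dirDeriv (fun y => A y j i) v =
      ((A x).updateCol i fun j => dirDeriv (fun y => A y j i) v).det := fun i => by
    rw [← Matrix.cramer_apply, Matrix.cramer_eq_adjugate_mulVec]
    rfl
  have h2 : ∀ (σ : Equiv.Perm ι) i, DiffFnAt E (fun y => A y (σ i) i) x := fun σ i => h _ _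
  simp only [h1, Matrix.det_apply']
  rw [dirDeriv_sum (φ := fun (σ : Equiv.Perm ι) y =>
      ((Equiv.Perm.sign σ : ℤ) : ℝ) * ∏ i, A y (σ i) i) fun σ _ =>
    DiffFnAt.mul' (mdifferentiableAt_const) (DiffFnAt.prod fun i _ => h2 σ i), Finset.sum_comm]
  refine Finset.sum_congr rfl fun σ _ => ?_
  rw [dirDeriv_const_mul _ (DiffFnAt.prod fun i _ => h2 σ i), dirDeriv_prod fun i _ => h2 σ i,
    Finset.mul_sum]
  refine Finset.sum_congr rfl fun i _ => ?_
  rw [← Finset.mul_prod_erase _ _ (Finset.mem_univ i), Matrix.updateCol_self]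
  refine congrArg _ (congrArg _ (Finset.prod_congr rfl fun j hj => ?_))
  rw [Matrix.updateCol_ne (Finset.ne_of_mem_erase hj)]

end Determinants

section Divergence

variable {E : Type*} [NormedAddCommGroup E] [NormedSpace ℝ E] [FiniteDimensional ℝ E]
  {M : Type*} [TopologicalSpace M] [T2Space M] [ChartedSpace E M] [IsManifold 𝓘(ℝ, E) ∞ M]
  (g : RMetric E M)

/-- The divergence of a vector field. -/
def divg (V : VField E M) (x : M) : ℝ := ∑ a, g.inner x (leviCivita g V x (onb g x a)) (onb g x a)

omit [T2Space M] in
lemma gram_mul {x : M} {n : ℕ} {e f : Fin n → TangentSpace 𝓘(ℝ, E) x} {P : Matrix (Fin n) (Fin n) ℝ}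
    (h : ∀ i, e i = ∑ j, P i j • f j) : gram g e = P * gram g f * P.transpose := by
  ext i k
  simp only [gram, Matrix.of_apply, Matrix.mul_apply, Matrix.transpose_apply, h]
  rw [inner_sum_left, Finset.sum_congr rfl fun j _ => inner_sum_right g _ _ _, Finset.sum_comm]
  simp only [inner_smul_left, inner_smul_right, Finset.sum_mul]
  exact Finset.sum_congr rfl fun k _ => Finset.sum_congr rfl fun j _ => by ring

/-- The coordinate frame of the chart at `c`. -/
def coordFrame (c y : M) (i : Fin (Module.finrank ℝ E)) : TangentSpace 𝓘(ℝ, E) y :=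
  coordVF c (Module.finBasis ℝ E i) y

omit [T2Space M] [FiniteDimensional ℝ E] in
lemma coordVF_sum (c y : M) {ι : Type*} (s : Finset ι) (r : ι → ℝ) (e : ι → E) :
    coordVF c (∑ i ∈ s, r i • e i) y = ∑ i ∈ s, r i • coordVF c (e i) y := by
  simp only [coordVF, map_sum, map_smul]

omit [T2Space M] in
lemma smooth_repr_coordL {c y : M} (hy : y ∈ (chartAt E c).source) {V : VField E M}
    (hV : SmoothVFieldAt V y) (i) : ContMDiffAt 𝓘(ℝ, E) 𝓘(ℝ, ℝ) ∞
      (fun z => (Module.finBasis ℝ E).repr (coordL c z (V z)) i) y := by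
  have h1 : ContMDiff 𝓘(ℝ, E) 𝓘(ℝ, ℝ) ∞ (fun e : E => (Module.finBasis ℝ E).repr e i) := by
    rw [contMDiff_iff_contDiff]
    exact (LinearMap.toContinuousLinearMap ((Module.finBasis ℝ E).coord i)).contDiff
  exact (h1 _).comp y (smooth_coordL hy hV)

omit [T2Space M] in
lemma sum_coordFrame {c y : M} (hy : y ∈ (chartAt E c).source) (v : TangentSpace 𝓘(ℝ, E) y) :
    v = ∑ i, (Module.finBasis ℝ E).repr (coordL c y v) i • coordFrame c y i := by
  conv_lhs => rw [← coordVF_coordL hy v, ← (Module.finBasis ℝ E).sum_repr (coordL c y v)]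
  exact coordVF_sum c y _ _ _

omit [T2Space M] in
lemma det_gram_coordFrame_pos {c y : M} (hy : y ∈ (chartAt E c).source) :
    0 < (gram g (coordFrame c y)).det := by
  have h1 := gram_mul g (e := onb g y) (f := coordFrame c y)
    (P := Matrix.of fun a i => (Module.finBasis ℝ E).repr (coordL c y (onb g y a)) i)
    fun a => sum_coordFrame hy _
  have h2 := gram_mul g (e := coordFrame c y) (f := onb g y)
    (P := Matrix.of fun i a => g.inner y (coordFrame c y i) (onb g y a)) fun i => (sum_inner_onb g _).symm
  rw [gram_onb] at h1 h2
  have h3 := congrArg Matrix.det h1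
  have h4 := congrArg Matrix.det h2
  rw [Matrix.det_one, Matrix.det_mul, Matrix.det_mul] at h3
  rw [Matrix.det_mul, Matrix.det_mul, Matrix.det_one, mul_one, Matrix.det_transpose] at h4
  have h5 : (gram g (coordFrame c y)).det ≠ 0 := fun h => by
    rw [h] at h3; simp at h3
  rw [h4] at h5 ⊢
  exact mul_self_pos.2 (left_ne_zero_of_mul h5)

/-- The Riemannian volume density in the chart at `c`. -/
def density (c y : M) : ℝ := Real.sqrt (gram g (coordFrame c y)).det

omit [T2Space M] in
lemma density_pos {c y : M} (hy : y ∈ (chartAt E c).source) : 0 < density g c y :=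
  Real.sqrt_pos.2 (det_gram_coordFrame_pos g hy)

omit [T2Space M] in
lemma smooth_det_gram_coordFrame {c y : M} (hy : y ∈ (chartAt E c).source) :
    ContMDiffAt 𝓘(ℝ, E) 𝓘(ℝ, ℝ) ∞ (fun y => (gram g (coordFrame c y)).det) y :=
  contMDiffAt_det fun _ _ => contMDiffAt_inner g (smooth_coordVF hy _) (smooth_coordVF hy _)

omit [T2Space M] in
lemma smooth_density {c y : M} (hy : y ∈ (chartAt E c).source) :
    ContMDiffAt 𝓘(ℝ, E) 𝓘(ℝ, ℝ) ∞ (density g c) y :=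
  (Real.contDiffAt_sqrt (det_gram_coordFrame_pos g hy).ne').contMDiffAt.comp y
    (smooth_det_gram_coordFrame g hy)

/-- The logarithmic derivative of a Gram determinant of commuting fields is a divergence. -/
lemma dirDeriv_det_gram {y : M} {U : Fin (Module.finrank ℝ E) → VField E M}
    (hU : ∀ i, SmoothVF (U i)) (hb : ∀ i j, mlieBracket 𝓘(ℝ, E) (U i) (U j) y = 0)
    (hdet : (gram g fun i => U i y).det ≠ 0) (i) :
    dirDeriv (fun z => (gram g fun i => U i z).det) (U i y) =
      2 * ((gram g fun i => U i y).det * divg g (U i) y) := by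
  have hc := isConnection_leviCivita g
  have hcomm : ∀ i j, leviCivita g (U j) y (U i y) = leviCivita g (U i) y (U j y) := fun i j => by
    rw [← sub_eq_zero, leviCivita_sub_leviCivita g (hU i) (hU j), hb]
  have h1 : divg g (U i) y = ∑ a, ∑ b, (gram g fun i => U i y)⁻¹ a b *
      g.inner y (leviCivita g (U i) y (U a y)) (U b y) :=
    sum_bilin_onb (B := fun u v => g.inner y (leviCivita g (U i) y u) v)
      (fun v => ⟨fun a b => by rw [hc.vadd (hU i), inner_add_left],
        fun r a => by rw [hc.vsmul (hU i), inner_smul_left, smul_eq_mul]⟩)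
      (fun u => ⟨fun a b => inner_add_right g _ _ _, fun r a => inner_smul_right g _ _ _⟩) hdet
  have h2 : ∀ a b, (gram g fun i => U i y).adjugate a b =
      (gram g fun i => U i y).det * (gram g fun i => U i y)⁻¹ a b := fun a b => by
    rw [Matrix.inv_def, Ring.inverse_eq_inv', Matrix.smul_apply, smul_eq_mul,
      mul_inv_cancel_left₀ hdet]
  have h4 : (gram g fun i => U i y).transpose = gram g fun i => U i y := by
    ext a b; exact gram_symm g (fun i => U i y) b a
  have h3 : ∀ a b, (gram g fun i => U i y)⁻¹ a b = (gram g fun i => U i y)⁻¹ b a := fun a b => by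
    conv_lhs => rw [← h4, ← Matrix.transpose_nonsing_inv]
    rfl
  rw [dirDeriv_det (A := fun z => gram g fun i => U i z) fun a b =>
    (smooth_inner g (hU a) (hU b)).diff y]
  have h5 : ∀ a b, dirDeriv (fun z => gram g (fun i => U i z) b a) (U i y) =
      g.inner y (leviCivita g (U i) y (U b y)) (U a y)
        + g.inner y (leviCivita g (U i) y (U a y)) (U b y) := fun a b => by
    refine (dirDeriv_inner g (hU b) (hU a) y _).trans ?_
    rw [hcomm i b, hcomm i a, g.symm y (U b y)]
  simp only [h5, h2, mul_add, Finset.sum_add_distrib]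
  have h6 : ∑ a, ∑ b, (gram g fun i => U i y).det * (gram g fun i => U i y)⁻¹ a b *
      g.inner y (leviCivita g (U i) y (U b y)) (U a y) =
      ∑ a, ∑ b, (gram g fun i => U i y).det * (gram g fun i => U i y)⁻¹ a b *
      g.inner y (leviCivita g (U i) y (U a y)) (U b y) := by
    rw [Finset.sum_comm]
    exact Finset.sum_congr rfl fun a _ => Finset.sum_congr rfl fun b _ => by rw [h3 b a]
  rw [h6, h1]
  simp only [mul_assoc, ← Finset.mul_sum]
  ring

lemma divg_congr {V W : VField E M} {x : M} (h : V =ᶠ[𝓝 x] W) : divg g V x = divg g W x := by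
  rw [divg, divg, (isConnection_leviCivita g).congr h]

lemma divg_smul {φ : M → ℝ} (hφ : SmoothFn E φ) {V : VField E M} (hV : SmoothVF V) (x : M) :
    divg g (fun y => φ y • V y) x = φ x * divg g V x + dirDeriv φ (V x) := by
  have h : dirDeriv φ (V x) = ∑ a, dirDeriv φ (onb g x a) * g.inner x (V x) (onb g x a) := by
    conv_lhs => rw [← sum_inner_onb g (V x), dirDeriv_vsum]
    exact Finset.sum_congr rfl fun a _ => by rw [dirDeriv_vsmul, mul_comm]
  rw [h, divg, divg, Finset.mul_sum, ← Finset.sum_add_distrib]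
  refine Finset.sum_congr rfl fun a _ => ?_
  rw [(isConnection_leviCivita g).leibniz hφ hV, inner_add_left, inner_smul_left, inner_smul_left]

lemma divg_sum {ι : Type*} (s : Finset ι) {V : ι → VField E M} (hV : ∀ i, SmoothVF (V i)) (x : M) :
    divg g (fun y => ∑ i ∈ s, V i y) x = ∑ i ∈ s, divg g (V i) x := by
  simp only [divg, (isConnection_leviCivita g).sum s hV, inner_sum_left]
  exact Finset.sum_comm

/-- The coordinate expression of the divergence. -/
lemma density_mul_divg {c y : M} (hy : y ∈ (chartAt E c).source) {V : VField E M} (hV : SmoothVF V) :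
    density g c y * divg g V y = ∑ i, dirDeriv
      (fun z => density g c z * (Module.finBasis ℝ E).repr (coordL c z (V z)) i)
      (coordFrame c y i) := by
  have ho := (chartAt E c).open_source
  choose U hU hUy using fun i => exists_smoothVF_eventuallyEq ho hy
    (X := coordVF c (Module.finBasis ℝ E i)) fun _ hz => smooth_coordVF hz _
  choose φ hφ hφy using fun i => exists_smoothFn_eventuallyEq ho hy
    fun z hz => (smooth_repr_coordL hz (hV z) i).contMDiffWithinAt
  have hUF : ∀ i, U i y = coordFrame c y i := fun i => (hUy i).eq_of_nhds
  have hgram : (fun z => (gram g fun i => U i z).det) =ᶠ[𝓝 y]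
      fun z => (gram g (coordFrame c z)).det := by
    filter_upwards [eventually_all.2 hUy] with z hz
    have : (fun i => U i z) = coordFrame c z := funext hz
    rw [this]
  have hdet0 := (det_gram_coordFrame_pos g hy).ne'
  have hdet : (gram g fun i => U i y).det = (gram g (coordFrame c y)).det := hgram.eq_of_nhds
  have hb : ∀ i j, mlieBracket 𝓘(ℝ, E) (U i) (U j) y = 0 := fun i j => by
    rw [(hUy i).mlieBracket_vectorField_eq (hUy j)]
    exact mlieBracket_coordVF hy _ _
  have hwd : DiffFnAt E (density g c) y := (smooth_density g hy).mdifferentiableAt (by simp)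
  -- `∂ᵢ w = w div(∂ᵢ)`, from `w² = det G`
  have h1 : ∀ i, dirDeriv (density g c) (coordFrame c y i) = density g c y * divg g (U i) y := by
    intro i
    have e1 : (fun z => density g c z * density g c z) =ᶠ[𝓝 y]
        fun z => (gram g fun i => U i z).det := by
      filter_upwards [hgram, ho.mem_nhds hy] with z hz hz'
      rw [hz]
      exact Real.mul_self_sqrt (det_gram_coordFrame_pos g hz').le
    have e2 := dirDeriv_congr e1 (coordFrame c y i)
    rw [dirDeriv_mul hwd hwd] at e2
    have e3 := dirDeriv_det_gram g hU hb (hdet ▸ hdet0) i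
    rw [hUF] at e3
    rw [e3, ← e1.eq_of_nhds] at e2
    have := density_pos g hy
    have e4 : density g c y * dirDeriv (density g c) (coordFrame c y i) =
      density g c y * (density g c y * divg g (U i) y) := by linarith
    exact mul_left_cancel₀ this.ne' e4
  have h2 : divg g V y = ∑ i, (φ i y * divg g (U i) y + dirDeriv (φ i) (coordFrame c y i)) := by
    have e1 : V =ᶠ[𝓝 y] fun z => ∑ i, φ i z • U i z := by
      filter_upwards [eventually_all.2 hUy, eventually_all.2 hφy, ho.mem_nhds hy] with z h3 h4 h5
      simp only [h3, h4]
      exact sum_coordFrame h5 (V z)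
    refine ((divg_congr g e1).trans (divg_sum g Finset.univ (V := fun i z => φ i z • U i z)
      (fun i => (hU i).smul (hφ i)) y)).trans ?_
    exact Finset.sum_congr rfl fun i _ => by rw [divg_smul g (hφ i) (hU i), hUF]
  rw [h2, Finset.mul_sum]
  refine Finset.sum_congr rfl fun i _ => ?_
  have e1 : (fun z => density g c z * (Module.finBasis ℝ E).repr (coordL c z (V z)) i) =ᶠ[𝓝 y]
      fun z => density g c z * φ i z := by
    filter_upwards [hφy i] with z hz
    rw [hz]
  rw [dirDeriv_congr e1, dirDeriv_mul hwd ((hφ i).diff y), h1]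
  ring

end Divergence

/-! ### Integration in a chart -/

section ChartIntegral

open MeasureTheory

variable {E : Type*} [NormedAddCommGroup E] [NormedSpace ℝ E]
  {M : Type*} [TopologicalSpace M] [ChartedSpace E M]

/-- A function on `M`, read in the chart at `c` and extended by zero outside its image. -/
def pull (c : M) (θ : M → ℝ) : E → ℝ :=
  (extChartAt 𝓘(ℝ, E) c).target.indicator fun u => θ ((extChartAt 𝓘(ℝ, E) c).symm u)

lemma pull_of_mem {c : M} {θ : M → ℝ} {u : E} (hu : u ∈ (extChartAt 𝓘(ℝ, E) c).target) :
    pull c θ u = θ ((extChartAt 𝓘(ℝ, E) c).symm u) := Set.indicator_of_mem hu _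

lemma pull_of_notMem {c : M} {θ : M → ℝ} {u : E} (hu : u ∉ (extChartAt 𝓘(ℝ, E) c).target) :
    pull c θ u = 0 := Set.indicator_of_notMem hu _

lemma pull_extChartAt {c y : M} (θ : M → ℝ) (hy : y ∈ (chartAt E c).source) :
    pull c θ (extChartAt 𝓘(ℝ, E) c y) = θ y := by
  have hy' : y ∈ (extChartAt 𝓘(ℝ, E) c).source := by simpa using hy
  rw [pull_of_mem ((extChartAt 𝓘(ℝ, E) c).map_source hy'), (extChartAt 𝓘(ℝ, E) c).left_inv hy']

lemma symm_mem_source {c : M} {u : E} (hu : u ∈ (extChartAt 𝓘(ℝ, E) c).target) :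
    (extChartAt 𝓘(ℝ, E) c).symm u ∈ (chartAt E c).source := by
  simpa using (extChartAt 𝓘(ℝ, E) c).map_target hu

lemma pull_congr {c : M} {θ η : M → ℝ} (h : ∀ y ∈ (chartAt E c).source, θ y = η y) :
    (pull c θ : E → ℝ) = pull c η :=
  Set.indicator_congr fun _ hu => h _ (symm_mem_source hu)

lemma pull_sum (c : M) {ι : Type*} (s : Finset ι) (θ : ι → M → ℝ) :
    (pull c (fun y => ∑ i ∈ s, θ i y) : E → ℝ) = fun u => ∑ i ∈ s, pull c (θ i) u := by
  funext u
  by_cases hu : u ∈ (extChartAt 𝓘(ℝ, E) c).target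
  · simp only [pull_of_mem hu]
  · simp only [pull_of_notMem hu, Finset.sum_const_zero]

section Compact

variable [T2Space M] [CompactSpace M]

omit [T2Space M] in
lemma isCompact_image_tsupport {c : M} {θ : M → ℝ} (hθ : tsupport θ ⊆ (chartAt E c).source) :
    IsCompact (extChartAt 𝓘(ℝ, E) c '' tsupport θ) :=
  (isClosed_tsupport θ).isCompact.image_of_continuousOn
    ((continuousOn_extChartAt c).mono (by simpa using hθ))

omit [T2Space M] [CompactSpace M] in
lemma pull_eq_zero {c : M} {θ : M → ℝ} {u : E} (hu : u ∉ extChartAt 𝓘(ℝ, E) c '' tsupport θ) :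
    pull c θ u = 0 := by
  by_cases h : u ∈ (extChartAt 𝓘(ℝ, E) c).target
  · rw [pull_of_mem h]
    by_contra h0
    exact hu ⟨_, subset_tsupport θ h0, (extChartAt 𝓘(ℝ, E) c).right_inv h⟩
  · exact pull_of_notMem h

omit [T2Space M] in
lemma hasCompactSupport_pull {c : M} {θ : M → ℝ} (hθ : tsupport θ ⊆ (chartAt E c).source) :
    HasCompactSupport (pull c θ : E → ℝ) :=
  HasCompactSupport.intro (isCompact_image_tsupport hθ) fun _ h => pull_eq_zero h

omit [T2Space M] in
lemma pull_eventuallyEq_zero {c : M} {θ : M → ℝ} (hθ : tsupport θ ⊆ (chartAt E c).source) {u : E}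
    (hu : u ∉ (extChartAt 𝓘(ℝ, E) c).target) : (pull c θ : E → ℝ) =ᶠ[𝓝 u] fun _ => 0 := by
  have h1 : u ∉ extChartAt 𝓘(ℝ, E) c '' tsupport θ := by
    rintro ⟨y, hy, rfl⟩
    exact hu ((extChartAt 𝓘(ℝ, E) c).map_source (by simpa using hθ hy))
  filter_upwards [(isCompact_image_tsupport hθ).isClosed.isOpen_compl.mem_nhds h1] with z hz
    using pull_eq_zero hz

omit [T2Space M] [CompactSpace M] in
lemma pull_eventuallyEq {c : M} (θ : M → ℝ) {u : E} (hu : u ∈ (extChartAt 𝓘(ℝ, E) c).target) :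
    (pull c θ : E → ℝ) =ᶠ[𝓝 u] fun z => θ ((extChartAt 𝓘(ℝ, E) c).symm z) := by
  filter_upwards [(isOpen_extChartAt_target c).mem_nhds hu] with z hz using pull_of_mem hz

variable [IsManifold 𝓘(ℝ, E) ∞ M]

omit [T2Space M] in
lemma contDiff_pull {c : M} {θ : M → ℝ} (hs : SmoothFn E θ)
    (hθ : tsupport θ ⊆ (chartAt E c).source) : ContDiff ℝ ∞ (pull c θ : E → ℝ) := by
  rw [contDiff_iff_contDiffAt]
  intro u
  by_cases hu : u ∈ (extChartAt 𝓘(ℝ, E) c).target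
  · have h1 : ContDiffOn ℝ ∞ (fun z => θ ((extChartAt 𝓘(ℝ, E) c).symm z))
        (extChartAt 𝓘(ℝ, E) c).target := by
      rw [← contMDiffOn_iff_contDiffOn]
      exact hs.comp_contMDiffOn (contMDiffOn_extChartAt_symm c)
    exact (h1.contDiffAt ((isOpen_extChartAt_target c).mem_nhds hu)).congr_of_eventuallyEq
      (pull_eventuallyEq θ hu)
  · exact contDiffAt_const.congr_of_eventuallyEq (pull_eventuallyEq_zero hθ hu)

omit [T2Space M] in
lemma fderiv_pull {c : M} {θ : M → ℝ} (hs : SmoothFn E θ)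
    (hθ : tsupport θ ⊆ (chartAt E c).source) (e u : E) :
    fderiv ℝ (pull c θ : E → ℝ) u e = pull c (fun y => dirDeriv θ (coordVF c e y)) u := by
  by_cases hu : u ∈ (extChartAt 𝓘(ℝ, E) c).target
  · rw [(pull_eventuallyEq θ hu).fderiv_eq, fderiv_comp_extChartAt_symm hu (hs.diff _),
      pull_of_mem hu, coordVF_eq_mfderiv (symm_mem_source hu), (extChartAt 𝓘(ℝ, E) c).right_inv hu]
  · rw [(pull_eventuallyEq_zero hθ hu).fderiv_eq, pull_of_notMem hu]
    simp

variable [FiniteDimensional ℝ E] [MeasurableSpace E] [BorelSpace E] (μ : Measure E)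
  [μ.IsAddHaarMeasure]

omit [T2Space M] in
lemma integrable_pull {c : M} {θ : M → ℝ} (hs : SmoothFn E θ)
    (hθ : tsupport θ ⊆ (chartAt E c).source) : Integrable (pull c θ : E → ℝ) μ :=
  (contDiff_pull hs hθ).continuous.integrable_of_hasCompactSupport (hasCompactSupport_pull hθ)

lemma integral_fderiv_eq_zero {F : E → ℝ} (hF : ContDiff ℝ ∞ F) (hc : HasCompactSupport F)
    (e : E) : Integrable (fun u => fderiv ℝ F u e) μ ∧ ∫ u, fderiv ℝ F u e ∂μ = 0 := by
  have h1 : Integrable (fun u => fderiv ℝ F u e) μ :=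
    Continuous.integrable_of_hasCompactSupport
      ((hF.continuous_fderiv (by simp)).clm_apply continuous_const) (hc.fderiv_apply ℝ e)
  refine ⟨h1, ?_⟩
  have h2 : Integrable F μ := hF.continuous.integrable_of_hasCompactSupport hc
  have := integral_mul_fderiv_eq_neg_fderiv_mul_of_integrable (μ := μ) (f := fun _ : E => (1 : ℝ))
    (g := F) (v := e) (by simp) (by simpa using h1) (by simpa using h2)
    (fun _ _ => differentiableAt_const _) (fun x _ => hF.differentiable (by simp) x)
  simpa using this

variable (g : RMetric E M)

/-- The Riemannian integral over the domain of the chart at `c`. -/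
def chartInt (c : M) (φ : M → ℝ) : ℝ := ∫ u, pull c (fun y => density g c y * φ y) u ∂μ

omit [T2Space M] [CompactSpace M] [FiniteDimensional ℝ E] [MeasurableSpace E] [BorelSpace E] in
lemma smooth_mul_of_tsupport {c : M} {ψ φ : M → ℝ} (hφ : SmoothFn E φ)
    (hψ : ∀ y ∈ (chartAt E c).source, ContMDiffAt 𝓘(ℝ, E) 𝓘(ℝ, ℝ) ∞ ψ y)
    (h : tsupport φ ⊆ (chartAt E c).source) :
    SmoothFn E (fun y => ψ y * φ y) ∧ tsupport (fun y => ψ y * φ y) ⊆ (chartAt E c).source := by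
  have h1 : tsupport (fun y => ψ y * φ y) ⊆ (chartAt E c).source := tsupport_mul_subset_right.trans h
  exact ⟨contMDiff_of_tsupport fun x hx => (hψ x (h1 hx)).mul (hφ x), h1⟩

omit [T2Space M] in
lemma chartInt_sum (c : M) {ι : Type*} (s : Finset ι) {φ : ι → M → ℝ} (hφ : ∀ i, SmoothFn E (φ i))
    (h : ∀ i, tsupport (φ i) ⊆ (chartAt E c).source) :
    chartInt μ g c (fun y => ∑ i ∈ s, φ i y) = ∑ i ∈ s, chartInt μ g c (φ i) := by
  have h1 := fun i => smooth_mul_of_tsupport (hφ i) (fun y hy => smooth_density g hy) (h i)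
  simp only [chartInt, Finset.mul_sum]
  rw [pull_sum c s fun i y => density g c y * φ i y]
  exact integral_finsetSum s fun i _ => integrable_pull μ (h1 i).1 (h1 i).2

/-- The divergence theorem for fields supported in a chart. -/
lemma chartInt_divg {c : M} {V : VField E M} (hV : SmoothVF V) {ρ : M → ℝ} (hρ : SmoothFn E ρ)
    (hs : tsupport ρ ⊆ (chartAt E c).source) :
    chartInt μ g c (divg g fun y => ρ y • V y) = 0 := by
  let ψ := fun (i : Fin (Module.finrank ℝ E)) (z : M) =>
    density g c z * (Module.finBasis ℝ E).repr (coordL c z (V z)) i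
  have hψ : ∀ i, ∀ z ∈ (chartAt E c).source, ContMDiffAt 𝓘(ℝ, E) 𝓘(ℝ, ℝ) ∞ (ψ i) z :=
    fun i z hz => (smooth_density g hz).mul (smooth_repr_coordL hz (hV z) i)
  have h1 := fun i => smooth_mul_of_tsupport hρ (hψ i) hs
  have h2 : (pull c (fun y => density g c y * divg g (fun y => ρ y • V y) y) : E → ℝ) =
      fun u => ∑ i, fderiv ℝ (pull c (fun y => ψ i y * ρ y)) u (Module.finBasis ℝ E i) := by
    simp only [fderiv_pull (h1 _).1 (h1 _).2]
    rw [← pull_sum c Finset.univ fun i y =>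
      dirDeriv (fun y => ψ i y * ρ y) (coordVF c (Module.finBasis ℝ E i) y)]
    refine pull_congr fun y hy => (density_mul_divg g hy (hV.smul hρ)).trans ?_
    refine Finset.sum_congr rfl fun i _ => ?_
    refine congrArg (fun θ => dirDeriv θ (coordFrame c y i)) (funext fun z => ?_)
    rw [map_smul, map_smul, Finsupp.smul_apply, smul_eq_mul]
    simp only [ψ]
    ring
  have h3 := fun i => integral_fderiv_eq_zero μ (contDiff_pull (h1 i).1 (h1 i).2)
    (hasCompactSupport_pull (h1 i).2) (Module.finBasis ℝ E i)
  rw [chartInt, h2, integral_finsetSum _ fun i _ => (h3 i).1]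
  exact Finset.sum_eq_zero fun i _ => (h3 i).2

end Compact

end ChartIntegral

/-! ### The divergence theorem on a compact manifold -/

section DivergenceTheorem

open MeasureTheory

variable {E : Type*} [NormedAddCommGroup E] [NormedSpace ℝ E] [FiniteDimensional ℝ E]
  {M : Type*} [TopologicalSpace M] [T2Space M] [ChartedSpace E M] [IsManifold 𝓘(ℝ, E) ∞ M]
  (g : RMetric E M)

/-- The derivative of the transition map from the chart at `c` to the chart at `c'`. -/
def transition (c c' y : M) : E →L[ℝ] E :=
  (coordL c' y).comp ((trivializationAt E (TangentSpace 𝓘(ℝ, E)) c).symmL ℝ y)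

omit [T2Space M] in
lemma hasFDerivAt_transition {c c' y : M} (hy : y ∈ (chartAt E c).source)
    (hy' : y ∈ (chartAt E c').source) :
    HasFDerivAt (fun u => extChartAt 𝓘(ℝ, E) c' ((extChartAt 𝓘(ℝ, E) c).symm u))
      (transition c c' y) (extChartAt 𝓘(ℝ, E) c y) := by
  have hyc : y ∈ (extChartAt 𝓘(ℝ, E) c).source := by simpa using hy
  have hu : extChartAt 𝓘(ℝ, E) c y ∈ (extChartAt 𝓘(ℝ, E) c).target :=
    (extChartAt 𝓘(ℝ, E) c).map_source hyc
  have h1 : MDifferentiableAt 𝓘(ℝ, E) 𝓘(ℝ, E) (extChartAt 𝓘(ℝ, E) c).symm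
      (extChartAt 𝓘(ℝ, E) c y) :=
    (mdifferentiableOn_extChartAt_symm _ hu).mdifferentiableAt
      ((isOpen_extChartAt_target c).mem_nhds hu)
  have hinv : (extChartAt 𝓘(ℝ, E) c).symm (extChartAt 𝓘(ℝ, E) c y) = y :=
    (extChartAt 𝓘(ℝ, E) c).left_inv hyc
  have h2 : MDifferentiableAt 𝓘(ℝ, E) 𝓘(ℝ, E) (extChartAt 𝓘(ℝ, E) c')
      ((extChartAt 𝓘(ℝ, E) c).symm (extChartAt 𝓘(ℝ, E) c y)) := by
    rw [hinv]; exact mdifferentiableAt_extChartAt hy'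
  have h3 : HasFDerivAt (fun u => extChartAt 𝓘(ℝ, E) c' ((extChartAt 𝓘(ℝ, E) c).symm u))
      (mfderiv 𝓘(ℝ, E) 𝓘(ℝ, E) (fun u => extChartAt 𝓘(ℝ, E) c' ((extChartAt 𝓘(ℝ, E) c).symm u))
        (extChartAt 𝓘(ℝ, E) c y) : E →L[ℝ] E) (extChartAt 𝓘(ℝ, E) c y) :=
    (h2.comp _ h1).hasMFDerivAt.hasFDerivAt
  have h4 : ∀ e : E, mfderiv 𝓘(ℝ, E) 𝓘(ℝ, E)
      (fun u => extChartAt 𝓘(ℝ, E) c' ((extChartAt 𝓘(ℝ, E) c).symm u))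
      (extChartAt 𝓘(ℝ, E) c y) e = transition c c' y e := fun e => by
    refine (mfderiv_comp_apply _ h2 h1 e).trans ?_
    refine Eq.trans ?_ (congrArg (coordL c' y) (coordVF_eq_mfderiv hy e)).symm
    rw [coordL_eq_mfderiv hy', hinv]
    rfl
  exact h3.congr_fderiv (ContinuousLinearMap.ext h4)

omit [T2Space M] in
/-- The density transforms by the absolute value of the Jacobian determinant. -/
lemma density_transition {c c' y : M} (hy' : y ∈ (chartAt E c').source) :
    density g c y = |(transition (E := E) c c' y).det| * density g c' y := by
  have h0 : ∀ i, (transition (E := E) c c' y : E →ₗ[ℝ] E) (Module.finBasis ℝ E i) =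
      coordL c' y (coordFrame c y i) := fun _ => rfl
  have h1 : gram g (coordFrame c y) = (LinearMap.toMatrix (Module.finBasis ℝ E)
      (Module.finBasis ℝ E) (transition (E := E) c c' y : E →ₗ[ℝ] E)).transpose * gram g (coordFrame c' y) *
        (LinearMap.toMatrix (Module.finBasis ℝ E)
      (Module.finBasis ℝ E) (transition (E := E) c c' y : E →ₗ[ℝ] E)).transpose.transpose :=
    gram_mul g fun i => by
      simp only [Matrix.transpose_apply, LinearMap.toMatrix_apply, h0]
      exact sum_coordFrame hy' (coordFrame c y i)
  have h2 : (transition (E := E) c c' y).det = LinearMap.det (transition (E := E) c c' y : E →ₗ[ℝ] E) := rfl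
  rw [density, h1, Matrix.det_mul, Matrix.det_mul, Matrix.transpose_transpose, Matrix.det_transpose,
    LinearMap.det_toMatrix, mul_right_comm, Real.sqrt_mul (mul_self_nonneg _),
    Real.sqrt_mul_self_eq_abs, h2, density]

lemma smooth_divg {V : VField E M} (hV : SmoothVF V) : SmoothFn E (divg g V) :=
  have hc := isConnection_leviCivita g
  IsBilin.smooth_trace (g := g) (B := fun x u v => g.inner x (leviCivita g V x u) v)
    { left := fun x v => ⟨fun a b => by rw [hc.vadd hV, inner_add_left],
        fun r a => by rw [hc.vsmul hV, inner_smul_left, smul_eq_mul]⟩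
      right := fun x u => ⟨fun a b => inner_add_right g _ _ _, fun r a => inner_smul_right g _ _ _⟩
      smooth := fun hX hY => smooth_inner g (hc.smooth hX hV) hY }

lemma tsupport_divg_smul_subset {V : VField E M} (hV : SmoothVF V) (ρ : M → ℝ) :
    tsupport (divg g fun y => ρ y • V y) ⊆ tsupport ρ := by
  refine closure_minimal (fun y hy => ?_) (isClosed_tsupport ρ)
  by_contra h
  have h1 : (fun y => ρ y • V y) =ᶠ[𝓝 y] fun y => (0 : ℝ) • V y := by
    filter_upwards [(isClosed_tsupport ρ).isOpen_compl.mem_nhds h] with z hz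
    rw [image_eq_zero_of_notMem_tsupport hz]
  refine hy ?_
  rw [divg_congr g h1, divg_smul g contMDiff_const hV, zero_mul, zero_add, dirDeriv_const]

section ChangeOfChart

variable [MeasurableSpace E] [BorelSpace E] (μ : Measure E) [μ.IsAddHaarMeasure]

omit [T2Space M] in
/-- The integral of a function supported in two chart domains is the same in both charts. -/
lemma chartInt_eq {c c' : M} {φ : M → ℝ} (h : tsupport φ ⊆ (chartAt E c).source)
    (h' : tsupport φ ⊆ (chartAt E c').source) : chartInt μ g c φ = chartInt μ g c' φ := by
  let S := (chartAt E c).source ∩ (chartAt E c').source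
  let ψ := extChartAt 𝓘(ℝ, E) c
  let ψ' := extChartAt 𝓘(ℝ, E) c'
  have hS : ∀ y ∈ S, y ∈ ψ.source ∧ y ∈ ψ'.source := fun y hy => by
    simpa [ψ, ψ', S] using hy
  have hsupp : ∀ y ∉ S, φ y = 0 := fun y hy => by
    by_contra h0
    exact hy ⟨h (subset_tsupport _ h0), h' (subset_tsupport _ h0)⟩
  have hvanish : ∀ (b : M) (u : E), u ∉ extChartAt 𝓘(ℝ, E) b '' S →
      pull b (fun y => density g b y * φ y) u = 0 := fun b u hu => by
    by_cases hb : u ∈ (extChartAt 𝓘(ℝ, E) b).target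
    · rw [pull_of_mem hb, hsupp _ fun hy => hu ⟨_, hy, (extChartAt 𝓘(ℝ, E) b).right_inv hb⟩,
        mul_zero]
    · exact pull_of_notMem hb
  have himage : (fun u => ψ' (ψ.symm u)) '' (ψ '' S) = ψ' '' S := by
    rw [Set.image_image]
    exact Set.image_congr fun y hy => by rw [ψ.left_inv (hS y hy).1]
  have hopen : IsOpen (ψ '' S) := by
    have h1 : ψ '' S = ψ.target ∩ ψ.symm ⁻¹' (chartAt E c').source := by
      ext u
      constructor
      · rintro ⟨y, hy, rfl⟩
        refine ⟨ψ.map_source (hS y hy).1, ?_⟩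
        rw [Set.mem_preimage, ψ.left_inv (hS y hy).1]
        exact hy.2
      · rintro ⟨h1, h2⟩
        exact ⟨ψ.symm u, ⟨symm_mem_source h1, h2⟩, ψ.right_inv h1⟩
    rw [h1]
    exact (continuousOn_extChartAt_symm c).isOpen_inter_preimage (isOpen_extChartAt_target c)
      (chartAt E c').open_source
  have hinj : Set.InjOn (fun u => ψ' (ψ.symm u)) (ψ '' S) := by
    rintro _ ⟨y, hy, rfl⟩ _ ⟨z, hz, rfl⟩ he
    simp only [ψ.left_inv (hS y hy).1, ψ.left_inv (hS z hz).1] at he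
    rw [ψ'.injOn (hS y hy).2 (hS z hz).2 he]
  have hcov := integral_image_eq_integral_abs_det_fderiv_smul μ hopen.measurableSet
    (f := fun u => ψ' (ψ.symm u)) (f' := fun u => transition c c' (ψ.symm u))
    (by
      rintro _ ⟨y, hy, rfl⟩
      rw [ψ.left_inv (hS y hy).1]
      exact (hasFDerivAt_transition hy.1 hy.2).hasFDerivWithinAt)
    hinj (pull c' fun y => density g c' y * φ y)
  rw [himage, setIntegral_eq_integral_of_forall_compl_eq_zero (hvanish c')] at hcov
  rw [chartInt, chartInt, hcov,
    ← setIntegral_eq_integral_of_forall_compl_eq_zero (hvanish c)]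
  refine setIntegral_congr_fun hopen.measurableSet ?_
  rintro _ ⟨y, hy, rfl⟩
  refine (pull_extChartAt _ hy.1).trans ?_
  have h1 : ψ.symm (extChartAt 𝓘(ℝ, E) c y) = y := ψ.left_inv (hS y hy).1
  have h2 : pull c' (fun y => density g c' y * φ y) (ψ' y) = _ := pull_extChartAt _ hy.2
  simp only [h1, h2, smul_eq_mul]
  rw [density_transition g (c := c) hy.2, mul_assoc]

end ChangeOfChart

variable [CompactSpace M]

variable (E M) in
lemma exists_partition : ∃ (t : Finset M) (ρ : t → M → ℝ), (∀ i, SmoothFn E (ρ i)) ∧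
    (∀ i y, 0 ≤ ρ i y) ∧ (∀ i, tsupport (ρ i) ⊆ (chartAt E (i : M)).source) ∧
    ∀ y, ∑ i, ρ i y = 1 := by
  obtain ⟨t, ht⟩ := isCompact_univ.elim_finite_subcover (fun c : M => (chartAt E c).source)
    (fun c => (chartAt E c).open_source) fun y _ => Set.mem_iUnion.2 ⟨y, mem_chart_source E y⟩
  obtain ⟨ρ, hρ⟩ := SmoothPartitionOfUnity.exists_isSubordinate 𝓘(ℝ, E) (isClosed_univ (X := M))
    (fun i : t => (chartAt E (i : M)).source) (fun i => (chartAt E (i : M)).open_source) fun y hy => by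
      obtain ⟨c, hc, hyc⟩ := Set.mem_iUnion₂.1 (ht hy)
      exact Set.mem_iUnion.2 ⟨⟨c, hc⟩, hyc⟩
  refine ⟨t, fun i => ρ i, fun i => (ρ i).contMDiff, fun i y => ρ.nonneg i y, hρ, fun y => ?_⟩
  rw [← finsum_eq_sum_of_fintype]
  exact ρ.sum_eq_one (Set.mem_univ y)

/-- A divergence on a compact manifold that does not change sign vanishes. -/
theorem divg_eq_zero_of_nonneg {V : VField E M} (hV : SmoothVF V) (h0 : ∀ x, 0 ≤ divg g V x)
    (x : M) : divg g V x = 0 := by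
  let _ : MeasurableSpace E := borel E
  have : BorelSpace E := ⟨rfl⟩
  let μ : Measure E := Measure.addHaar
  obtain ⟨t, ρ, hρ, hρ0, hsub, hsum⟩ := exists_partition E M
  have hd := fun j => smooth_divg g (hV.smul (hρ j))
  have hds := fun j => tsupport_divg_smul_subset g hV (ρ j)
  have hdiv : ∀ y, divg g V y = ∑ j, divg g (fun y => ρ j y • V y) y := fun y => by
    rw [← divg_sum g Finset.univ (V := fun j y => ρ j y • V y) (fun j => hV.smul (hρ j))]
    refine congrFun (congrArg (divg g) (funext fun z => ?_)) y
    simp only [← Finset.sum_smul, hsum, one_smul]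
  -- `∑ᵢ ∫ ρᵢ div(ρⱼ V) = ∫ div(ρⱼ V) = 0`, with all integrals moved to the `j`-th chart
  have hI : ∑ i : t, chartInt μ g i (fun y => ρ i y * divg g V y) = 0 := by
    have h1 : ∀ i : t, chartInt μ g i (fun y => ρ i y * divg g V y) =
        ∑ j : t, chartInt μ g j (fun y => ρ i y * divg g (fun y => ρ j y • V y) y) := fun i => by
      simp only [hdiv, Finset.mul_sum]
      rw [chartInt_sum μ g i Finset.univ (φ := fun (j : t) y => ρ i y * divg g (fun y => ρ j y • V y) y)
        (fun j => (hρ i).mul (hd j)) fun j => tsupport_mul_subset_left.trans (hsub i)]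
      exact Finset.sum_congr rfl fun j _ => chartInt_eq g μ (c := i) (c' := j)
        (tsupport_mul_subset_left.trans (hsub i))
        (tsupport_mul_subset_right.trans ((hds j).trans (hsub j)))
    simp only [h1]
    rw [Finset.sum_comm]
    refine Finset.sum_eq_zero fun j _ => ?_
    rw [← chartInt_sum μ g j Finset.univ (φ := fun (i : t) y => ρ i y * divg g (fun y => ρ j y • V y) y)
        (fun i => (hρ i).mul (hd j))
        fun i => tsupport_mul_subset_right.trans ((hds j).trans (hsub j))]
    simp only [← Finset.sum_mul, hsum, one_mul]
    exact chartInt_divg μ g hV (hρ j) (hsub j)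
  have hφ : ∀ i, SmoothFn E (fun y => ρ i y * divg g V y) := fun i => (hρ i).mul (smooth_divg g hV)
  have hφs : ∀ i, tsupport (fun y => ρ i y * divg g V y) ⊆ (chartAt E (i : M)).source := fun i =>
    tsupport_mul_subset_left.trans (hsub i)
  have hw := fun i => smooth_mul_of_tsupport (hφ i) (fun y hy => smooth_density g hy) (hφs i)
  have hnn : ∀ i : t, 0 ≤ (pull (i : M) (fun y => density g i y * (ρ i y * divg g V y)) : E → ℝ) :=
    fun i u => Set.indicator_nonneg (fun _ _ => mul_nonneg (Real.sqrt_nonneg _)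
      (mul_nonneg (hρ0 _ _) (h0 _))) u
  have hz := (Finset.sum_eq_zero_iff_of_nonneg fun i _ => integral_nonneg (hnn i)).1 hI
  have hz' : ∀ i, ρ i x * divg g V x = 0 := fun i => by
    by_cases hx : x ∈ (chartAt E (i : M)).source
    · by_contra hne
      refine (Continuous.integral_pos_of_hasCompactSupport_nonneg_nonzero (μ := μ)
        (contDiff_pull (hw i).1 (hw i).2).continuous (hasCompactSupport_pull (hw i).2) (hnn i)
        (x := extChartAt 𝓘(ℝ, E) (i : M) x) ?_).ne' (hz i (Finset.mem_univ i))
      rw [pull_extChartAt _ hx]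
      exact mul_ne_zero (density_pos g hx).ne' hne
    · rw [image_eq_zero_of_notMem_tsupport fun h => hx (hsub i h), zero_mul]
  rw [← one_mul (divg g V x), ← hsum x, Finset.sum_mul]
  exact Finset.sum_eq_zero fun i _ => hz' i

end DivergenceTheorem

/-! ### The weighted divergence theorem and vanishing -/

section WeightedDivergence

variable {E : Type*} [NormedAddCommGroup E] [NormedSpace ℝ E]
  {M : Type*} [TopologicalSpace M] [ChartedSpace E M]

lemma dirDeriv_exp_neg {φ : M → ℝ} {x : M} (hφ : DiffFnAt E φ x) (v : TangentSpace 𝓘(ℝ, E) x) :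
    dirDeriv (fun y => Real.exp (-φ y)) v = -(Real.exp (-φ x) * dirDeriv φ v) := by
  have h1 : MDifferentiableAt 𝓘(ℝ, ℝ) 𝓘(ℝ, ℝ) (fun t : ℝ => Real.exp (-t)) (φ x) :=
    (Real.differentiable_exp.comp differentiable_neg).differentiableAt.mdifferentiableAt
  refine (mvfderiv_comp_apply x h1 hφ v).trans ?_
  have h2 : HasDerivAt (fun t : ℝ => Real.exp (-t)) (Real.exp (-φ x) * -1) (φ x) :=
    (hasDerivAt_neg (φ x)).exp
  have h3 : ∀ r : ℝ, mvfderiv 𝓘(ℝ, ℝ) (fun t : ℝ => Real.exp (-t)) (φ x) r =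
      r * (Real.exp (-φ x) * -1) := fun r => by
    simp only [mvfderiv, mfderiv_eq_fderiv]
    exact congrArg (fun L : ℝ →L[ℝ] ℝ => L r) h2.hasFDerivAt.fderiv
  refine (h3 _).trans ?_
  change dirDeriv φ v * _ = _
  ring

variable [FiniteDimensional ℝ E] [T2Space M] [IsManifold 𝓘(ℝ, E) ∞ M] (g : RMetric E M)

/-- The vector field dual to a `1`-form. -/
def sharp (α : TField E M 1) : VField E M := fun x => ∑ a, α x ![onb g x a] • onb g x a

omit [T2Space M] in
lemma inner_sharp {α : TField E M 1} (hα : IsTensor α) {x : M} (w : TangentSpace 𝓘(ℝ, E) x) :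
    g.inner x (sharp g α x) w = α x ![w] := by
  rw [sharp, inner_sum_left]
  conv_rhs => rw [← sum_inner_onb g w]
  refine Eq.trans ?_ (linear_apply_sum_smul (hα.linear₁ x) _ _ _).symm
  refine Finset.sum_congr rfl fun a _ => ?_
  rw [inner_smul_left, g.symm x w, smul_eq_mul, mul_comm]

lemma smoothVF_sharp {α : TField E M 1} (hα : IsTensor α) : SmoothVF (sharp g α) :=
  smoothVF_of_inner g fun Z hZ => by
    simp only [inner_sharp g hα]
    exact hα.smooth₁ hZ

lemma covD_leviCivita_one {α : TField E M 1} (hα : IsTensor α) (x : M)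
    (v w : TangentSpace 𝓘(ℝ, E) x) : covD (fun _ => leviCivita g) α x ![v, w] =
      g.inner x (leviCivita g (sharp g α) x v) w := by
  obtain ⟨W, hW, rfl⟩ := exists_smoothVF w
  rw [covD_one (fun _ => isConnection_leviCivita g) hα hW]
  simp only [← inner_sharp g hα]
  rw [dirDeriv_inner g (smoothVF_sharp g hα) hW]
  ring

/-- `d_f^*` on `1`-forms is the negative of the divergence, up to the weight `e^{-f}`. -/
lemma divg_exp_smul_sharp {f : M → ℝ} (hf : SmoothFn E f) {α : TField E M 1} (hα : IsTensor α)
    (x : M) : divg g (fun y => Real.exp (-f y) • sharp g α y) x =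
      -(Real.exp (-f x) * dStar g f α x ![]) := by
  have h1 : SmoothFn E (fun y => Real.exp (-f y)) :=
    (Real.contDiff_exp.comp contDiff_neg).contMDiff.comp hf
  rw [divg_smul g h1 (smoothVF_sharp g hα), dirDeriv_exp_neg (hf.diff x), dStar_one hα]
  simp only [covD_leviCivita_one g hα]
  rw [← divg, sharp, dirDeriv_vsum]
  simp only [dirDeriv_vsmul, mul_comm]
  ring

variable {g} [CompactSpace M]

/-- A nonnegative function that is a difference of twisted divergences vanishes. -/
lemma eq_zero_of_eq_dStar {f : M → ℝ} (hf : SmoothFn E f) {α β : TField E M 1} (hα : IsTensor α)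
    (hβ : IsTensor β) {φ : M → ℝ} (h0 : ∀ x, 0 ≤ φ x) (p q : ℝ)
    (h : ∀ x, φ x = p * dStar g f α x ![] - q * dStar g f β x ![]) (x : M) : φ x = 0 := by
  have he : SmoothFn E (fun y => Real.exp (-f y)) :=
    (Real.contDiff_exp.comp contDiff_neg).contMDiff.comp hf
  have hV := SmoothVF.smul he (smoothVF_sharp g hα)
  have hW := SmoothVF.smul he (smoothVF_sharp g hβ)
  have hd : ∀ y, divg g (fun y => ∑ i : Fin 2, (![-p, q] i) •
      (Real.exp (-f y) • sharp g (![α, β] i) y)) y = Real.exp (-f y) * φ y := fun y => by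
    rw [divg_sum g Finset.univ (V := fun i y => (![-p, q] i) •
      (Real.exp (-f y) • sharp g (![α, β] i) y)) (by
        intro i; fin_cases i
        exacts [hV.const_smul _, hW.const_smul _]), Fin.sum_univ_two]
    have h1 := divg_smul g (φ := fun _ => -p) contMDiff_const hV y
    have h2 := divg_smul g (φ := fun _ => q) contMDiff_const hW y
    rw [dirDeriv_const, divg_exp_smul_sharp g hf hα] at h1
    rw [dirDeriv_const, divg_exp_smul_sharp g hf hβ] at h2
    refine (congrArg₂ (· + ·) h1 h2).trans ?_
    rw [h y]
    ring
  have hs : SmoothVF (fun y => ∑ i : Fin 2, (![-p, q] i) •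
      (Real.exp (-f y) • sharp g (![α, β] i) y)) := SmoothVF.sum fun i _ => by
    fin_cases i
    exacts [hV.const_smul _, hW.const_smul _]
  have := divg_eq_zero_of_nonneg g hs (fun y => by
    rw [hd]; exact mul_nonneg (Real.exp_pos _).le (h0 y)) x
  rw [hd] at this
  exact (mul_eq_zero.1 this).resolve_left (Real.exp_pos _).ne'

/-- On a compact steady soliton, `2`-forms in the kernel of `L̄_f` are closed and coclosed. -/
theorem eq_zero_of_Lbar_eq_zero {H : TField E M 3} {f : M → ℝ} (h : IsSteadySoliton g H f)
    {T : TField E M 2} (hT : IsTensor T) (hs : IsSkew₂ T) (hL : Lbar g H f T = 0) :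
    extD T = 0 ∧ dStar g f T = 0 ∧ dStarB g H f T = 0 := by
  have hβ := isTensor_dStar g h.smooth hT
  have hσ := isTensor_extD_two g hT hs
  have hη : IsTensor (contr₂ g H T) := isTensor_contr₂ h.tensor hT
  have hen := eq_zero_of_eq_dStar h.smooth (isTensor_contr₁ (g := g) hβ hT)
    (isTensor_contr₂ (g := g) hσ hT) (φ := fun x => ∑ m, contr₂ g H T x ![onb g x m] ^ 2
      + 4 * ∑ c, dStar g f T x ![onb g x c] ^ 2
      + 2 / 3 * ∑ a, ∑ b, ∑ c, extD T x ![onb g x a, onb g x b, onb g x c] ^ 2)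
    (fun x => by positivity) 4 2 fun x => energy_identity h hT hs hL x
  have h1 : ∀ x, 0 ≤ ∑ m, contr₂ g H T x ![onb g x m] ^ 2 := fun x => by positivity
  have h2 : ∀ x, 0 ≤ ∑ c, dStar g f T x ![onb g x c] ^ 2 := fun x => by positivity
  have h3 : ∀ x, 0 ≤ ∑ a, ∑ b, ∑ c, extD T x ![onb g x a, onb g x b, onb g x c] ^ 2 :=
    fun x => by positivity
  have e2 : dStar g f T = 0 := funext fun x => hβ.eq_zero_one (g := g) fun a => by
    have h4 : ∑ c, dStar g f T x ![onb g x c] ^ 2 = 0 := by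
      have := hen x; linarith [h1 x, h2 x, h3 x]
    exact pow_eq_zero_iff two_ne_zero |>.1
      ((Finset.sum_eq_zero_iff_of_nonneg fun _ _ => sq_nonneg _).1 h4 a (Finset.mem_univ a))
  have e1 : contr₂ g H T = 0 := funext fun x => hη.eq_zero_one (g := g) fun a => by
    have h4 : ∑ c, contr₂ g H T x ![onb g x c] ^ 2 = 0 := by
      have := hen x; linarith [h1 x, h2 x, h3 x]
    exact pow_eq_zero_iff two_ne_zero |>.1
      ((Finset.sum_eq_zero_iff_of_nonneg fun _ _ => sq_nonneg _).1 h4 a (Finset.mem_univ a))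
  have e3 : extD T = 0 := funext fun x => hσ.eq_zero_three (g := g) fun a b c => by
    have h4 : ∑ a, ∑ b, ∑ c, extD T x ![onb g x a, onb g x b, onb g x c] ^ 2 = 0 := by
      have := hen x; linarith [h1 x, h2 x, h3 x]
    have h5 := (Finset.sum_eq_zero_iff_of_nonneg fun _ _ => by positivity).1 h4 a (Finset.mem_univ a)
    have h6 := (Finset.sum_eq_zero_iff_of_nonneg fun _ _ => by positivity).1 h5 b (Finset.mem_univ b)
    exact pow_eq_zero_iff two_ne_zero |>.1
      ((Finset.sum_eq_zero_iff_of_nonneg fun _ _ => sq_nonneg _).1 h6 c (Finset.mem_univ c))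
  refine ⟨e3, e2, ?_⟩
  have hB : IsTensor (dStarB g H f T) := isTensor_dStarB h.tensor h.smooth hT
  funext x
  refine hB.eq_zero_one (g := g) fun a => ?_
  rw [dStarB_frame h.tensor h.skew f hT, e1, e2]
  simp

end WeightedDivergence

/-! ### Hermitian metrics on complex manifolds -/

section Hermitian

variable {E : Type*} [NormedAddCommGroup E] [NormedSpace ℝ E]
  {M : Type*} [TopologicalSpace M] [ChartedSpace E M] [IsManifold 𝓘(ℝ, E) ∞ M]

lemma SmoothVF.end {J : EndField E M} (hJ : IsComplexStructure J) {X : VField E M}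
    (hX : SmoothVF X) : SmoothVF (fun y => J y (X y)) := fun x => hJ.smooth x X (hX x)

omit [IsManifold 𝓘(ℝ, E) ∞ M] in
lemma extD_neg {k : ℕ} (T : TField E M k) [IsManifold 𝓘(ℝ, E) ∞ M] : extD (-T) = -extD T := by
  funext x w
  simp only [extD, Pi.neg_apply, dirDeriv_neg, mul_neg, Finset.sum_neg_distrib]

lemma extD_zero {k : ℕ} : extD (0 : TField E M k) = 0 := by
  funext x w
  simp [extD, dirDeriv_const]

variable [FiniteDimensional ℝ E] (g : RMetric E M)

lemma dStar_neg {k : ℕ} (f : M → ℝ) (T : TField E M (k + 1)) :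
    dStar g f (-T) = -dStar g f T := by
  funext x w
  simp only [dStar, adjD, covD, Pi.neg_apply, dirDeriv_neg, Finset.sum_neg_distrib,
    Finset.sum_sub_distrib]
  ring

lemma dStar_zero {k : ℕ} (f : M → ℝ) : dStar g f (0 : TField E M (k + 1)) = 0 := by
  funext x w
  simp [dStar, adjD, covD, dirDeriv_const]

lemma hodgeLap_neg_eq_zero {k : ℕ} {f : M → ℝ} {T : TField E M (k + 1)} (h1 : extD T = 0)
    (h2 : dStar g f T = 0) : hodgeLap g f (-T) = 0 := by
  rw [hodgeLap, dStar_neg, h2, extD_neg (T := T), h1, neg_zero, neg_zero, extD_zero, dStar_zero]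
  simp

variable [T2Space M] {g} {J : EndField E M} (hJ : IsComplexStructure J)
  (hg : ∀ x v w, g.inner x (J x v) (J x w) = g.inner x v w)

include hJ

lemma IsTensor.pullEnd {k : ℕ} {T : TField E M k} (hT : IsTensor T) : IsTensor (pullEnd J T) where
  multilinear := fun x => by
    obtain ⟨A, hA⟩ := hT.multilinear x
    exact ⟨A.compLinearMap fun _ => (J x : _ →ₗ[ℝ] _), by
      funext w
      simp only [PluriclosedSoliton.pullEnd, hA]
      rfl⟩
  smooth := fun X hX => hT.smooth (fun i y => J y (X i y)) fun i => (hX i).end hJ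

lemma isTensor_compJ {T : TField E M 2} (hT : IsTensor T) : IsTensor (compJ J T) :=
  .of_isLinear (fun x w i => by
    fin_cases i
    · exact hT.linear₂₀ x (J x (w 1))
    · have h := hT.linear₂₁ x (w 0)
      exact ⟨fun u v => by
          change T x ![w 0, J x (u + v)] = T x ![w 0, J x u] + T x ![w 0, J x v]
          rw [map_add, h.map_add],
        fun r u => by
          change T x ![w 0, J x (r • u)] = r • T x ![w 0, J x u]
          rw [map_smul, h.map_smul]⟩)
    fun X hX => hT.smooth₂ (hX 0) ((hX 1).end hJ)

include hg

lemma inner_J_left {x : M} (v w : TangentSpace 𝓘(ℝ, E) x) :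
    g.inner x (J x v) w = -g.inner x v (J x w) := by
  rw [← hg x (J x v) w, hJ.sq, inner_neg_left]

lemma isSkew₂_kahlerForm : IsSkew₂ (kahlerForm g J) := fun x u v => by
  change g.inner x (J x u) v = -g.inner x (J x v) u
  rw [inner_J_left hJ hg, g.symm x u]

omit hg in
lemma isTensor_kahlerForm : IsTensor (kahlerForm g J) :=
  .of_isLinear (fun x w i => by
    fin_cases i
    · exact ⟨fun u v => by
          change g.inner x (J x (u + v)) (w 1) = g.inner x (J x u) (w 1) + g.inner x (J x v) (w 1)
          rw [map_add, inner_add_left],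
        fun r u => by
          change g.inner x (J x (r • u)) (w 1) = r • g.inner x (J x u) (w 1)
          rw [map_smul, inner_smul_left, smul_eq_mul]⟩
    · exact ⟨fun u v => inner_add_right g _ _ _, fun r u => inner_smul_right g _ _ _⟩)
    fun X hX => smooth_inner g ((hX 0).end hJ) (hX 1)

/-- `∇ω` is the covariant derivative of `J`. -/
lemma covD_kahlerForm {Y : VField E M} (hY : SmoothVF Y) {x : M} (v w : TangentSpace 𝓘(ℝ, E) x) :
    covD (fun _ => leviCivita g) (kahlerForm g J) x ![v, Y x, w] =
      g.inner x (leviCivita g (fun y => J y (Y y)) x v - J x (leviCivita g Y x v)) w := by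
  obtain ⟨Z, hZ, rfl⟩ := exists_smoothVF w
  rw [covD_two (fun _ => isConnection_leviCivita g) (isTensor_kahlerForm hJ) hY hZ]
  refine (congrArg (fun r => r - _ - _) (dirDeriv_inner g (hY.end hJ) hZ x v)).trans ?_
  change _ - g.inner x (J x (leviCivita g Y x v)) (Z x) -
    g.inner x (J x (Y x)) (leviCivita g Z x v) = _
  rw [inner_sub_left]
  ring

/-- `∇ω` has type `(2,0) + (0,2)` in its last two arguments. -/
lemma covD_kahlerForm_J {x : M} (u v w : TangentSpace 𝓘(ℝ, E) x) :
    covD (fun _ => leviCivita g) (kahlerForm g J) x ![u, J x v, w] =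
      covD (fun _ => leviCivita g) (kahlerForm g J) x ![u, v, J x w] := by
  obtain ⟨Y, hY, rfl⟩ := exists_smoothVF v
  refine (covD_kahlerForm hJ hg (hY.end hJ) u w).trans ?_
  rw [covD_kahlerForm hJ hg hY]
  have h1 : leviCivita g (fun y => J y (J y (Y y))) x u = -leviCivita g Y x u := by
    have h2 : (fun y => J y (J y (Y y))) = fun y => (-1 : ℝ) • Y y := by
      funext y; rw [hJ.sq, neg_one_smul]
    rw [h2, (isConnection_leviCivita g).leibniz (φ := fun _ => -1) contMDiff_const hY,
      dirDeriv_const]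
    simp
  have h3 := inner_J_left hJ hg (leviCivita g (fun y => J y (Y y)) x u - J x (leviCivita g Y x u)) w
  rw [map_sub, hJ.sq, inner_sub_left, inner_neg_left] at h3
  rw [h1, inner_sub_left, inner_neg_left]
  linarith

/-- The vanishing of the Nijenhuis tensor in terms of `∇ω`. -/
lemma covD_kahlerForm_integrable {x : M} (u v w : TangentSpace 𝓘(ℝ, E) x) :
    covD (fun _ => leviCivita g) (kahlerForm g J) x ![J x u, v, w]
      - covD (fun _ => leviCivita g) (kahlerForm g J) x ![J x v, u, w]
      - covD (fun _ => leviCivita g) (kahlerForm g J) x ![v, u, J x w]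
      + covD (fun _ => leviCivita g) (kahlerForm g J) x ![u, v, J x w] = 0 := by
  obtain ⟨X, hX, rfl⟩ := exists_smoothVF u
  obtain ⟨Y, hY, rfl⟩ := exists_smoothVF v
  have h := hJ.integrable x X Y (hX x) (hY x)
  rw [← leviCivita_sub_leviCivita g (hX.end hJ) (hY.end hJ),
    ← leviCivita_sub_leviCivita g (hX.end hJ) hY, ← leviCivita_sub_leviCivita g hX (hY.end hJ),
    ← leviCivita_sub_leviCivita g hX hY] at h
  have h1 := congrArg (fun z => g.inner x z w) h
  simp only [fun a b => map_sub (J x) a b, inner_sub_left, inner_zero_left, inner_J_left hJ hg] at h1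
  simp only [covD_kahlerForm hJ hg hX, covD_kahlerForm hJ hg hY, inner_sub_left,
    inner_J_left hJ hg]
  simp only [hJ.sq, inner_neg_right]
  linarith

/-- On a complex manifold `∇ω` is determined by its `(2,1) + (1,2)` part. -/
lemma covD_kahlerForm_J_left {x : M} (u v w : TangentSpace 𝓘(ℝ, E) x) :
    covD (fun _ => leviCivita g) (kahlerForm g J) x ![J x u, v, w] =
      -covD (fun _ => leviCivita g) (kahlerForm g J) x ![u, v, J x w] := by
  have hs := fun (a b c : TangentSpace 𝓘(ℝ, E) x) =>
    covD_two_skew (g := g) (isTensor_kahlerForm (g := g) hJ) (isSkew₂_kahlerForm hJ hg) a b c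
  have hJJ := fun (a b c : TangentSpace 𝓘(ℝ, E) x) => covD_kahlerForm_J hJ hg a b c
  -- `B(u, v, w) = ∇ω(Ju, v, w) + ∇ω(u, v, Jw)` is symmetric in `u, v` and skew in `v, w`
  have i1 := covD_kahlerForm_integrable hJ hg u v w
  have i2 := covD_kahlerForm_integrable hJ hg v w u
  have i3 := covD_kahlerForm_integrable hJ hg w u v
  linarith [hs (J x u) v w, hs (J x v) w u, hs (J x w) u v, hs u v (J x w), hs v w (J x u),
    hs w u (J x v), hs u w (J x v), hs v u (J x w), hs w v (J x u), hJJ u v w, hJJ v w u, hJJ w u v,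
    hJJ u w v, hJJ v u w, hJJ w v u]

end Hermitian

/-! ### Pluriclosed solitons and the main statement -/

section Pluriclosed

variable {E : Type*} [NormedAddCommGroup E] [NormedSpace ℝ E] [FiniteDimensional ℝ E]
  {M : Type*} [TopologicalSpace M] [T2Space M] [ChartedSpace E M] [IsManifold 𝓘(ℝ, E) ∞ M]
  {g : RMetric E M} {H : TField E M 3} {J : EndField E M} {f : M → ℝ}

omit [FiniteDimensional ℝ E] [T2Space M] in
lemma IsDiffForm.isSkew₂ {T : TField E M 2} (hT : IsDiffForm T) : IsSkew₂ T := fun x u v => by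
  obtain ⟨A, hA⟩ := hT.alternating x
  have h := A.map_swap ![u, v] (i := 0) (j := 1) (by decide)
  have h1 : ![u, v] ∘ Equiv.swap 0 1 = ![v, u] := by
    funext i; fin_cases i <;> rfl
  rw [h1] at h
  simp only [hA, h, neg_neg]

/-- `H = -dᶜω = dω(J·, J·, J·)`. -/
lemma neg_dc_kahlerForm (hJ : IsComplexStructure J)
    (hg : ∀ x v w, g.inner x (J x v) (J x w) = g.inner x v w) :
    -dc J (kahlerForm g J) = pullEnd J (extD (kahlerForm g J)) := by
  have h1 : pullEnd J (kahlerForm g J) = kahlerForm g J := by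
    funext x w
    exact hg x (J x (w 0)) (w 1)
  have hT := isTensor_extD_two g (isTensor_kahlerForm (g := g) hJ) (isSkew₂_kahlerForm hJ hg)
  funext x w
  have h2 : ∀ {u v w : TangentSpace 𝓘(ℝ, E) x}, extD (kahlerForm g J) x ![-u, -v, -w] =
      -extD (kahlerForm g J) x ![u, v, w] := fun {u v w} => by
    rw [(hT.linear₃₀ x _ _).map_neg, (hT.linear₃₁ x _ _).map_neg, (hT.linear₃₂ x _ _).map_neg,
      neg_neg]
  change -(extD (pullEnd J (kahlerForm g J)) x fun i => -J x (w i)) =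
    extD (kahlerForm g J) x fun i => J x (w i)
  rw [h1, eq_vec₃ (fun i => -J x (w i)), eq_vec₃ (fun i => J x (w i)), h2, neg_neg]

lemma torsion_eq (hs : IsPluriclosedSteadySoliton g H J f) {x : M} (u v w : TangentSpace 𝓘(ℝ, E) x) :
    H x ![u, v, w] = extD (kahlerForm g J) x ![J x u, J x v, J x w] := by
  rw [hs.torsion, neg_dc_kahlerForm hs.complexStructure hs.hermitian]
  exact congrArg (extD (kahlerForm g J) x) (eq_vec₃ _)

lemma IsPluriclosedSteadySoliton.isSteadySoliton (hs : IsPluriclosedSteadySoliton g H J f) :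
    IsSteadySoliton g H f where
  tensor := by
    rw [hs.torsion, neg_dc_kahlerForm hs.complexStructure hs.hermitian]
    exact (isTensor_extD_two g (isTensor_kahlerForm hs.complexStructure)
      (isSkew₂_kahlerForm hs.complexStructure hs.hermitian)).pullEnd hs.complexStructure
  skew := fun x u v w => by
    have h := isSkew₂_kahlerForm hs.complexStructure hs.hermitian
    have hsk := fun (a b c : TangentSpace 𝓘(ℝ, E) x) =>
      covD_two_skew (g := g) (isTensor_kahlerForm (g := g) hs.complexStructure) h a b c
    simp only [torsion_eq hs, extD_two g h]
    constructor <;> linarith [hsk (J x u) (J x v) (J x w), hsk (J x v) (J x u) (J x w),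
      hsk (J x w) (J x u) (J x v)]
  closed := by rw [hs.torsion, extD_neg, hs.pluriclosed, neg_zero]
  smooth := hs.smooth
  ricci_eq := hs.ricci_eq
  dStar_eq := hs.dStar_eq

/-- The Bismut connection `∇⁺` preserves `J`. -/
lemma bismutPlus_J (hs : IsPluriclosedSteadySoliton g H J f) {Y : VField E M} (hY : SmoothVF Y)
    (x : M) (v : TangentSpace 𝓘(ℝ, E) x) :
    bismutPlus g H (fun y => J y (Y y)) x v = J x (bismutPlus g H Y x v) := by
  have hJ := hs.complexStructure
  have hg := hs.hermitian
  have hω := isSkew₂_kahlerForm hJ hg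
  have hH := hs.isSteadySoliton.tensor
  refine eq_of_inner_eq g fun z => ?_
  rw [inner_J_left hJ hg, bismutPlus, bismut_eq, bismut_eq, inner_add_left, inner_add_left,
    inner_smul_left, inner_smul_left, inner_torsionVec g hH, inner_torsionVec g hH,
    torsion_eq hs, torsion_eq hs, extD_two g hω, extD_two g hω, hJ.sq, hJ.sq]
  have h1 := covD_kahlerForm hJ hg hY v z
  rw [inner_sub_left, inner_J_left hJ hg] at h1
  generalize Y x = u at *
  have hA := isTensor_covD (fun _ => isConnection_leviCivita g) (isTensor_kahlerForm (g := g) hJ)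
  have n0 := fun (a b c : TangentSpace 𝓘(ℝ, E) x) => (hA.linear₃₀ x b c).map_neg a
  have n1 := fun (a b c : TangentSpace 𝓘(ℝ, E) x) => (hA.linear₃₁ x a c).map_neg b
  have n2 := fun (a b c : TangentSpace 𝓘(ℝ, E) x) => (hA.linear₃₂ x a b).map_neg c
  have hl := fun (a b c : TangentSpace 𝓘(ℝ, E) x) => covD_kahlerForm_J_left hJ hg a b c
  have hm := fun (a b c : TangentSpace 𝓘(ℝ, E) x) => covD_kahlerForm_J hJ hg a b c
  have hsk := fun (a b c : TangentSpace 𝓘(ℝ, E) x) =>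
    covD_two_skew (g := g) (isTensor_kahlerForm (g := g) hJ) hω a b c
  simp only [n0, n1, n2, hl, hm, hJ.sq]
  linarith [hsk v u z, hsk u v z, hsk z v u]

/-- `∇̄` commutes with `T ↦ T(·, J·)`, since `∇⁺` acts on the last argument. -/
lemma mixedD_compJ (hs : IsPluriclosedSteadySoliton g H J f) {T : TField E M 2} (hT : IsTensor T)
    {x : M} (u v w : TangentSpace 𝓘(ℝ, E) x) :
    mixedD g H (compJ J T) x ![u, v, w] = mixedD g H T x ![u, v, J x w] := by
  have hH := hs.isSteadySoliton.tensor
  have hJ := hs.complexStructure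
  obtain ⟨Y, hY, rfl⟩ := exists_smoothVF v
  obtain ⟨Z, hZ, rfl⟩ := exists_smoothVF w
  have hD : ∀ i : Fin 2, IsConnection (![bismutMinus g H, bismutPlus g H] i) := by
    simp [Fin.forall_fin_two, bismutMinus, bismutPlus, isConnection_bismut g hH]
  refine (covD_two hD (isTensor_compJ hJ hT) hY hZ x u).trans ?_
  refine Eq.trans ?_ (covD_two hD hT hY (hZ.end hJ) x u).symm
  refine congrArg₂ (· - ·) rfl ?_
  exact congrArg (fun z => T x ![Y x, z]) (bismutPlus_J hs hZ x u).symm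

lemma covD_mixedD_compJ (hs : IsPluriclosedSteadySoliton g H J f) {T : TField E M 2}
    (hT : IsTensor T) {x : M} (t u v w : TangentSpace 𝓘(ℝ, E) x) :
    covD ![leviCivita g, bismutMinus g H, bismutPlus g H] (mixedD g H (compJ J T)) x ![t, u, v, w] =
      covD ![leviCivita g, bismutMinus g H, bismutPlus g H] (mixedD g H T) x ![t, u, v, J x w] := by
  have hH := hs.isSteadySoliton.tensor
  have hJ := hs.complexStructure
  obtain ⟨X, hX, rfl⟩ := exists_smoothVF u
  obtain ⟨Y, hY, rfl⟩ := exists_smoothVF v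
  obtain ⟨Z, hZ, rfl⟩ := exists_smoothVF w
  have hD : ∀ i : Fin 3, IsConnection (![leviCivita g, bismutMinus g H, bismutPlus g H] i) := by
    simp [Fin.forall_fin_succ, bismutMinus, bismutPlus, isConnection_bismut g hH,
      isConnection_leviCivita g]
  refine (covD_three hD (isTensor_mixedD hH (isTensor_compJ hJ hT)) hX hY hZ x t).trans ?_
  refine Eq.trans ?_ (covD_three hD (isTensor_mixedD hH hT) hX hY (hZ.end hJ) x t).symm
  simp only [mixedD_compJ hs hT]
  refine congrArg₂ (· - ·) rfl ?_
  exact congrArg (fun z => mixedD g H T x ![X x, Y x, z]) (bismutPlus_J hs hZ x t).symm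

/-- `R⁺(X, Y)` commutes with `J`. -/
lemma curv_bismutPlus_J (hs : IsPluriclosedSteadySoliton g H J f) {x : M}
    (t u v w : TangentSpace 𝓘(ℝ, E) x) :
    curv g (bismutPlus g H) x ![t, u, J x v, w] = -curv g (bismutPlus g H) x ![t, u, v, J x w] := by
  have hB : IsConnection (bismutPlus g H) := isConnection_bismut g hs.isSteadySoliton.tensor 1
  obtain ⟨X, hX, rfl⟩ := exists_smoothVF t
  obtain ⟨Y, hY, rfl⟩ := exists_smoothVF u
  obtain ⟨Z, hZ, rfl⟩ := exists_smoothVF v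
  refine (curv_eq g hB hX hY (hZ.end hs.complexStructure) x w).trans ?_
  rw [curv_eq g hB hX hY hZ, ← inner_J_left hs.complexStructure hs.hermitian]
  congr 2
  simp only [curvVec, bismutPlus_J hs hZ, bismutPlus_J hs (hB.smooth hX hZ),
    bismutPlus_J hs (hB.smooth hY hZ), map_sub]

omit [T2Space M] in
/-- A skew endomorphism can be moved across a trace. -/
lemma sum_onb_skew {x : M} {A : TangentSpace 𝓘(ℝ, E) x → TangentSpace 𝓘(ℝ, E) x}
    (hA : ∀ v w, g.inner x (A v) w = -g.inner x v (A w))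
    {P Q : TangentSpace 𝓘(ℝ, E) x → ℝ} (hP : IsLinearMap ℝ P) (hQ : IsLinearMap ℝ Q) :
    ∑ a, P (onb g x a) * Q (A (onb g x a)) = -∑ a, P (A (onb g x a)) * Q (onb g x a) := by
  have h : ∀ {L : TangentSpace 𝓘(ℝ, E) x → ℝ}, IsLinearMap ℝ L → ∀ a, L (A (onb g x a)) =
      ∑ b, g.inner x (A (onb g x a)) (onb g x b) * L (onb g x b) := fun {L} hL a => by
    conv_lhs => rw [← sum_inner_onb g (A (onb g x a)), linear_apply_sum_smul hL]
    rfl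
  simp only [h hP, h hQ, Finset.mul_sum, Finset.sum_mul]
  rw [Finset.sum_comm, ← Finset.sum_neg_distrib]
  refine Finset.sum_congr rfl fun b _ => ?_
  rw [← Finset.sum_neg_distrib]
  refine Finset.sum_congr rfl fun a _ => ?_
  rw [hA, g.symm x (onb g x a)]
  ring

/-- `L̄_f (T ∘ J) = (L̄_f T) ∘ J`. -/
lemma Lbar_compJ (hs : IsPluriclosedSteadySoliton g H J f) {T : TField E M 2} (hT : IsTensor T)
    {x : M} (u v : TangentSpace 𝓘(ℝ, E) x) :
    Lbar g H f (compJ J T) x ![u, v] = Lbar g H f T x ![u, J x v] := by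
  have hJ := hs.complexStructure
  have hB : IsConnection (bismutPlus g H) := isConnection_bismut g hs.isSteadySoliton.tensor 1
  simp only [Lbar_apply, mixedD_compJ hs hT, covD_mixedD_compJ hs hT]
  refine congrArg _ (Finset.sum_congr rfl fun k _ => ?_)
  have hl : IsLinearMap ℝ (fun z => curv g (bismutPlus g H) x ![u, onb g x k, z, v]) := by
    obtain ⟨X, hX, rfl⟩ := exists_smoothVF u
    obtain ⟨Y, hY, hYx⟩ := exists_smoothVF (onb g x k)
    rw [← hYx]
    constructor
    · intro a b
      obtain ⟨A, hA, rfl⟩ := exists_smoothVF a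
      obtain ⟨B, hB', rfl⟩ := exists_smoothVF b
      rw [curv_eq g hB hX hY hA, curv_eq g hB hX hY hB', ← inner_add_left,
        ← curvVec_add_right hB hX hY hA hB']
      exact curv_eq g hB hX hY (hA.add hB') x v
    · intro r a
      obtain ⟨A, hA, rfl⟩ := exists_smoothVF a
      rw [curv_eq g hB hX hY hA, smul_eq_mul, ← inner_smul_left,
        ← curvVec_smul_right (φ := fun _ => r) hB contMDiff_const hX hY hA]
      exact curv_eq g hB hX hY (hA.const_smul r) x v
  refine (sum_onb_skew (g := g) (A := J x) (fun a b => inner_J_left hJ hs.hermitian a b) hl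
    (hT.linear₂₁ x (onb g x k))).trans ?_
  rw [← Finset.sum_neg_distrib]
  exact Finset.sum_congr rfl fun l _ => by rw [curv_bismutPlus_J hs, neg_mul, neg_neg]

lemma Lbar_eq_zero_of_compJ (hs : IsPluriclosedSteadySoliton g H J f) {T : TField E M 2}
    (hT : IsTensor T) (h : Lbar g H f (compJ J T) = 0) : Lbar g H f T = 0 := by
  funext x w
  have h1 := Lbar_compJ hs hT (w 0) (-J x (w 1))
  rw [h, map_neg, hs.complexStructure.sq, neg_neg] at h1
  rw [eq_vec₂ w]
  exact h1.symm

omit [FiniteDimensional ℝ E] [T2Space M] in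
lemma compJ_compJ (hJ : IsComplexStructure J) {T : TField E M 2} (hT : IsTensor T) :
    compJ J (compJ J T) = -T := by
  funext x w
  change T x ![w 0, J x (J x (w 1))] = -T x w
  rw [hJ.sq, (hT.linear₂₁ x (w 0)).map_neg, ← eq_vec₂ w]

end Pluriclosed

end PluriclosedSoliton

end

open scoped Manifold ContDiff
open PluriclosedSoliton
theorem proposition5p9
    {E : Type*} [NormedAddCommGroup E] [NormedSpace ℝ E] [FiniteDimensional ℝ E]
    {M : Type*} [TopologicalSpace M] [T2Space M] [CompactSpace M] [ChartedSpace E M]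
    [IsManifold 𝓘(ℝ, E) ∞ M]
    (g : RMetric E M) (H : TField E M 3) (J : EndField E M) (f : M → ℝ)
    (hsol : IsPluriclosedSteadySoliton g H J f)
    (ξ : TField E M 2) (hξ : IsDiffForm ξ) :
    (Lbar g H f ξ = 0 ↔ extD ξ = 0 ∧ dStar g f ξ = 0 ∧ dStarB g H f ξ = 0) ∧
    (compJ J ξ ∈ IGSD g H f → hodgeLap g f (compJ J (compJ J ξ)) = 0) := by
  have hT := hξ.isTensor
  have hskew : IsSkew₂ ξ := hξ.isSkew₂
  have hs := hsol.isSteadySoliton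
  refine ⟨⟨fun h => eq_zero_of_Lbar_eq_zero hs hT hskew h,
    fun ⟨h1, h2, h3⟩ => Lbar_eq_zero hs hT hskew h1 h2 h3⟩, fun ⟨_, hL, _⟩ => ?_⟩
  obtain ⟨h1, h2, -⟩ := eq_zero_of_Lbar_eq_zero hs hT hskew (Lbar_eq_zero_of_compJ hsol hT hL)
  rw [compJ_compJ hsol.complexStructure hT]
  exact hodgeLap_neg_eq_zero g h1 h2
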